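/- **Setting.** Types are $\sigma ::= \mathbb N \mid \sigma\to\sigma$; every type is written $\sigma_0,\ldots,\sigma_{r-1}\to\mathbb N$, and $\mathrm{lv}(\mathbb N)=0$, $\mathrm{lv}(\sigma\to\tau)=\max(\mathrm{lv}(\sigma)+1,\mathrm{lv}(\tau))$. An environment $\Gamma$ is a finite list of distinct typed variables. All syntax below is well-typed and taken up to $\alpha$-equivalence. *Nested sequential procedures* are the possibly infinite (coinductively generated) terms of the grammar $$\text{procedures } p,q ::= \lambda x_0\cdots x_{r-1}.\,e,\qquad \text{expressions } d,e ::= \bot \mid n \mid \mathtt{case}\ a\ \mathtt{of}\ (i\Rightarrow e_i\mid i\in\mathbb N),\qquad \text{applications } a ::= x\,q_0\cdots q_{r-1},$$ where applications are fully applied, and a procedure of type $\sigma_0,\ldots,\sigma_{r-1}\to\mathbb N$ abstracts exactly $r$ variables. We write $\Gamma\vdash p:\sigma$ for a procedure-in-environment. *Meta-terms* are generated likewise (coinductively) by $P,Q ::= \lambda\vec x.E$; $\;E ::= \bot\mid n\mid \mathtt{case}\ G\ \mathtt{of}\ (i\Rightarrow E_i)$; $\;G ::= E\mid x\vec Q\mid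 P\vec Q$. Write $T\sqsubseteq U$ if $T$ arises from $U$ by replacing some ground subterms (possibly infinitely many) by $\bot$, and $\bigsqcup$ for suprema in this order. Substituting $P$ for $x$ in $x\vec Q$ gives the meta-term $P\vec Q$, with the substitution also carried out in $\vec Q$. *Evaluation.* Basic reductions of ground meta-terms are $(\lambda\vec x.E)\vec Q\rightsquigarrow E[\vec x\mapsto\vec Q]$; $\ \mathtt{case}\ \bot\ \mathtt{of}\ (i\Rightarrow E_i)\rightsquigarrow\bot$; $\ \mathtt{case}\ n\ \mathtt{of}\ (i\Rightarrow E_i)\rightsquigarrow E_n$; and $\mathtt{case}\ (\mathtt{case}\ G\ \mathtt{of}\ (i\Rightarrow E_i))\ \mathtt{of}\ (j\Rightarrow F_j)\rightsquigarrow \mathtt{case}\ G\ \mathtt{of}\ (i\Rightarrow\mathtt{case}\ E_i\ \mathtt{of}\ (j\Rightarrow F_j))$. Head reduction applies basic reductions at the root or, repeatedly, in the scrutinee of a $\mathtt{case}$ when that scrutinee is not itself a $\mathtt{case}$ meta-term, and under $\lambda$. General reduction $\rightsquigarrow$ is generated by head reduction together with reduction under $\lambda$, reduction of one argument $Q_j$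 in $x\vec Q$ or in $\mathtt{case}\ x\vec Q\ \mathtt{of}\ (i\Rightarrow E_i)$, and reduction of one branch $E_i$ in $\mathtt{case}\ x\vec Q\ \mathtt{of}\ (i\Rightarrow E_i)$. A term is *finite* if it is generated inductively by the grammar for procedures, expressions and applications, each $\mathtt{case}$ having only finitely many branches different from $\bot$. The value of $T$ is $$\langle\!\langle T\rangle\!\rangle=\bigsqcup\{t\ \text{a finite term}\mid \exists T'.\ T\rightsquigarrow^*T',\ t\sqsubseteq T'\}.$$ *Interpretation.* $\mathrm{PCF}^\Omega_k$ ($k\in\mathbb N$) is the simply typed $\lambda$-calculus with constants $\widehat n:\mathbb N$; $\mathit{suc},\mathit{pre}:\mathbb N\to\mathbb N$; $\mathit{ifzero}:\mathbb N\to\mathbb N\to\mathbb N\to\mathbb N$; $C_f:\mathbb N\to\mathbb N$ for every partial function $f:\mathbb N\rightharpoonup\mathbb N$; and $Y_\sigma:(\sigma\to\sigma)\to\sigma$ for every $\sigma$ of level $\le k$. Let $x^\eta=\lambda z_0\cdots z_{r-1}.\,\mathtt{case}\ x z_0^\eta\cdots z_{r-1}^\eta\ \mathtt{of}\ (i\Rightarrow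 i)$. A term $\Gamma\vdash M:\sigma$ denotes a procedure $\Gamma\vdash[\![M]\!]_\Gamma:\sigma$ defined by $[\![x]\!]=x^\eta$; $[\![\widehat n]\!]=\lambda.n$; $[\![\lambda x.M]\!]_\Gamma=\lambda x.[\![M]\!]_{\Gamma,x}$; $[\![MN]\!]=[\![M]\!]\cdot[\![N]\!]$, where $(\lambda x\vec y.e)\cdot q=\lambda\vec y.\langle\!\langle e[x\mapsto q]\rangle\!\rangle$; $[\![C_f]\!]=\lambda x.\,\mathtt{case}\ x\ \mathtt{of}\ (i\Rightarrow f(i))$ with $f(i)$ read as $\bot$ where undefined; $[\![\mathit{suc}]\!]=\lambda x.\,\mathtt{case}\ x\ \mathtt{of}\ (i\Rightarrow i+1)$; $[\![\mathit{pre}]\!]=\lambda x.\,\mathtt{case}\ x\ \mathtt{of}\ (0\Rightarrow0\mid i+1\Rightarrow i)$; $[\![\mathit{ifzero}]\!]=\lambda xyz.\,\mathtt{case}\ x\ \mathtt{of}\ (0\Rightarrow\mathtt{case}\ y\ \mathtt{of}\ (j\Rightarrow j)\mid i+1\Rightarrow\mathtt{case}\ z\ \mathtt{of}\ (j\Rightarrow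 j))$; and $[\![Y_\sigma]\!]=\lambda g.F_\sigma[g]$, where corecursively $F_\sigma[g]=\lambda x_0\cdots x_{r-1}.\,\mathtt{case}\ g\,(F_\sigma[g])\,x_0^\eta\cdots x_{r-1}^\eta\ \mathtt{of}\ (i\Rightarrow i)$. A procedure $\Gamma\vdash p:\sigma$ is *$\mathrm{PCF}^\Omega_k$-denotable* if $p=[\![M]\!]_\Gamma$ for some $\mathrm{PCF}^\Omega_k$ term $\Gamma\vdash M:\sigma$. *Leaf replacement and plugging.* The rightward numeral leaves of a procedure or expression are those reached by passing only through its outermost $\lambda\vec x$ (if any) and through branches of $\mathtt{case}$ (never into arguments); $t[i\mapsto e_i]$ is the result of replacing each rightward leaf $i$ of $t$ by $e_i$ (avoiding variable capture). For a finite list $Z$ of variables disjoint from $\Gamma$, an expression $\Gamma,Z\vdash e$, and procedures $\Gamma,Z\vdash\xi(z):\sigma$ for $z^\sigma\in Z$, let $\Pi^0(e,\xi)=e$, $\ \Pi^{m+1}(e,\xi)=\Pi^m(e,\xi)[z\mapsto\xi(z)\text{ for all }z\in Z]$ and $\Pi_{\Gamma,Z}(e,\xi)=\bigsqcup_m\Pi^m(e,\xi)^\circ$,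 where $T^\circ$ is obtained from $T$ by replacing each ground subterm $z\vec Q$ with $z\in Z$ by $\bot$. **Theorem 3.9.** For every $k$, the class of $\mathrm{PCF}^\Omega_k$-denotable procedures-in-environment $\Gamma\vdash p:\sigma$ is exactly the class generated inductively by the following rules. 1. If $x\in\Gamma$ has type $\sigma_0,\ldots,\sigma_{r-1}\to\mathbb N$ and $\Gamma\vdash q_i:\sigma_i$ is in the class for each $i<r$, then so is $\Gamma\vdash\lambda.\,\mathtt{case}\ x q_0\cdots q_{r-1}\ \mathtt{of}\ (j\Rightarrow j)$. 2. If $\Gamma,x\vdash p$ is in the class, then so is $\Gamma\vdash\lambda x.p$. 3. Each $\Gamma\vdash\lambda.n$ with $n\in\mathbb N$ is in the class. 4. If $\Gamma\vdash p$ is in the class and $f:\mathbb N\rightharpoonup\mathbb N$, then $\Gamma\vdash p[i\mapsto f(i)]$ is in the class (with $f(i)$ read as $\bot$ where undefined; $\mathit{suc}$ and $\mathit{pre}$ are special cases). 5. If $\Gamma\vdash p$, $\Gamma\vdash\lambda.d$ and $\Gamma\vdash\lambda.e$ are in the class, then so is $\Gamma\vdash p[0\mapsto d,\ i+1\mapsto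 e]$. 6. If $\sigma=\sigma_0,\ldots,\sigma_{r-1}\to\mathbb N$ has level $\le k$, $\Gamma\vdash\lambda z^{\sigma}x_0^{\sigma_0}\cdots x_{r-1}^{\sigma_{r-1}}.\,e$ is in the class, and $\Gamma\vdash q_i:\sigma_i$ is in the class for each $i<r$, then so is $\Gamma\vdash\lambda.\langle\!\langle\Pi_{\Gamma,Z}(e,\xi)\rangle\!\rangle$, where $Z=z,x_0,\ldots,x_{r-1}$ is disjoint from $\Gamma$, $\xi(z)=\lambda x_0\cdots x_{r-1}.\,e$ and $\xi(x_i)=q_i$. -/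

import Mathlib

namespace NSP

noncomputable section

/-! ### Infinite trees over an indexed signature (final coalgebras)

All syntax trees below are possibly infinite ("the grammar is read coinductively"). They are obtained
from Mathlib's final coalgebras `PFunctor.M` of polynomial functors by keeping an index at each node. -/

/-- A signature: for every index `i` the node shapes allowed there, the positions below such a
node, the index required at each position, and a designated leaf shape `bot` at every index. -/
structure Sig (I : Type) where
  Shape : I → Type
  Pos : ∀ {i}, Shape i → Type
  next : ∀ {i} (a : Shape i), Pos a → I
  bot : ∀ i, Shape i
  bot_leaf : ∀ i, IsEmpty (Pos (bot i))

variable {I : Type}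

/-- One layer of a tree. -/
abbrev Sig.Obj (S : Sig I) (X : I → Type) (i : I) : Type :=
  Σ a : S.Shape i, ∀ b : S.Pos a, X (S.next a b)

/-- The polynomial functor of nodes labelled by an index and a shape at this index. -/
abbrev Sig.toPFunctor (S : Sig I) : PFunctor := ⟨Σ i, S.Shape i, fun a => S.Pos a.2⟩

/-- `IsTree S i t`: the root of `t` has index `i`, and throughout `t` the child at a position has the
index that the signature demands there (the largest such predicate). -/
def Sig.IsTree (S : Sig I) (i : I) (t : S.toPFunctor.M) : Prop :=
  ∃ R : I → S.toPFunctor.M → Prop, R i t ∧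
    ∀ j u, R j u → u.dest.1.1 = j ∧ ∀ b, R (S.next u.dest.1.2 b) (u.dest.2 b)

/-- The possibly infinite trees over `S` with root index `i`. -/
def Tree (S : Sig I) (i : I) : Type := {t : S.toPFunctor.M // S.IsTree i t}

namespace Tree

variable {S : Sig I} {i : I}

theorem root_index {t : S.toPFunctor.M} (h : S.IsTree i t) : t.dest.1.1 = i := by
  obtain ⟨R, hR, hs⟩ := h
  exact (hs _ _ hR).1

theorem isTree_child {t : S.toPFunctor.M} (h : S.IsTree i t) (b : S.Pos t.dest.1.2) :
    S.IsTree (S.next t.dest.1.2 b) (t.dest.2 b) := by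
  obtain ⟨R, hR, hs⟩ := h
  exact ⟨R, (hs _ _ hR).2 b, hs⟩

/-- The root shape of a tree together with its immediate subtrees. -/
def dest (t : Tree S i) : S.Obj (Tree S) i :=
  root_index t.2 ▸
    (⟨t.1.dest.1.2, fun b => ⟨t.1.dest.2 b, isTree_child t.2 b⟩⟩ :
      S.Obj (Tree S) t.1.dest.1.1)

/-- Build a tree from its root shape and its immediate subtrees. -/
def mk (x : S.Obj (Tree S) i) : Tree S i :=
  ⟨PFunctor.M.mk (F := S.toPFunctor) ⟨⟨i, x.1⟩, fun b => (x.2 b).1⟩, by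
    refine ⟨fun j u => S.IsTree j u ∨
      (j = i ∧ u = PFunctor.M.mk (F := S.toPFunctor) ⟨⟨i, x.1⟩, fun b => (x.2 b).1⟩), Or.inr ⟨rfl, rfl⟩, ?_⟩
    rintro j u (h | ⟨rfl, rfl⟩)
    · exact ⟨root_index h, fun b => Or.inl (isTree_child h b)⟩
    · exact ⟨rfl, fun b => Or.inl (x.2 b).2⟩⟩

/-- The coalgebra of `PFunctor.M` underlying `corec`. -/
def corecFun {X : I → Type} (f : ∀ i, X i → S.Obj X i) (y : Σ i, X i) :
    S.toPFunctor (Σ i, X i) :=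
  ⟨⟨y.1, (f y.1 y.2).1⟩, fun b => ⟨_, (f y.1 y.2).2 b⟩⟩

/-- Corecursion: unfold a coalgebra `f` into a tree. -/
def corec {X : I → Type} (f : ∀ i, X i → S.Obj X i) (x : X i) : Tree S i :=
  ⟨PFunctor.M.corec (corecFun f) ⟨i, x⟩, by
    refine ⟨fun j u => ∃ y : X j, u = PFunctor.M.corec (corecFun f) ⟨j, y⟩, ⟨x, rfl⟩, ?_⟩
    rintro j u ⟨y, rfl⟩
    rw [PFunctor.M.dest_corec]
    exact ⟨rfl, fun b => ⟨(f j y).2 b, rfl⟩⟩⟩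

theorem val_dest (t : Tree S i) :
    t.1.dest = ⟨⟨i, t.dest.1⟩, fun b => (t.dest.2 b).1⟩ := by
  obtain ⟨t, h⟩ := t
  have e := root_index h
  subst e
  rfl

theorem dest_mk (x : S.Obj (Tree S) i) : (mk x).dest = x := rfl

theorem dest_corec {X : I → Type} (f : ∀ i, X i → S.Obj X i) (x : X i) :
    (corec f x : Tree S i).dest = ⟨(f i x).1, fun b => corec f ((f i x).2 b)⟩ := by
  have h : (corec f x : Tree S i) = mk ⟨(f i x).1, fun b => corec f ((f i x).2 b)⟩ := by
    apply Subtype.ext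
    change PFunctor.M.corec (corecFun f) ⟨i, x⟩ = PFunctor.M.mk _
    rw [← PFunctor.M.mk_dest (PFunctor.M.corec (corecFun f) ⟨i, x⟩), PFunctor.M.dest_corec]
    rfl
  rw [h, dest_mk]

theorem bisim (R : ∀ i, Tree S i → Tree S i → Prop)
    (h : ∀ i t u, R i t u → ∃ a f g, t.dest = ⟨a, f⟩ ∧ u.dest = ⟨a, g⟩ ∧ ∀ b, R _ (f b) (g b))
    {t u : Tree S i} (htu : R i t u) : t = u := by
  apply Subtype.ext
  refine PFunctor.M.bisim (fun x y => ∃ i, ∃ t u : Tree S i, R i t u ∧ t.1 = x ∧ u.1 = y) ?_ _ _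
    ⟨i, t, u, htu, rfl, rfl⟩
  rintro _ _ ⟨j, t, u, r, rfl, rfl⟩
  obtain ⟨a, f, g, ht, hu, hr⟩ := h _ _ _ r
  refine ⟨⟨j, a⟩, fun b => (f b).1, fun b => (g b).1, ?_, ?_, fun b => ⟨_, _, _, hr b, rfl, rfl⟩⟩
  · rw [val_dest, ht]
  · rw [val_dest, hu]

theorem mk_dest (t : Tree S i) : mk t.dest = t := by
  refine bisim (fun j x y => x = y ∨ x = mk y.dest) ?_ (Or.inr rfl)
  rintro j x y (rfl | rfl)
  · exact ⟨x.dest.1, x.dest.2, x.dest.2, rfl, rfl, fun b => Or.inl rfl⟩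
  · exact ⟨y.dest.1, y.dest.2, y.dest.2, rfl, rfl, fun b => Or.inl rfl⟩

/-- The leaf `⊥`. -/
def bot (S : Sig I) (i : I) : Tree S i := mk ⟨S.bot i, fun b => ((S.bot_leaf i).false b).elim⟩

/-- The syntactic order: `t ⊑ u` iff `t` arises from `u` by replacing some subtrees
(perhaps infinitely many) by `⊥`. -/
instance : LE (Tree S i) where
  le t u := ∃ R : ∀ i, Tree S i → Tree S i → Prop, R i t u ∧
    ∀ j t u, R j t u → t = bot S j ∨
      ∃ a f g, t = mk ⟨a, f⟩ ∧ u = mk ⟨a, g⟩ ∧ ∀ b, R _ (f b) (g b)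

open Classical in
/-- The supremum of a set of trees in the syntactic order (used only for directed sets,
which always have a supremum; it is unique since the order is antisymmetric). -/
def sup (A : Set (Tree S i)) : Tree S i :=
  if h : ∃ t, IsLUB A t then h.choose else bot S i

end Tree

/-! ### Types, environments and variables -/

/-- Simple types over the natural numbers. -/
inductive Ty : Type
  | nat : Ty
  | arrow : Ty → Ty → Ty

/-- The list `σ₀, …, σᵣ₋₁` of argument types of `σ = σ₀, …, σᵣ₋₁ → ℕ`. -/
abbrev Ty.args : Ty → List Ty
  | .nat => []
  | .arrow σ τ => σ :: τ.args

/-- The level of a type. -/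
def Ty.level : Ty → ℕ
  | .nat => 0
  | .arrow σ τ => max (σ.level + 1) τ.level

/-- An environment is a finite list of typed variables. Variables are identified with their places in
the list (de Bruijn), the most recently added variable standing first; this represents syntax up to
`α`-equivalence, and the variables of an environment are automatically distinct. -/
abbrev Ctx := List Ty

/-- `Var Γ ρ`: the variables of type `ρ` in `Γ`. -/
inductive Var : Ctx → Ty → Type
  | here {Γ : Ctx} {ρ : Ty} : Var (ρ :: Γ) ρ
  | there {Γ : Ctx} {ρ σ : Ty} : Var Γ ρ → Var (σ :: Γ) ρ

/-- `ext Γ [σ₀, …, σᵣ₋₁]` is the environment `Γ, x₀, …, xᵣ₋₁` with new variables `xᵢ` of type `σᵢ`. -/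
abbrev ext : Ctx → List Ty → Ctx
  | Γ, [] => Γ
  | Γ, σ :: σs => ext (σ :: Γ) σs

/-- A variable of `Γ`, seen in `Γ, x₀, …, xᵣ₋₁`. -/
def Var.wk {ρ : Ty} : {Γ : Ctx} → (σs : List Ty) → Var Γ ρ → Var (ext Γ σs) ρ
  | _, [], v => v
  | _, _ :: σs, v => Var.wk σs (.there v)

/-- The variable `xᵢ` of `Γ, x₀, …, xᵣ₋₁`. (Places in the list `σs` are elements of `Var σs ρ`.) -/
def Var.new {ρ : Ty} : (Γ : Ctx) → {σs : List Ty} → Var σs ρ → Var (ext Γ σs) ρ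
  | _, _ :: σs, .here => Var.wk σs .here
  | _, σ :: _, .there v => Var.new (σ :: _) v

/-- A variable of `Γ, x₀, …, xᵣ₋₁` is either one of `Γ` or one of the `xᵢ`. -/
def Var.split {ρ : Ty} : {Γ : Ctx} → (σs : List Ty) → Var (ext Γ σs) ρ → Var Γ ρ ⊕ Var σs ρ
  | _, [], v => .inl v
  | _, _ :: σs, v =>
    match Var.split σs v with
    | .inr w => .inr (.there w)
    | .inl .here => .inr .here
    | .inl (.there w) => .inl w

/-- The places of a list of types. -/
abbrev Place (σs : List Ty) : Type := Σ ρ : Ty, Var σs ρ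

/-! ### Nested sequential procedures (terms) -/

/-- Node shapes of expressions: `⊥`, a numeral, or `case x q₀ … qᵣ₋₁ of (j ⇒ eⱼ)`. -/
inductive ExpShape (Γ : Ctx) : Type
  | bot : ExpShape Γ
  | num (n : ℕ) : ExpShape Γ
  | case (σ : Ty) (x : Var Γ σ) : ExpShape Γ

/-- Below a `case` there are the arguments `qᵢ` and the branches `eⱼ`. -/
abbrev ExpShape.Pos {Γ : Ctx} : ExpShape Γ → Type
  | .bot => Empty
  | .num _ => Empty
  | .case σ _ => Place σ.args ⊕ ℕ

/-- A procedure `λ y⃗. e` of type `ρ` in `Γ` has its body `e` in `Γ, y⃗`. -/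
abbrev ExpShape.next {Γ : Ctx} : (a : ExpShape Γ) → a.Pos → Ctx
  | .bot, b => nomatch b
  | .num _, b => nomatch b
  | .case _ _, .inl v => ext Γ v.1.args
  | .case _ _, .inr _ => Γ

abbrev expSig : Sig Ctx where
  Shape := ExpShape
  Pos := ExpShape.Pos
  next := ExpShape.next
  bot _ := .bot
  bot_leaf _ := inferInstanceAs (IsEmpty Empty)

/-- Well-typed expressions `Γ ⊢ e`, up to `α`-equivalence. -/
abbrev Exp (Γ : Ctx) : Type := Tree expSig Γ

/-- Well-typed procedures `Γ ⊢ p : σ`, up to `α`-equivalence. For `σ = σ₀, …, σᵣ₋₁ → ℕ` such a procedure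
is `λ x₀ … xᵣ₋₁. e` with `Γ, x₀, …, xᵣ₋₁ ⊢ e`, and it is represented by its body `e`. -/
def Proc (Γ : Ctx) (σ : Ty) : Type := Exp (ext Γ σ.args)

/-- `λ x₀ … xᵣ₋₁. e` -/
def Proc.mk {Γ : Ctx} (σ : Ty) (e : Exp (ext Γ σ.args)) : Proc Γ σ := e

/-- The body `e` of `λ x₀ … xᵣ₋₁. e`. -/
def Proc.body {Γ : Ctx} {σ : Ty} (p : Proc Γ σ) : Exp (ext Γ σ.args) := p

/-- `λ x. p`: from `p = λ y⃗. e` in `Γ, x` to `λ x y⃗. e` in `Γ`. -/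
def Proc.lam {Γ : Ctx} {σ τ : Ty} (p : Proc (σ :: Γ) τ) : Proc Γ (.arrow σ τ) :=
  Proc.mk (.arrow σ τ) p.body

/-- The body of `λ x y⃗. e` as the procedure `λ y⃗. e` in `Γ, x`. -/
def Proc.unlam {Γ : Ctx} {σ τ : Ty} (p : Proc Γ (.arrow σ τ)) : Proc (σ :: Γ) τ :=
  Proc.mk τ p.body

/-- `λ. e`, a procedure of type `ℕ`. -/
def Proc.const {Γ : Ctx} (e : Exp Γ) : Proc Γ .nat := Proc.mk .nat e

namespace Exp

variable {Γ Δ : Ctx}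

def bot (Γ : Ctx) : Exp Γ := Tree.bot expSig Γ

def num (n : ℕ) : Exp Γ := Tree.mk ⟨ExpShape.num n, fun b => nomatch b⟩

/-- `case x q₀ … qᵣ₋₁ of (j ⇒ eⱼ)` -/
def case {σ : Ty} (x : Var Γ σ) (q : ∀ ρ, Var σ.args ρ → Proc Γ ρ) (e : ℕ → Exp Γ) : Exp Γ :=
  Tree.mk ⟨ExpShape.case σ x, fun
    | .inl ⟨ρ, v⟩ => q ρ v
    | .inr j => e j⟩

/-- Finite expressions: finitely many nodes, a `case` having only finitely many branches other
than `⊥`. -/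
inductive Finite : {Γ : Ctx} → Exp Γ → Prop
  | bot (Γ : Ctx) : Finite (Exp.bot Γ)
  | num {Γ : Ctx} (n : ℕ) : Finite (Exp.num n : Exp Γ)
  | case {Γ : Ctx} {σ : Ty} (x : Var Γ σ) (q : ∀ ρ, Var σ.args ρ → Proc Γ ρ) (e : ℕ → Exp Γ) (N : ℕ)
      (hq : ∀ ρ v, Finite (q ρ v).body) (he : ∀ j, Finite (e j))
      (hN : ∀ j, N ≤ j → e j = Exp.bot Γ) : Finite (Exp.case x q e)

end Exp

/-! ### Renaming, `η`-expansion and leaf replacement for terms -/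

abbrev Ren (Γ Δ : Ctx) : Type := ∀ ρ, Var Γ ρ → Var Δ ρ

/-- A renaming, extended by the identity on new variables. -/
def Ren.lift {Γ Δ : Ctx} (r : Ren Γ Δ) (σs : List Ty) : Ren (ext Γ σs) (ext Δ σs) :=
  fun ρ v =>
    match Var.split σs v with
    | .inl w => Var.wk σs (r ρ w)
    | .inr w => Var.new Δ w

def Exp.renameStep (Δ : Ctx) :
    (Σ Γ : Ctx, Ren Γ Δ × Exp Γ) → expSig.Obj (fun Δ => Σ Γ : Ctx, Ren Γ Δ × Exp Γ) Δ
  | ⟨Γ, r, t⟩ =>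
    match Tree.dest t with
    | ⟨.bot, _⟩ => ⟨ExpShape.bot, fun b => nomatch b⟩
    | ⟨.num n, _⟩ => ⟨ExpShape.num n, fun b => nomatch b⟩
    | ⟨.case σ x, c⟩ => ⟨ExpShape.case σ (r σ x), fun
        | .inl v => ⟨ext Γ v.1.args, r.lift v.1.args, c (.inl v)⟩
        | .inr j => ⟨Γ, r, c (.inr j)⟩⟩

/-- Renaming of the free variables of an expression. -/
def Exp.rename {Γ Δ : Ctx} (r : Ren Γ Δ) (t : Exp Γ) : Exp Δ :=
  Tree.corec Exp.renameStep ⟨Γ, r, t⟩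

def Proc.rename {Γ Δ : Ctx} (r : Ren Γ Δ) {σ : Ty} (p : Proc Γ σ) : Proc Δ σ :=
  Proc.mk σ (p.body.rename (r.lift σ.args))

/-- A term of `Γ`, seen in `Γ, x₀, …, xᵣ₋₁`. -/
def Exp.wk {Γ : Ctx} (σs : List Ty) (t : Exp Γ) : Exp (ext Γ σs) :=
  t.rename fun _ v => Var.wk σs v

def Proc.wk {Γ : Ctx} (σs : List Ty) {ρ : Ty} (p : Proc Γ ρ) : Proc (ext Γ σs) ρ :=
  p.rename fun _ v => Var.wk σs v

theorem Var.sizeOf_lt {ρ : Ty} : {σ : Ty} → Var σ.args ρ → sizeOf ρ < sizeOf σ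
  | .nat, v => nomatch v
  | .arrow σ τ, .here => by simp only [Ty.arrow.sizeOf_spec]; omega
  | .arrow σ τ, .there v => by
    have := Var.sizeOf_lt (σ := τ) v
    simp only [Ty.arrow.sizeOf_spec]; omega

/-- The hereditary `η`-expansion `x^η = λ z₀ … zᵣ₋₁. case x z₀^η … zᵣ₋₁^η of (i ⇒ i)`. -/
def eta (σ : Ty) (Γ : Ctx) (x : Var Γ σ) : Proc Γ σ :=
  Proc.mk σ (Exp.case (Var.wk σ.args x) (fun ρ v => eta ρ (ext Γ σ.args) (Var.new Γ v)) Exp.num)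
termination_by sizeOf σ
decreasing_by exact Var.sizeOf_lt v

/-- States of the leaf replacement: `todo t` stands for `t[i ↦ eᵢ]`, and `done u` for `u`. -/
inductive LeafState (Γ : Ctx) (Δ : Ctx) : Type
  | todo (h : Δ = Γ) (t : Exp Γ) : LeafState Γ Δ
  | done (u : Exp Δ) : LeafState Γ Δ

def Exp.leafStep {Γ : Ctx} (e : ℕ → Exp Γ) (Δ : Ctx) :
    LeafState Γ Δ → expSig.Obj (LeafState Γ) Δ
  | .done u => ⟨(Tree.dest u).1, fun b => .done ((Tree.dest u).2 b)⟩
  | .todo h t => by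
    subst h
    exact
      match Tree.dest t with
      | ⟨.bot, _⟩ => ⟨ExpShape.bot, fun b => nomatch b⟩
      | ⟨.num n, _⟩ => ⟨(Tree.dest (e n)).1, fun b => .done ((Tree.dest (e n)).2 b)⟩
      | ⟨.case σ x, c⟩ => ⟨ExpShape.case σ x, fun
          | .inl v => .done (c (.inl v))
          | .inr j => .todo rfl (c (.inr j))⟩

/-- `t[i ↦ eᵢ]`: replace each rightward numeral leaf `i` of the expression `t` (that is, each one
reached from the root through branches of `case` only, not through arguments) by `eᵢ`. -/
def Exp.replaceLeaves {Γ : Ctx} (t : Exp Γ) (e : ℕ → Exp Γ) : Exp Γ :=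
  Tree.corec (Exp.leafStep e) (.todo rfl t)

/-- `p[i ↦ eᵢ]` for a procedure `p = λ x⃗. t`: it is `λ x⃗. t[i ↦ eᵢ]`, the `x⃗` not being free
in the `eᵢ`. -/
def Proc.replaceLeaves {Γ : Ctx} {σ : Ty} (p : Proc Γ σ) (e : ℕ → Exp Γ) : Proc Γ σ :=
  Proc.mk σ (p.body.replaceLeaves fun i => (e i).wk σ.args)

/-! ### Meta-terms -/

/-- The two sorts of meta-terms of ground type: meta-expressions and general ground meta-terms. -/
inductive Srt : Type
  | exp : Srt
  | gnd : Srt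

/-- Node shapes: `⊥`, numerals and `case G of (i ⇒ Eᵢ)` in both sorts (each meta-expression is also a ground
meta-term); applications `x Q⃗` and `P Q⃗` (with `P` of type `σ`) as ground meta-terms only. -/
inductive MShape (Γ : Ctx) (s : Srt) : Type
  | bot : MShape Γ s
  | num (n : ℕ) : MShape Γ s
  | case : MShape Γ s
  | app (h : s = .gnd) (σ : Ty) (x : Var Γ σ) : MShape Γ s
  | beta (h : s = .gnd) (σ : Ty) : MShape Γ s

/-- Below a `case`: the scrutinee (`none`) and the branches. Below `x Q⃗`: the arguments.
Below `P Q⃗`: the operator (`none`) and the arguments. -/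
abbrev MShape.Pos {Γ : Ctx} {s : Srt} : MShape Γ s → Type
  | .bot => Empty
  | .num _ => Empty
  | .case => Option ℕ
  | .app _ σ _ => Place σ.args
  | .beta _ σ => Option (Place σ.args)

abbrev MShape.next {Γ : Ctx} {s : Srt} : (a : MShape Γ s) → a.Pos → Srt × Ctx
  | .bot, b => nomatch b
  | .num _, b => nomatch b
  | .case, none => (.gnd, Γ)
  | .case, some _ => (.exp, Γ)
  | .app _ _ _, v => (.exp, ext Γ v.1.args)
  | .beta _ σ, none => (.exp, ext Γ σ.args)
  | .beta _ _, some v => (.exp, ext Γ v.1.args)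

abbrev metaSig : Sig (Srt × Ctx) where
  Shape i := MShape i.2 i.1
  Pos := MShape.Pos
  next := MShape.next
  bot _ := .bot
  bot_leaf _ := inferInstanceAs (IsEmpty Empty)

/-- Well-typed meta-terms of ground type in `Γ`, up to `α`-equivalence: meta-expressions `E` (sort `exp`)
and ground meta-terms `G` (sort `gnd`). -/
abbrev Meta (s : Srt) (Γ : Ctx) : Type := Tree metaSig (s, Γ)

/-- Well-typed meta-procedures `λ x⃗. E` of type `σ` in `Γ`, represented by their bodies `E`. -/
abbrev MProc (Γ : Ctx) (σ : Ty) : Type := Meta .exp (ext Γ σ.args)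

namespace Meta

variable {Γ Δ : Ctx} {s : Srt}

def bot (s : Srt) (Γ : Ctx) : Meta s Γ := Tree.bot metaSig (s, Γ)

def num (n : ℕ) : Meta s Γ := Tree.mk ⟨MShape.num n, fun b => nomatch b⟩

/-- `case G of (i ⇒ Eᵢ)` -/
def case (G : Meta .gnd Γ) (E : ℕ → Meta .exp Γ) : Meta s Γ :=
  Tree.mk ⟨MShape.case, fun
    | none => G
    | some j => E j⟩

/-- `x Q⃗` -/
def app {σ : Ty} (x : Var Γ σ) (Q : ∀ v : Place σ.args, MProc Γ v.1) : Meta .gnd Γ :=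
  Tree.mk ⟨MShape.app rfl σ x, Q⟩

/-- `P Q⃗` -/
def beta {σ : Ty} (P : MProc Γ σ) (Q : ∀ v : Place σ.args, MProc Γ v.1) : Meta .gnd Γ :=
  Tree.mk ⟨MShape.beta rfl σ, fun
    | none => P
    | some v => Q v⟩

/-- A meta-expression as a meta-term of either sort. -/
def ofExp (s : Srt) (E : Meta .exp Γ) : Meta s Γ :=
  match Tree.dest (S := metaSig) (i := (Srt.exp, Γ)) E with
  | ⟨.bot, _⟩ => Meta.bot s Γ
  | ⟨.num n, _⟩ => Meta.num n
  | ⟨.case, c⟩ => Meta.case (c none) (fun j => c (some j))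

/-- States of the inclusion of terms into meta-terms: an expression, or an application `x q⃗`. -/
abbrev IncState : Srt × Ctx → Type
  | (.exp, Γ) => Exp Γ
  | (.gnd, Γ) => Σ σ : Ty, Var Γ σ × (∀ v : Place σ.args, Proc Γ v.1)

def incStep : ∀ i, IncState i → metaSig.Obj IncState i
  | (.exp, _), t =>
    match Tree.dest (S := expSig) t with
    | ⟨.bot, _⟩ => ⟨MShape.bot, fun b => nomatch b⟩
    | ⟨.num n, _⟩ => ⟨MShape.num n, fun b => nomatch b⟩
    | ⟨.case σ x, c⟩ => ⟨MShape.case, fun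
        | none => ⟨σ, x, fun v => c (.inl v)⟩
        | some j => c (.inr j)⟩
  | (.gnd, _), ⟨σ, x, q⟩ => ⟨MShape.app rfl σ x, q⟩

/-- The inclusion of terms into meta-terms. -/
def ofTerm (t : Exp Γ) : Meta .exp Γ := Tree.corec (i := (Srt.exp, Γ)) incStep t

abbrev RenState (i : Srt × Ctx) : Type := Σ Γ : Ctx, Ren Γ i.2 × Meta i.1 Γ

def renameStep (i : Srt × Ctx) : RenState i → metaSig.Obj RenState i
  | ⟨Γ, r, T⟩ =>
    match Tree.dest (S := metaSig) T with
    | ⟨.bot, _⟩ => ⟨MShape.bot, fun b => nomatch b⟩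
    | ⟨.num n, _⟩ => ⟨MShape.num n, fun b => nomatch b⟩
    | ⟨.case, c⟩ => ⟨MShape.case, fun
        | none => ⟨Γ, r, c none⟩
        | some j => ⟨Γ, r, c (some j)⟩⟩
    | ⟨.app h σ x, c⟩ => ⟨MShape.app h σ (r σ x), fun v =>
        ⟨ext Γ v.1.args, r.lift v.1.args, c v⟩⟩
    | ⟨.beta h σ, c⟩ => ⟨MShape.beta h σ, fun
        | none => ⟨ext Γ σ.args, r.lift σ.args, c none⟩
        | some v => ⟨ext Γ v.1.args, r.lift v.1.args, c (some v)⟩⟩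

/-- Renaming of the free variables of a meta-term. -/
def rename (r : Ren Γ Δ) (T : Meta s Γ) : Meta s Δ :=
  Tree.corec (i := (s, Δ)) renameStep ⟨Γ, r, T⟩

end Meta

/-! ### Substitution -/

/-- A simultaneous substitution: each variable of `Γ` is either replaced by a meta-procedure or
kept as a variable of `Δ`. -/
abbrev Sub (Γ Δ : Ctx) : Type := ∀ ρ, Var Γ ρ → Var Δ ρ ⊕ MProc Δ ρ

/-- A substitution below a binder of the variables `x⃗`, which are kept. -/
def Sub.lift {Γ Δ : Ctx} (θ : Sub Γ Δ) (σs : List Ty) : Sub (ext Γ σs) (ext Δ σs) :=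
  fun ρ v =>
    match Var.split σs v with
    | .inr w => .inl (Var.new Δ w)
    | .inl w =>
      match θ ρ w with
      | .inl y => .inl (Var.wk σs y)
      | .inr P => .inr (P.rename (Ren.lift (fun _ u => Var.wk σs u) ρ.args))

/-- The substitution on `Γ, x₀, …, xᵣ₋₁` that replaces `xᵢ` by `Qᵢ` and keeps `Γ`. -/
def Sub.single {Γ : Ctx} (σs : List Ty) (Q : ∀ v : Place σs, MProc Γ v.1) : Sub (ext Γ σs) Γ :=
  fun ρ v =>
    match Var.split σs v with
    | .inl w => .inl w
    | .inr w => .inr (Q ⟨ρ, w⟩)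

namespace Meta

variable {Γ Δ : Ctx} {s : Srt}

/-- States of substitution: a substitution still to be applied, or a finished meta-term. -/
abbrev SubState (i : Srt × Ctx) : Type :=
  (Σ Γ : Ctx, Sub Γ i.2 × Meta i.1 Γ) ⊕ Tree metaSig i

/-- The replacement of `x` in `x Q⃗` by `P` gives `P Q⃗`. -/
def substStep (i : Srt × Ctx) : SubState i → metaSig.Obj SubState i
  | .inr U => ⟨(Tree.dest U).1, fun b => .inr ((Tree.dest U).2 b)⟩
  | .inl ⟨Γ, θ, T⟩ =>
    match Tree.dest (S := metaSig) T with
    | ⟨.bot, _⟩ => ⟨MShape.bot, fun b => nomatch b⟩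
    | ⟨.num n, _⟩ => ⟨MShape.num n, fun b => nomatch b⟩
    | ⟨.case, c⟩ => ⟨MShape.case, fun
        | none => .inl ⟨Γ, θ, c none⟩
        | some j => .inl ⟨Γ, θ, c (some j)⟩⟩
    | ⟨.app h σ x, c⟩ =>
      match θ σ x with
      | .inl y => ⟨MShape.app h σ y, fun v => .inl ⟨ext Γ v.1.args, θ.lift v.1.args, c v⟩⟩
      | .inr P => ⟨MShape.beta h σ, fun
          | none => .inr P
          | some v => .inl ⟨ext Γ v.1.args, θ.lift v.1.args, c v⟩⟩
    | ⟨.beta h σ, c⟩ => ⟨MShape.beta h σ, fun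
        | none => .inl ⟨ext Γ σ.args, θ.lift σ.args, c none⟩
        | some v => .inl ⟨ext Γ v.1.args, θ.lift v.1.args, c (some v)⟩⟩

/-- Simultaneous capture-avoiding substitution. -/
def subst (θ : Sub Γ Δ) (T : Meta s Γ) : Meta s Δ :=
  Tree.corec (i := (s, Δ)) substStep (.inl ⟨Γ, θ, T⟩)

/-! ### Reduction and evaluation -/

/-- Basic reduction. (It is stated for both sorts, as each meta-expression is a ground meta-term.) -/
inductive Basic {Γ : Ctx} : {s : Srt} → Meta s Γ → Meta s Γ → Prop
  | beta {σ : Ty} (E : MProc Γ σ) (Q : ∀ v : Place σ.args, MProc Γ v.1) :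
      Basic (Meta.beta E Q) (Meta.ofExp .gnd (E.subst (Sub.single σ.args Q)))
  | case_bot {s : Srt} (E : ℕ → Meta .exp Γ) : Basic (Meta.case (Meta.bot .gnd Γ) E) (Meta.bot s Γ)
  | case_num {s : Srt} (n : ℕ) (E : ℕ → Meta .exp Γ) :
      Basic (Meta.case (Meta.num n) E) (Meta.ofExp s (E n))
  | case_case {s : Srt} (G : Meta .gnd Γ) (E F : ℕ → Meta .exp Γ) :
      Basic (Meta.case (Meta.case G E) F : Meta s Γ)
        (Meta.case G fun i => Meta.case (Meta.ofExp .gnd (E i)) F)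

/-- Head reduction. -/
inductive Head {Γ : Ctx} : {s : Srt} → Meta s Γ → Meta s Γ → Prop
  | basic {s : Srt} {G G' : Meta s Γ} : Basic G G' → Head G G'
  | scrutinee {s : Srt} {G G' : Meta .gnd Γ} (E : ℕ → Meta .exp Γ) : Head G G' →
      (∀ H F, G ≠ Meta.case H F) → Head (Meta.case G E : Meta s Γ) (Meta.case G' E)

open Classical in
/-- General reduction. Meta-procedures being represented by their bodies, reduction below a `λ` is
reduction of the body; otherwise a head redex, one argument of
a head variable, or one branch is reduced. -/
inductive Red : {Γ : Ctx} → {s : Srt} → Meta s Γ → Meta s Γ → Prop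
  | head {Γ : Ctx} {s : Srt} {T T' : Meta s Γ} : Head T T' → Red T T'
  | arg {Γ : Ctx} {σ : Ty} (x : Var Γ σ) (Q : ∀ v : Place σ.args, MProc Γ v.1)
      (v : Place σ.args) (Q' : MProc Γ v.1) : Red (Q v) Q' →
      Red (Meta.app x Q) (Meta.app x (Function.update Q v Q'))
  | case_arg {Γ : Ctx} {s : Srt} {σ : Ty} (x : Var Γ σ) (Q : ∀ v : Place σ.args, MProc Γ v.1)
      (E : ℕ → Meta .exp Γ) (v : Place σ.args) (Q' : MProc Γ v.1) : Red (Q v) Q' →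
      Red (Meta.case (Meta.app x Q) E : Meta s Γ)
        (Meta.case (Meta.app x (Function.update Q v Q')) E)
  | branch {Γ : Ctx} {s : Srt} {σ : Ty} (x : Var Γ σ) (Q : ∀ v : Place σ.args, MProc Γ v.1)
      (E : ℕ → Meta .exp Γ) (j : ℕ) (E' : Meta .exp Γ) : Red (E j) E' →
      Red (Meta.case (Meta.app x Q) E : Meta s Γ)
        (Meta.case (Meta.app x Q) (Function.update E j E'))

/-- The finite terms visible at finite stages in the reduction of a meta-expression. -/
def finiteApprox (T : Meta .exp Γ) : Set (Exp Γ) :=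
  {t | t.Finite ∧ ∃ T', Relation.ReflTransGen Red T T' ∧ Meta.ofTerm t ≤ T'}

/-- The value of a meta-expression. -/
def eval (T : Meta .exp Γ) : Exp Γ := Tree.sup (finiteApprox T)

end Meta

/-- Application of procedures: `(λ x y⃗. e) · q = λ y⃗. ⟪e[x ↦ q]⟫`. -/
def Proc.apply {Γ : Ctx} {σ τ : Ty} (p : Proc Γ (.arrow σ τ)) (q : Proc Γ σ) : Proc Γ τ :=
  Proc.mk τ (Meta.eval ((Meta.ofTerm p.unlam.body).subst
    (Sub.lift (Sub.single [σ] fun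
      | ⟨_, .here⟩ => Meta.ofTerm q.body) τ.args)))

/-! ### The language `PCF^Ω_k` and its interpretation -/

/-- Well-typed terms `Γ ⊢ M : σ` of oracle PCF with recursion operators `Y_σ` only for types `σ` of level
at most `k`; partial functions `ℕ ⇀ ℕ` are functions `ℕ → Option ℕ`. -/
inductive Tm (k : ℕ) : Ctx → Ty → Type
  | var {Γ : Ctx} {σ : Ty} (x : Var Γ σ) : Tm k Γ σ
  | lam {Γ : Ctx} {σ τ : Ty} (M : Tm k (σ :: Γ) τ) : Tm k Γ (.arrow σ τ)
  | app {Γ : Ctx} {σ τ : Ty} (M : Tm k Γ (.arrow σ τ)) (N : Tm k Γ σ) : Tm k Γ τ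
  | num {Γ : Ctx} (n : ℕ) : Tm k Γ .nat
  | suc {Γ : Ctx} : Tm k Γ (.arrow .nat .nat)
  | pre {Γ : Ctx} : Tm k Γ (.arrow .nat .nat)
  | ifzero {Γ : Ctx} : Tm k Γ (.arrow .nat (.arrow .nat (.arrow .nat .nat)))
  | Y {Γ : Ctx} (σ : Ty) (hσ : σ.level ≤ k) : Tm k Γ (.arrow (.arrow σ σ) σ)
  | oracle {Γ : Ctx} (f : ℕ → Option ℕ) : Tm k Γ (.arrow .nat .nat)

/-- A numeral for a defined value, `⊥` for an undefined one. -/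
def Exp.ofOption {Γ : Ctx} : Option ℕ → Exp Γ
  | none => Exp.bot Γ
  | some n => Exp.num n

/-- `case x of (j ⇒ eⱼ)` for a variable `x` of type `ℕ`. -/
def Exp.caseNat {Γ : Ctx} (x : Var Γ .nat) (e : ℕ → Exp Γ) : Exp Γ :=
  Exp.case x (fun _ v => nomatch v) e

/-- States of the unfolding of the procedure `F_σ[g]`. -/
inductive YState (σ : Ty) : Ctx → Type
  | unfold {Γ : Ctx} (g : Var Γ (.arrow σ σ)) : YState σ (ext Γ σ.args)
  | done {Γ : Ctx} (t : Exp Γ) : YState σ Γ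

def yStep (σ : Ty) : ∀ Γ, YState σ Γ → expSig.Obj (YState σ) Γ
  | _, .done t => ⟨(Tree.dest t).1, fun b => .done ((Tree.dest t).2 b)⟩
  | _, .unfold (Γ := Γ) g => ⟨ExpShape.case (.arrow σ σ) (Var.wk σ.args g), fun
      | .inl ⟨_, .here⟩ => .unfold (Var.wk σ.args g)
      | .inl ⟨ρ, .there v⟩ => .done (eta ρ (ext Γ σ.args) (Var.new Γ v)).body
      | .inr j => .done (Exp.num j)⟩

/-- `F_σ[g] = λ x₀ … xᵣ₋₁. case g (F_σ[g]) x₀^η … xᵣ₋₁^η of (i ⇒ i)`, specified corecursively. -/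
def procF (σ : Ty) {Γ : Ctx} (g : Var Γ (.arrow σ σ)) : Proc Γ σ :=
  Proc.mk σ (Tree.corec (yStep σ) (.unfold g))

/-- The procedure `Y_σ = λ g. F_σ[g]`. -/
def procY (Γ : Ctx) (σ : Ty) : Proc Γ (.arrow (.arrow σ σ) σ) := Proc.lam (procF σ Var.here)

/-- The interpretation of terms as nested sequential procedures in their environment. -/
def denote {k : ℕ} : {Γ : Ctx} → {σ : Ty} → Tm k Γ σ → Proc Γ σ
  | Γ, σ, .var x => eta σ Γ x
  | _, _, .lam M => Proc.lam (denote M)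
  | _, _, .app M N => (denote M).apply (denote N)
  | _, _, .num n => Proc.const (Exp.num n)
  | _, _, .suc => Proc.lam (Proc.const (Exp.caseNat .here fun i => Exp.num (i + 1)))
  | _, _, .pre => Proc.lam (Proc.const (Exp.caseNat .here fun
      | 0 => Exp.num 0
      | i + 1 => Exp.num i))
  | _, _, .ifzero => Proc.lam (Proc.lam (Proc.lam (Proc.const
      (Exp.caseNat (.there (.there .here)) fun
        | 0 => Exp.caseNat (.there .here) Exp.num
        | _ + 1 => Exp.caseNat .here Exp.num))))
  | Γ, _, .Y σ _ => procY Γ σ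
  | _, _, .oracle f => Proc.lam (Proc.const (Exp.caseNat .here fun i => Exp.ofOption (f i)))

/-- `Γ ⊢ p : σ` is `PCF^Ω_k`-denotable. -/
def Denotable (k : ℕ) (Γ : Ctx) (σ : Ty) (p : Proc Γ σ) : Prop := ∃ M : Tm k Γ σ, denote M = p

/-! ### Plugging -/

/-- A partial renaming, extended by the identity on new variables. -/
def liftPartial {Γ Δ : Ctx} (r : ∀ ρ, Var Γ ρ → Option (Var Δ ρ)) (σs : List Ty) :
    ∀ ρ, Var (ext Γ σs) ρ → Option (Var (ext Δ σs) ρ) :=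
  fun ρ v =>
    match Var.split σs v with
    | .inr w => some (Var.new Δ w)
    | .inl w => (r ρ w).map (Var.wk σs)

namespace Meta

variable {Γ Δ : Ctx} {s : Srt}

abbrev PruneState (i : Srt × Ctx) : Type :=
  Σ Γ : Ctx, (∀ ρ, Var Γ ρ → Option (Var i.2 ρ)) × Meta i.1 Γ

def pruneStep (i : Srt × Ctx) : PruneState i → metaSig.Obj PruneState i
  | ⟨Γ, r, T⟩ =>
    match Tree.dest (S := metaSig) T with
    | ⟨.bot, _⟩ => ⟨MShape.bot, fun b => nomatch b⟩
    | ⟨.num n, _⟩ => ⟨MShape.num n, fun b => nomatch b⟩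
    | ⟨.case, c⟩ => ⟨MShape.case, fun
        | none => ⟨Γ, r, c none⟩
        | some j => ⟨Γ, r, c (some j)⟩⟩
    | ⟨.app h σ x, c⟩ =>
      match r σ x with
      | none => ⟨MShape.bot, fun b => nomatch b⟩
      | some y => ⟨MShape.app h σ y, fun v => ⟨ext Γ v.1.args, liftPartial r v.1.args, c v⟩⟩
    | ⟨.beta h σ, c⟩ => ⟨MShape.beta h σ, fun
        | none => ⟨ext Γ σ.args, liftPartial r σ.args, c none⟩
        | some v => ⟨ext Γ v.1.args, liftPartial r v.1.args, c (some v)⟩⟩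

/-- `T°`: the meta-term obtained from `Γ, Z ⊢ T` by replacing each ground type subterm `z Q⃗` with `z ∈ Z`
by `⊥`; no variable of `Z` remains. -/
def prune (Z : List Ty) (T : Meta s (ext Γ Z)) : Meta s Γ :=
  Tree.corec (i := (s, Γ)) pruneStep ⟨ext Γ Z, fun _ v => (Var.split Z v).getLeft?, T⟩

end Meta

/-- The substitution `z ↦ ξ(z)` for all `z ∈ Z`, in the environment `Γ, Z`. -/
def plugSub (Γ : Ctx) (Z : List Ty) (ξ : ∀ ρ, Var Z ρ → Proc (ext Γ Z) ρ) :
    Sub (ext Γ Z) (ext Γ Z) :=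
  fun ρ v =>
    match Var.split Z v with
    | .inl w => .inl (Var.wk Z w)
    | .inr w => .inr (Meta.ofTerm (ξ ρ w).body)

/-- `Πᵐ(e, ξ)`: expand the variables of `Z` in `e` according to `ξ`, `m` times. -/
def plugIter (Γ : Ctx) (Z : List Ty) (e : Exp (ext Γ Z))
    (ξ : ∀ ρ, Var Z ρ → Proc (ext Γ Z) ρ) : ℕ → Meta .exp (ext Γ Z)
  | 0 => Meta.ofTerm e
  | m + 1 => (plugIter Γ Z e ξ m).subst (plugSub Γ Z ξ)

/-- The plugging `Π_{Γ,Z}(e, ξ) = ⊔ₘ Πᵐ(e, ξ)°`, a meta-expression in `Γ`. -/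
def plug (Γ : Ctx) (Z : List Ty) (e : Exp (ext Γ Z))
    (ξ : ∀ ρ, Var Z ρ → Proc (ext Γ Z) ρ) : Meta .exp Γ :=
  Tree.sup (Set.range fun m => Meta.prune Z (plugIter Γ Z e ξ m))

/-- For `Z = z, x₀, …, xᵣ₋₁` with `z : σ = σ₀, …, σᵣ₋₁ → ℕ` and `xᵢ : σᵢ`, and for a procedure `p = λ x⃗. e` in
`Γ, z`: the assignment `z ↦ λ x⃗. e`, `xᵢ ↦ qᵢ`, all values seen in `Γ, Z`. -/
def recAssign {Γ : Ctx} {σ : Ty} (p : Proc (σ :: Γ) σ) (q : ∀ ρ, Var σ.args ρ → Proc Γ ρ) :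
    ∀ ρ, Var (σ :: σ.args) ρ → Proc (ext Γ (σ :: σ.args)) ρ
  | _, .here => p.wk σ.args
  | ρ, .there v => (q ρ v).wk (σ :: σ.args)

/-! ### The inductively generated class -/

/-- The class of procedures-in-environment `Γ ⊢ p : σ` generated inductively by the six rules. -/
inductive Generated (k : ℕ) : (Γ : Ctx) → (σ : Ty) → Proc Γ σ → Prop
  | var {Γ : Ctx} {σ : Ty} (x : Var Γ σ) (q : ∀ ρ, Var σ.args ρ → Proc Γ ρ)
      (hq : ∀ ρ v, Generated k Γ ρ (q ρ v)) :
      Generated k Γ .nat (Proc.const (Exp.case x q fun j => Exp.num j))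
  | lam {Γ : Ctx} {σ τ : Ty} (p : Proc (σ :: Γ) τ) (hp : Generated k (σ :: Γ) τ p) :
      Generated k Γ (.arrow σ τ) p.lam
  | num {Γ : Ctx} (n : ℕ) : Generated k Γ .nat (Proc.const (Exp.num n))
  | oracle {Γ : Ctx} {σ : Ty} (p : Proc Γ σ) (hp : Generated k Γ σ p) (f : ℕ → Option ℕ) :
      Generated k Γ σ (p.replaceLeaves fun i => Exp.ofOption (f i))
  | ifzero {Γ : Ctx} {σ : Ty} (p : Proc Γ σ) (d e : Exp Γ) (hp : Generated k Γ σ p)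
      (hd : Generated k Γ .nat (Proc.const d)) (he : Generated k Γ .nat (Proc.const e)) :
      Generated k Γ σ (p.replaceLeaves fun
        | 0 => d
        | _ + 1 => e)
  | recursion {Γ : Ctx} {σ : Ty} (hσ : σ.level ≤ k) (e : Exp (ext Γ (σ :: σ.args)))
      (he : Generated k Γ (.arrow σ σ) (Proc.mk (.arrow σ σ) e))
      (q : ∀ ρ, Var σ.args ρ → Proc Γ ρ) (hq : ∀ ρ v, Generated k Γ ρ (q ρ v)) :
      Generated k Γ .nat (Proc.const (Meta.eval
        (plug Γ (σ :: σ.args) e (recAssign (Proc.mk σ e) q))))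

end

end NSP

/-! The difficulty is that `eval` is defined through finite reductions, while application, `F_σ` and
plugging are all infinite constructions. Evaluation is therefore traded for a deterministic object.
A machine performs head reduction with a stack of pending branches, and `ev` unfolds its results
into a possibly infinite normal form. By `eval_eq_ev` the two agree: reduction preserves `ev`, and
each finite part of `ev` is exposed by finitely many reductions.

The calculus of values rests on one coinductive relation, `CSim`. It lets configurations match at
any common root, redexes included, and this makes it compatible with substitution (`CSim.subst`),
even when a variable on one side faces its η-expansion on the other. Induction on the length of a
run (`CSim.haltsIn`) then shows that similar configurations have the same normal form. Consequently
evaluated substitution `inst` is associative, has η-expansion as its identity, and commutes with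
leaf replacement, abstraction and application.

For the recursion rule, plugging is the supremum of finite expansions. It equals a corecursive
infinite expansion, and this expansion is a substitution. The value `A` it gives to `z` satisfies `A
= λ x⃗. e[z ↦ A]` literally. The procedure `F_σ`, instantiated at `λ z x⃗. e`, satisfies the same
equation up to evaluation and η, so the two are similar (`fixM_csim`). Hence `eval_plug`: the rule
produces exactly the value of `Y_σ (λ z x⃗. e) q⃗`.

After this, every rule visibly builds a denotable procedure from denotable ones. Conversely, the
constants are easily generated, and the one substantial point is closure under application. The
argument is hereditary substitution (`Generated.inst_of_bounded`). The leaf rules and recursion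
commute with substitution. When a head variable of type `σ` is replaced by a generated procedure,
its arguments have to be substituted in the body of that procedure, and their types are smaller than
`σ`. -/

namespace NSP

noncomputable section

/-! ### Trees and the syntactic order -/

namespace Tree

variable {I : Type} {S : Sig I} {i : I}

theorem mk_injective : Function.Injective (mk : S.Obj (Tree S) i → Tree S i) := fun x y h => by
  rw [← dest_mk x, h, dest_mk]

theorem corec_eq {X : I → Type} (f : ∀ i, X i → S.Obj X i) (x : X i) :
    (corec f x : Tree S i) = mk ⟨(f i x).1, fun b => corec f ((f i x).2 b)⟩ := by
  rw [← mk_dest (corec f x), dest_corec]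

theorem eq_bot (f : ∀ b, Tree S (S.next (S.bot i) b)) : mk ⟨S.bot i, f⟩ = bot S i := by
  have : f = fun b => ((S.bot_leaf i).false b).elim := funext fun b => ((S.bot_leaf i).false b).elim
  rw [this]; rfl

/-- A greatest post-fixed point is a fixed point: the order enlarged by its own one-step unfolding
is again post-fixed. -/
theorem le_iff {t u : Tree S i} : t ≤ u ↔ t = bot S i ∨
    ∃ a f g, t = mk ⟨a, f⟩ ∧ u = mk ⟨a, g⟩ ∧ ∀ b, f b ≤ g b := by
  constructor
  · rintro ⟨R, h, hR⟩
    rcases hR _ _ _ h with h | ⟨a, f, g, ht, hu, hb⟩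
    · exact .inl h
    · exact .inr ⟨a, f, g, ht, hu, fun b => ⟨R, hb b, hR⟩⟩
  · intro h
    refine ⟨fun j t u => t ≤ u ∨ (t = bot S j ∨
      ∃ a f g, t = mk ⟨a, f⟩ ∧ u = mk ⟨a, g⟩ ∧ ∀ b, f b ≤ g b), .inr h, ?_⟩
    rintro j t u (⟨R, h, hR⟩ | h | ⟨a, f, g, ht, hu, hb⟩)
    · rcases hR _ _ _ h with h | ⟨a, f, g, ht, hu, hb⟩
      · exact .inl h
      · exact .inr ⟨a, f, g, ht, hu, fun b => .inl ⟨R, hb b, hR⟩⟩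
    · exact .inl h
    · exact .inr ⟨a, f, g, ht, hu, fun b => .inl (hb b)⟩

theorem le_coind (R : ∀ i, Tree S i → Tree S i → Prop)
    (hR : ∀ j t u, R j t u → t = bot S j ∨
      ∃ a f g, t = mk ⟨a, f⟩ ∧ u = mk ⟨a, g⟩ ∧ ∀ b, R _ (f b) (g b))
    {t u : Tree S i} (h : R i t u) : t ≤ u := ⟨R, h, hR⟩

theorem bot_le (t : Tree S i) : bot S i ≤ t := le_iff.2 (.inl rfl)

theorem le_refl (t : Tree S i) : t ≤ t :=
  le_coind (fun _ t u => t = u) (by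
    rintro j t _ rfl
    exact .inr ⟨t.dest.1, t.dest.2, t.dest.2, (mk_dest t).symm, (mk_dest t).symm, fun _ => rfl⟩) rfl

theorem mk_le_iff {a : S.Shape i} {f : ∀ b, Tree S (S.next a b)} {u : Tree S i}
    (ha : mk ⟨a, f⟩ ≠ bot S i) : mk ⟨a, f⟩ ≤ u ↔ ∃ g, u = mk ⟨a, g⟩ ∧ ∀ b, f b ≤ g b := by
  rw [le_iff]
  constructor
  · rintro (h | ⟨a', f', g, ht, hu, hb⟩)
    · exact absurd h ha
    · cases mk_injective ht
      exact ⟨g, hu, hb⟩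
  · rintro ⟨g, hu, hb⟩
    exact .inr ⟨a, f, g, rfl, hu, hb⟩

theorem mk_le_mk {a : S.Shape i} {f g : ∀ b, Tree S (S.next a b)} (h : ∀ b, f b ≤ g b) :
    mk ⟨a, f⟩ ≤ mk ⟨a, g⟩ := le_iff.2 (.inr ⟨a, f, g, rfl, rfl, h⟩)

theorem le_bot {t : Tree S i} (h : t ≤ bot S i) : t = bot S i := by
  rcases le_iff.1 h with h | ⟨a, f, g, ht, hu, -⟩
  · exact h
  · have := mk_injective hu
    cases this
    rw [ht, eq_bot]

theorem le_trans {t u v : Tree S i} (h : t ≤ u) (h' : u ≤ v) : t ≤ v := by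
  refine le_coind (fun _ t v => ∃ u, t ≤ u ∧ u ≤ v) ?_ ⟨u, h, h'⟩
  rintro j t v ⟨u, h, h'⟩
  rcases le_iff.1 h with h | ⟨a, f, g, rfl, rfl, hb⟩
  · exact .inl h
  · rcases le_iff.1 h' with h' | ⟨a', f', g', ht, hu, hb'⟩
    · exact .inl (le_bot (h' ▸ h))
    · cases mk_injective ht
      exact .inr ⟨a, f, g', rfl, hu, fun b => ⟨g b, hb b, hb' b⟩⟩

theorem le_antisymm {t u : Tree S i} (h : t ≤ u) (h' : u ≤ t) : t = u := by
  refine bisim (fun _ t u => t ≤ u ∧ u ≤ t) ?_ ⟨h, h'⟩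
  rintro j t u ⟨h, h'⟩
  by_cases hb : t = bot S j
  · subst hb
    rw [le_bot h']
    exact ⟨S.bot j, _, _, rfl, rfl, fun b => ((S.bot_leaf j).false b).elim⟩
  · obtain ⟨⟨a, f⟩, rfl⟩ : ∃ x, t = mk x := ⟨_, (mk_dest t).symm⟩
    obtain ⟨g, rfl, hg⟩ := (mk_le_iff hb).1 h
    have hb' : mk ⟨a, g⟩ ≠ bot S j := fun e => hb (le_bot (e ▸ h))
    obtain ⟨f', e, hf⟩ := (mk_le_iff hb').1 h'
    cases mk_injective e
    exact ⟨a, f, g, rfl, rfl, fun b => ⟨hg b, hf b⟩⟩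

instance : PartialOrder (Tree S i) where
  le_refl := le_refl
  le_trans _ _ _ := le_trans
  le_antisymm _ _ := le_antisymm

/-- By antisymmetry the choice made in `sup` is immaterial, so a supremum is computed by exhibiting
any least upper bound. -/
theorem sup_eq {A : Set (Tree S i)} {t : Tree S i} (h : IsLUB A t) : sup A = t := by
  have h' : ∃ t, IsLUB A t := ⟨t, h⟩
  rw [sup, dif_pos h']
  exact h'.choose_spec.unique h

end Tree

/-! ### Variables -/

namespace Var

@[simp] theorem split_wk {ρ : Ty} : ∀ {Γ : Ctx} (σs : List Ty) (v : Var Γ ρ),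
    Var.split σs (Var.wk σs v) = .inl v
  | _, [], _ => rfl
  | _, σ :: σs, v => by simp [Var.split, Var.wk, split_wk σs]

@[simp] theorem split_new {ρ : Ty} : ∀ {Γ : Ctx} {σs : List Ty} (v : Var σs ρ),
    Var.split σs (Var.new Γ v) = .inr v
  | _, σ :: σs, .here => by simp [Var.split, Var.new]
  | Γ, σ :: σs, .there v => by simp [Var.split, Var.new, split_new v]

theorem wk_or_new {ρ : Ty} : ∀ {Γ : Ctx} (σs : List Ty) (v : Var (ext Γ σs) ρ),
    (∃ w : Var Γ ρ, v = Var.wk σs w) ∨ (∃ w : Var σs ρ, v = Var.new Γ w)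
  | _, [], v => .inl ⟨v, rfl⟩
  | Γ, σ :: σs, v => by
    rcases wk_or_new (Γ := σ :: Γ) σs v with ⟨w, rfl⟩ | ⟨w, rfl⟩
    · cases w with
      | here => exact .inr ⟨.here, rfl⟩
      | there w => exact .inl ⟨w, rfl⟩
    · exact .inr ⟨.there w, rfl⟩

end Var

namespace Ren

variable {Γ Δ Θ : Ctx}

@[simp] theorem lift_wk (r : Ren Γ Δ) (σs : List Ty) {ρ : Ty} (v : Var Γ ρ) :
    r.lift σs ρ (Var.wk σs v) = Var.wk σs (r ρ v) := by simp [Ren.lift]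

@[simp] theorem lift_new (r : Ren Γ Δ) {σs : List Ty} {ρ : Ty} (v : Var σs ρ) :
    r.lift σs ρ (Var.new Γ v) = Var.new Δ v := by simp [Ren.lift]

-- The laws for binders all reduce to these two cases, old variables and newly bound ones, so the
-- recursive definition of `Var.split` need not be unfolded again.
@[ext] theorem ext' {σs : List Ty} {r r' : Ren (ext Γ σs) Δ}
    (h : ∀ ρ (v : Var Γ ρ), r ρ (Var.wk σs v) = r' ρ (Var.wk σs v))
    (h' : ∀ ρ (v : Var σs ρ), r ρ (Var.new Γ v) = r' ρ (Var.new Γ v)) : r = r' := by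
  funext ρ v
  rcases Var.wk_or_new σs v with ⟨w, rfl⟩ | ⟨w, rfl⟩
  exacts [h _ _, h' _ _]

/-- The inclusion of an environment in an extension. -/
def wk (Γ : Ctx) (σs : List Ty) : Ren Γ (ext Γ σs) := fun _ v => Var.wk σs v

theorem lift_id (σs : List Ty) : Ren.lift (fun _ v => v : Ren Γ Γ) σs = fun _ v => v :=
  ext' (by simp) (by simp)

theorem lift_lift (r : Ren Γ Δ) (r' : Ren Δ Θ) (σs : List Ty) :
    (fun ρ v => r'.lift σs ρ (r.lift σs ρ v)) = Ren.lift (fun ρ v => r' ρ (r ρ v)) σs :=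
  ext' (by simp) (by simp)

end Ren

/-! ### Expressions -/

namespace Exp

/-- `R` relates the immediate subterms of two expressions with the same root. -/
inductive Node (R : ∀ Γ, Exp Γ → Exp Γ → Prop) : ∀ {Γ}, Exp Γ → Exp Γ → Prop
  | bot {Γ : Ctx} : Node R (Exp.bot Γ) (Exp.bot Γ)
  | num {Γ : Ctx} (n : ℕ) : Node R (Exp.num n : Exp Γ) (Exp.num n)
  | case {Γ : Ctx} {σ : Ty} (x : Var Γ σ) {q q' : ∀ ρ, Var σ.args ρ → Proc Γ ρ} {e e' : ℕ → Exp Γ} :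
      (∀ ρ v, R _ (q ρ v).body (q' ρ v).body) → (∀ i, R _ (e i) (e' i)) →
      Node R (Exp.case x q e) (Exp.case x q' e')

/-- Case analysis on expressions. -/
inductive View : ∀ {Γ}, Exp Γ → Prop
  | bot {Γ : Ctx} : View (Exp.bot Γ)
  | num {Γ : Ctx} (n : ℕ) : View (Exp.num n : Exp Γ)
  | case {Γ : Ctx} {σ : Ty} (x : Var Γ σ) (q : ∀ ρ, Var σ.args ρ → Proc Γ ρ) (e : ℕ → Exp Γ) :
      View (Exp.case x q e)

variable {Γ Δ : Ctx}

theorem bisim (R : ∀ Γ, Exp Γ → Exp Γ → Prop) (h : ∀ Γ t u, R Γ t u → Node R t u)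
    {t u : Exp Γ} (htu : R Γ t u) : t = u := by
  refine Tree.bisim R ?_ htu
  intro Γ t u htu
  cases h _ _ _ htu with
  | bot => exact ⟨_, _, _, rfl, rfl, fun b => nomatch b⟩
  | num n => exact ⟨_, _, _, rfl, rfl, fun b => nomatch b⟩
  | case x hq he => exact ⟨_, _, _, rfl, rfl, fun | .inl ⟨ρ, v⟩ => hq ρ v | .inr j => he j⟩

theorem mk_bot (c) : (Tree.mk ⟨ExpShape.bot, c⟩ : Exp Γ) = Exp.bot Γ := by
  congr 2; funext b; cases b

theorem mk_num (n : ℕ) (c) : (Tree.mk ⟨ExpShape.num n, c⟩ : Exp Γ) = Exp.num n := by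
  congr 2; funext b; cases b

theorem mk_case {σ : Ty} (x : Var Γ σ) (c) : (Tree.mk ⟨ExpShape.case σ x, c⟩ : Exp Γ) =
    Exp.case x (fun ρ v => c (.inl ⟨ρ, v⟩)) (fun j => c (.inr j)) := by
  unfold Exp.case
  congr 2; funext b
  rcases b with ⟨ρ, v⟩ | j <;> rfl

theorem view (t : Exp Γ) : View t := by
  rw [← Tree.mk_dest t]
  rcases Tree.dest t with ⟨a | n | ⟨σ, x⟩, c⟩
  · rw [mk_bot]; exact .bot
  · rw [mk_num]; exact .num n
  · rw [mk_case]; exact .case ..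

@[simp] theorem dest_bot : Tree.dest (Exp.bot Γ) = ⟨ExpShape.bot, fun b => nomatch b⟩ := by
  rw [← mk_bot (fun b => nomatch b), Tree.dest_mk]
  exact Sigma.ext rfl (heq_of_eq (funext fun b => nomatch b))

@[simp] theorem dest_num (n : ℕ) :
    Tree.dest (Exp.num n : Exp Γ) = ⟨ExpShape.num n, fun b => nomatch b⟩ := rfl

@[simp] theorem dest_case {σ : Ty} (x : Var Γ σ) (q : ∀ ρ, Var σ.args ρ → Proc Γ ρ)
    (e : ℕ → Exp Γ) : Tree.dest (Exp.case x q e) = ⟨ExpShape.case σ x, fun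
      | .inl ⟨ρ, v⟩ => q ρ v
      | .inr j => e j⟩ := rfl

theorem rename_bot (r : Ren Γ Δ) : (Exp.bot Γ).rename r = Exp.bot Δ := by
  rw [Exp.rename, Tree.corec_eq]
  rw [renameStep, dest_bot]
  exact mk_bot _

theorem rename_num (r : Ren Γ Δ) (n : ℕ) : (Exp.num n : Exp Γ).rename r = Exp.num n := by
  rw [Exp.rename, Tree.corec_eq]
  simp only [renameStep, dest_num]
  exact mk_num _ _

theorem rename_case (r : Ren Γ Δ) {σ : Ty} (x : Var Γ σ) (q : ∀ ρ, Var σ.args ρ → Proc Γ ρ)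
    (e : ℕ → Exp Γ) : (Exp.case x q e).rename r =
      Exp.case (r σ x) (fun ρ v => (q ρ v).rename r) (fun i => (e i).rename r) := by
  rw [Exp.rename, Tree.corec_eq]
  simp only [renameStep, dest_case]
  exact mk_case _ _

section replaceLeaves

variable (e : ℕ → Exp Γ)

theorem leaf_done {Γ Δ : Ctx} (e : ℕ → Exp Γ) (u : Exp Δ) :
    Tree.corec (S := expSig) (Exp.leafStep e) (.done u) = u := by
  refine Tree.bisim (S := expSig) (fun Δ t u => t = Tree.corec (S := expSig) (Exp.leafStep e) (.done u)) ?_ rfl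
  rintro Δ _ u rfl
  exact ⟨u.dest.1, _, u.dest.2, Tree.dest_corec .., rfl, fun _ => rfl⟩

@[simp] theorem replaceLeaves_bot : (Exp.bot Γ).replaceLeaves e = Exp.bot Γ := by
  rw [Exp.replaceLeaves, Tree.corec_eq]
  simp only [leafStep]
  rw [dest_bot]
  exact mk_bot _

@[simp] theorem replaceLeaves_num (n : ℕ) : (Exp.num n : Exp Γ).replaceLeaves e = e n := by
  rw [Exp.replaceLeaves, Tree.corec_eq]
  simp only [leafStep, dest_num, leaf_done]
  exact Tree.mk_dest _

@[simp] theorem replaceLeaves_case {σ : Ty} (x : Var Γ σ) (q : ∀ ρ, Var σ.args ρ → Proc Γ ρ)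
    (d : ℕ → Exp Γ) : (Exp.case x q d).replaceLeaves e =
      Exp.case x q (fun i => (d i).replaceLeaves e) := by
  rw [Exp.replaceLeaves, Tree.corec_eq]
  simp only [leafStep, dest_case]
  rw [mk_case]
  congr 1
  funext ρ v
  exact leaf_done _ _

end replaceLeaves

end Exp

end

end NSP

/-! ### Algebra of infinite meta-terms: renaming and substitution -/

namespace NSP

noncomputable section

/-! ### Meta-terms: case analysis and bisimulation -/

namespace Meta

/-- `R` relates the immediate subterms of two meta-terms with the same root. -/
inductive Node (R : ∀ s Γ, Meta s Γ → Meta s Γ → Prop) : ∀ {s Γ}, Meta s Γ → Meta s Γ → Prop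
  | bot {s : Srt} {Γ : Ctx} : Node R (Meta.bot s Γ) (Meta.bot s Γ)
  | num {s : Srt} {Γ : Ctx} (n : ℕ) : Node R (Meta.num n : Meta s Γ) (Meta.num n)
  | case {s : Srt} {Γ : Ctx} {G G' : Meta .gnd Γ} {E E' : ℕ → Meta .exp Γ} :
      R _ _ G G' → (∀ i, R _ _ (E i) (E' i)) → Node R (Meta.case G E : Meta s Γ) (Meta.case G' E')
  | app {Γ : Ctx} {σ : Ty} (x : Var Γ σ) {Q Q' : ∀ v : Place σ.args, MProc Γ v.1} :
      (∀ v, R _ _ (Q v) (Q' v)) → Node R (Meta.app x Q) (Meta.app x Q')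
  | beta {Γ : Ctx} {σ : Ty} {P P' : MProc Γ σ} {Q Q' : ∀ v : Place σ.args, MProc Γ v.1} :
      R _ _ P P' → (∀ v, R _ _ (Q v) (Q' v)) → Node R (Meta.beta P Q) (Meta.beta P' Q')

/-- Case analysis on meta-terms. -/
inductive View : ∀ {s Γ}, Meta s Γ → Prop
  | bot {s : Srt} {Γ : Ctx} : View (Meta.bot s Γ)
  | num {s : Srt} {Γ : Ctx} (n : ℕ) : View (Meta.num n : Meta s Γ)
  | case {s : Srt} {Γ : Ctx} (G : Meta .gnd Γ) (E : ℕ → Meta .exp Γ) :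
      View (Meta.case G E : Meta s Γ)
  | app {Γ : Ctx} {σ : Ty} (x : Var Γ σ) (Q : ∀ v : Place σ.args, MProc Γ v.1) :
      View (Meta.app x Q)
  | beta {Γ : Ctx} {σ : Ty} (P : MProc Γ σ) (Q : ∀ v : Place σ.args, MProc Γ v.1) :
      View (Meta.beta P Q)

variable {Γ Δ Θ : Ctx} {s : Srt}

theorem bisim (R : ∀ s Γ, Meta s Γ → Meta s Γ → Prop) (h : ∀ s Γ T U, R s Γ T U → Node R T U)
    {T U : Meta s Γ} (hTU : R s Γ T U) : T = U := by
  refine Tree.bisim (S := metaSig) (fun i => R i.1 i.2) ?_ hTU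
  rintro ⟨s, Γ⟩ T U hTU
  cases h _ _ _ _ hTU with
  | bot => exact ⟨_, _, _, rfl, rfl, fun b => nomatch b⟩
  | num n => exact ⟨_, _, _, rfl, rfl, fun b => nomatch b⟩
  | case hG hE => exact ⟨_, _, _, rfl, rfl, fun | none => hG | some i => hE i⟩
  | app x hQ => exact ⟨_, _, _, rfl, rfl, hQ⟩
  | beta hP hQ => exact ⟨_, _, _, rfl, rfl, fun | none => hP | some v => hQ v⟩

theorem mk_bot (c) : (Tree.mk (S := metaSig) (i := (s, Γ)) ⟨MShape.bot, c⟩) = Meta.bot s Γ := by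
  rw [Meta.bot, Tree.bot]
  congr 2; funext b; cases b

theorem mk_num (n : ℕ) (c) :
    (Tree.mk (S := metaSig) (i := (s, Γ)) ⟨MShape.num n, c⟩) = Meta.num n := by
  rw [Meta.num]
  congr 2; funext b; cases b

theorem mk_case (c) : (Tree.mk (S := metaSig) (i := (s, Γ)) ⟨MShape.case, c⟩) =
    Meta.case (c none) (fun j => c (some j)) := by
  rw [Meta.case]
  congr 2; funext b
  rcases b with _ | j <;> rfl

theorem mk_app {σ : Ty} (x : Var Γ σ) (c) :
    (Tree.mk (S := metaSig) (i := (.gnd, Γ)) ⟨MShape.app rfl σ x, c⟩) = Meta.app x c := rfl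

theorem mk_beta {σ : Ty} (c) :
    (Tree.mk (S := metaSig) (i := (.gnd, Γ)) ⟨MShape.beta rfl σ, c⟩) =
      Meta.beta (c none) (fun v => c (some v)) := by
  rw [Meta.beta]
  congr 2; funext b
  rcases b with _ | j <;> rfl

theorem view (T : Meta s Γ) : View T := by
  rw [← Tree.mk_dest (S := metaSig) T]
  rcases Tree.dest (S := metaSig) T with ⟨a | n | _ | ⟨h, σ, x⟩ | ⟨h, σ⟩, c⟩
  · rw [mk_bot]; exact .bot
  · rw [mk_num]; exact .num n
  · rw [mk_case]; exact .case ..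
  · cases h; rw [mk_app]; exact .app ..
  · cases h; rw [mk_beta]; exact .beta ..

theorem Node.refl {R : ∀ s Γ, Meta s Γ → Meta s Γ → Prop} (h : ∀ s Γ T, R s Γ T T) (T : Meta s Γ) :
    Node R T T := by
  cases T.view with
  | bot => exact .bot
  | num n => exact .num n
  | case G E => exact .case (h _ _ _) fun i => h _ _ _
  | app x Q => exact .app x fun v => h _ _ _
  | beta P Q => exact .beta (h _ _ _) fun v => h _ _ _

@[simp] theorem dest_bot : Tree.dest (S := metaSig) (Meta.bot s Γ) =
    ⟨MShape.bot, fun b => nomatch b⟩ := by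
  rw [← mk_bot (fun b => nomatch b), Tree.dest_mk]
  exact Sigma.ext rfl (heq_of_eq (funext fun b => nomatch b))

@[simp] theorem dest_num (n : ℕ) : Tree.dest (S := metaSig) (Meta.num n : Meta s Γ) =
    ⟨MShape.num n, fun b => nomatch b⟩ := rfl

@[simp] theorem dest_case (G : Meta .gnd Γ) (E : ℕ → Meta .exp Γ) :
    Tree.dest (S := metaSig) (Meta.case G E : Meta s Γ) = ⟨MShape.case, fun
      | none => G
      | some j => E j⟩ := rfl

@[simp] theorem dest_app {σ : Ty} (x : Var Γ σ) (Q : ∀ v : Place σ.args, MProc Γ v.1) :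
    Tree.dest (S := metaSig) (Meta.app x Q) = ⟨MShape.app rfl σ x, Q⟩ := rfl

@[simp] theorem dest_beta {σ : Ty} (P : MProc Γ σ) (Q : ∀ v : Place σ.args, MProc Γ v.1) :
    Tree.dest (S := metaSig) (Meta.beta P Q) = ⟨MShape.beta rfl σ, fun
      | none => P
      | some v => Q v⟩ := rfl

@[simp] theorem ofExp_bot : ofExp s (Meta.bot .exp Γ) = Meta.bot s Γ := by
  rw [ofExp, dest_bot]

@[simp] theorem ofExp_num (n : ℕ) : ofExp s (Meta.num n : Meta .exp Γ) = Meta.num n := rfl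

@[simp] theorem ofExp_case (G : Meta .gnd Γ) (E : ℕ → Meta .exp Γ) :
    ofExp s (Meta.case G E) = Meta.case G E := rfl

theorem ofExp_exp (E : Meta .exp Γ) : ofExp .exp E = E := by
  cases E.view <;> simp

/-! ### The inclusion of terms -/

@[simp] theorem ofTerm_bot : ofTerm (Exp.bot Γ) = Meta.bot .exp Γ := by
  rw [ofTerm, Tree.corec_eq]
  simp only [incStep]
  rw [Exp.dest_bot]
  exact mk_bot _

@[simp] theorem ofTerm_num (n : ℕ) : ofTerm (Exp.num n : Exp Γ) = Meta.num n := by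
  rw [ofTerm, Tree.corec_eq]
  simp only [incStep]
  rw [Exp.dest_num]
  exact mk_num _ _

@[simp] theorem ofTerm_case {σ : Ty} (x : Var Γ σ) (q : ∀ ρ, Var σ.args ρ → Proc Γ ρ)
    (e : ℕ → Exp Γ) : ofTerm (Exp.case x q e) =
      Meta.case (Meta.app x fun v => ofTerm (q v.1 v.2).body) (fun i => ofTerm (e i)) := by
  rw [ofTerm, Tree.corec_eq]
  simp only [incStep]
  rw [Exp.dest_case]
  refine (mk_case _).trans ?_
  congr 1
  rw [Tree.corec_eq (S := metaSig)]
  rfl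

/-! ### Renaming -/

@[simp] theorem rename_bot (r : Ren Γ Δ) : (Meta.bot s Γ).rename r = Meta.bot s Δ := by
  rw [rename, Tree.corec_eq]
  simp only [renameStep]
  rw [dest_bot]
  exact mk_bot _

@[simp] theorem rename_num (r : Ren Γ Δ) (n : ℕ) :
    (Meta.num n : Meta s Γ).rename r = Meta.num n := by
  rw [rename, Tree.corec_eq]
  simp only [renameStep]
  rw [dest_num]
  exact mk_num _ _

@[simp] theorem rename_case (r : Ren Γ Δ) (G : Meta .gnd Γ) (E : ℕ → Meta .exp Γ) :
    (Meta.case G E : Meta s Γ).rename r = Meta.case (G.rename r) fun i => (E i).rename r := by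
  rw [rename, Tree.corec_eq]
  simp only [renameStep]
  rw [dest_case]
  exact mk_case _

@[simp] theorem rename_app (r : Ren Γ Δ) {σ : Ty} (x : Var Γ σ)
    (Q : ∀ v : Place σ.args, MProc Γ v.1) :
    (Meta.app x Q).rename r = Meta.app (r σ x) fun v => (Q v).rename (r.lift v.1.args) := by
  rw [rename, Tree.corec_eq]
  simp only [renameStep]
  rw [dest_app]
  exact mk_app _ _

@[simp] theorem rename_beta (r : Ren Γ Δ) {σ : Ty} (P : MProc Γ σ)
    (Q : ∀ v : Place σ.args, MProc Γ v.1) :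
    (Meta.beta P Q).rename r =
      Meta.beta (P.rename (r.lift σ.args)) fun v => (Q v).rename (r.lift v.1.args) := by
  rw [rename, Tree.corec_eq]
  simp only [renameStep]
  rw [dest_beta]
  exact mk_beta _

theorem rename_id (T : Meta s Γ) : T.rename (fun _ v => v) = T := by
  refine bisim (fun s Γ T U => T = U.rename (fun _ v => v)) ?_ rfl
  rintro s Γ _ T rfl
  cases T.view with
  | bot => rw [rename_bot]; exact .bot
  | num n => rw [rename_num]; exact .num n
  | case G E => rw [rename_case]; exact .case rfl fun _ => rfl
  | app x Q =>
    rw [rename_app]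
    exact .app x fun v => by rw [Ren.lift_id]
  | beta P Q =>
    rw [rename_beta]
    exact .beta (by rw [Ren.lift_id]) fun v => by rw [Ren.lift_id]

theorem rename_rename (r : Ren Γ Δ) (r' : Ren Δ Θ) (T : Meta s Γ) :
    (T.rename r).rename r' = T.rename fun ρ v => r' ρ (r ρ v) := by
  refine bisim (fun s Θ T U => ∃ (Γ Δ : Ctx) (r : Ren Γ Δ) (r' : Ren Δ Θ) (V : Meta s Γ),
    T = (V.rename r).rename r' ∧ U = V.rename fun ρ v => r' ρ (r ρ v)) ?_ ⟨_, _, r, r', T, rfl, rfl⟩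
  rintro s Θ _ _ ⟨Γ, Δ, r, r', T, rfl, rfl⟩
  cases T.view with
  | bot => simp only [rename_bot]; exact .bot
  | num n => simp only [rename_num]; exact .num n
  | case G E =>
    simp only [rename_case]
    exact .case ⟨_, _, _, _, _, rfl, rfl⟩ fun _ => ⟨_, _, _, _, _, rfl, rfl⟩
  | app x Q =>
    simp only [rename_app]
    exact .app _ fun v => ⟨_, _, _, _, _, rfl, by rw [Ren.lift_lift]⟩
  | beta P Q =>
    simp only [rename_beta]
    exact .beta ⟨_, _, _, _, _, rfl, by rw [Ren.lift_lift]⟩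
      fun v => ⟨_, _, _, _, _, rfl, by rw [Ren.lift_lift]⟩

theorem ofTerm_rename (r : Ren Γ Δ) (t : Exp Γ) : ofTerm (t.rename r) = (ofTerm t).rename r := by
  -- A `case` node of a term becomes two nodes of a meta-term, the `case` and its scrutinee `x q⃗`,
  -- so the bisimulation needs a second alternative for the scrutinee.
  refine bisim (fun s Δ T U => (∃ (Γ : Ctx) (r : Ren Γ Δ) (t : Exp Γ),
      T = ofExp s (ofTerm (t.rename r)) ∧ U = ofExp s ((ofTerm t).rename r)) ∨
    ∃ (h : s = .gnd) (Γ : Ctx) (r : Ren Γ Δ) (σ : Ty) (x : Var Γ σ)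
      (q : ∀ ρ, Var σ.args ρ → Proc Γ ρ),
      T = h ▸ Meta.app (r _ x) (fun v => ofTerm ((q v.1 v.2).rename r).body) ∧
      U = h ▸ Meta.app (r _ x) (fun v => (ofTerm (q v.1 v.2).body).rename (r.lift v.1.args))) ?_
    (.inl ⟨_, r, t, (ofExp_exp _).symm, (ofExp_exp _).symm⟩)
  rintro s Δ _ _ (⟨Γ, r, t, rfl, rfl⟩ | ⟨rfl, Γ, r, σ, x, q, rfl, rfl⟩)
  · cases t.view with
    | bot => simp only [Exp.rename_bot, ofTerm_bot, rename_bot, ofExp_bot]; exact .bot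
    | num n => simp only [Exp.rename_num, ofTerm_num, rename_num, ofExp_num]; exact .num n
    | case x q e =>
      simp only [Exp.rename_case, ofTerm_case, rename_case, ofExp_case, rename_app]
      exact .case (.inr ⟨rfl, _, r, _, x, q, rfl, rfl⟩)
        fun i => .inl ⟨_, r, e i, (ofExp_exp _).symm, (ofExp_exp _).symm⟩
  · exact .app _ fun v =>
      .inl ⟨_, r.lift v.1.args, (q v.1 v.2).body, (ofExp_exp _).symm, (ofExp_exp _).symm⟩

/-! ### Substitution -/

theorem subst_done (U : Meta s Γ) :
    Tree.corec (S := metaSig) (i := (s, Γ)) substStep (.inr U) = U := by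
  refine Tree.bisim (S := metaSig)
    (fun i t u => t = Tree.corec (S := metaSig) (i := i) substStep (.inr u)) ?_ rfl
  rintro i _ u rfl
  exact ⟨(Tree.dest u).1, _, (Tree.dest u).2, Tree.dest_corec .., rfl, fun _ => rfl⟩

@[simp] theorem subst_bot (θ : Sub Γ Δ) : (Meta.bot s Γ).subst θ = Meta.bot s Δ := by
  rw [subst, Tree.corec_eq]
  simp only [substStep]
  rw [dest_bot]
  exact mk_bot _

@[simp] theorem subst_num (θ : Sub Γ Δ) (n : ℕ) :
    (Meta.num n : Meta s Γ).subst θ = Meta.num n := by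
  rw [subst, Tree.corec_eq]
  simp only [substStep]
  rw [dest_num]
  exact mk_num _ _

@[simp] theorem subst_case (θ : Sub Γ Δ) (G : Meta .gnd Γ) (E : ℕ → Meta .exp Γ) :
    (Meta.case G E : Meta s Γ).subst θ = Meta.case (G.subst θ) fun i => (E i).subst θ := by
  rw [subst, Tree.corec_eq]
  simp only [substStep]
  rw [dest_case]
  exact mk_case _

theorem subst_app_inl (θ : Sub Γ Δ) {σ : Ty} {x : Var Γ σ} {y : Var Δ σ} (h : θ σ x = .inl y)
    (Q : ∀ v : Place σ.args, MProc Γ v.1) :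
    (Meta.app x Q).subst θ = Meta.app y fun v => (Q v).subst (θ.lift v.1.args) := by
  rw [subst, Tree.corec_eq]
  simp only [substStep]
  rw [dest_app]
  dsimp only
  generalize θ σ x = a at h ⊢
  subst h
  exact mk_app _ _

theorem subst_app_inr (θ : Sub Γ Δ) {σ : Ty} {x : Var Γ σ} {P : MProc Δ σ} (h : θ σ x = .inr P)
    (Q : ∀ v : Place σ.args, MProc Γ v.1) :
    (Meta.app x Q).subst θ = Meta.beta P fun v => (Q v).subst (θ.lift v.1.args) := by
  rw [subst, Tree.corec_eq]
  simp only [substStep]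
  rw [dest_app]
  dsimp only
  generalize θ σ x = a at h ⊢
  subst h
  refine (mk_beta _).trans ?_
  congr 1
  exact subst_done _

@[simp] theorem subst_beta (θ : Sub Γ Δ) {σ : Ty} (P : MProc Γ σ)
    (Q : ∀ v : Place σ.args, MProc Γ v.1) :
    (Meta.beta P Q).subst θ =
      Meta.beta (P.subst (θ.lift σ.args)) fun v => (Q v).subst (θ.lift v.1.args) := by
  rw [subst, Tree.corec_eq]
  simp only [substStep]
  rw [dest_beta]
  exact mk_beta _

end Meta

namespace Sub

variable {Γ Δ Θ : Ctx}

@[ext] theorem ext' {σs : List Ty} {θ θ' : Sub (ext Γ σs) Δ}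
    (h : ∀ ρ (v : Var Γ ρ), θ ρ (Var.wk σs v) = θ' ρ (Var.wk σs v))
    (h' : ∀ ρ (v : Var σs ρ), θ ρ (Var.new Γ v) = θ' ρ (Var.new Γ v)) : θ = θ' := by
  funext ρ v
  rcases Var.wk_or_new σs v with ⟨w, rfl⟩ | ⟨w, rfl⟩
  exacts [h _ _, h' _ _]

@[simp] theorem lift_new (θ : Sub Γ Δ) {σs : List Ty} {ρ : Ty} (v : Var σs ρ) :
    θ.lift σs ρ (Var.new Γ v) = .inl (Var.new Δ v) := by simp [Sub.lift]

/-- Renaming of a value of a substitution. -/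
def renVal (r : Ren Γ Δ) {ρ : Ty} : Var Γ ρ ⊕ MProc Γ ρ → Var Δ ρ ⊕ MProc Δ ρ
  | .inl y => .inl (r ρ y)
  | .inr P => .inr (P.rename (r.lift ρ.args))

/-- Substitution in a value of a substitution. -/
def subVal (θ : Sub Γ Δ) {ρ : Ty} : Var Γ ρ ⊕ MProc Γ ρ → Var Δ ρ ⊕ MProc Δ ρ
  | .inl y => θ ρ y
  | .inr P => .inr (P.subst (θ.lift ρ.args))

theorem lift_wk (θ : Sub Γ Δ) {σs : List Ty} {ρ : Ty} (v : Var Γ ρ) :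
    θ.lift σs ρ (Var.wk σs v) = renVal (Ren.wk Δ σs) (θ ρ v) := by
  simp only [Sub.lift, Var.split_wk]
  cases θ ρ v <;> rfl

@[simp] theorem single_wk {σs : List Ty} (Q : ∀ v : Place σs, MProc Γ v.1) {ρ : Ty} (v : Var Γ ρ) :
    Sub.single σs Q ρ (Var.wk σs v) = .inl v := by simp [Sub.single]

@[simp] theorem single_new {σs : List Ty} (Q : ∀ v : Place σs, MProc Γ v.1) {ρ : Ty}
    (v : Var σs ρ) : Sub.single σs Q ρ (Var.new Γ v) = .inr (Q ⟨ρ, v⟩) := by simp [Sub.single]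

theorem renVal_renVal (r : Ren Γ Δ) (r' : Ren Δ Θ) {ρ : Ty} (a : Var Γ ρ ⊕ MProc Γ ρ) :
    renVal r' (renVal r a) = renVal (fun ρ v => r' ρ (r ρ v)) a := by
  cases a with
  | inl y => rfl
  | inr P => simp only [renVal, Meta.rename_rename, Ren.lift_lift]

/-- A renaming as a substitution. -/
def ofRen (r : Ren Γ Δ) : Sub Γ Δ := fun _ v => .inl (r _ v)

theorem lift_ofRen (r : Ren Γ Δ) (σs : List Ty) : (ofRen r).lift σs = ofRen (r.lift σs) :=
  ext' (fun _ _ => by rw [lift_wk, ofRen, ofRen, Ren.lift_wk]; rfl)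
    (fun _ _ => by rw [lift_new, ofRen, Ren.lift_new])

theorem lift_ren (r : Ren Γ Δ) (θ : Sub Δ Θ) (σs : List Ty) :
    (fun ρ v => θ.lift σs ρ (r.lift σs ρ v)) = Sub.lift (fun ρ v => θ ρ (r ρ v)) σs :=
  ext' (by simp [lift_wk]) (by simp)

theorem ren_lift (θ : Sub Γ Δ) (r : Ren Δ Θ) (σs : List Ty) :
    (fun ρ v => renVal (r.lift σs) (θ.lift σs ρ v)) =
      Sub.lift (fun ρ v => renVal r (θ ρ v)) σs := by
  refine ext' (fun ρ v => ?_) fun ρ v => ?_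
  · simp only [lift_wk, renVal_renVal]
    congr; funext ρ v; exact Ren.lift_wk _ _ _
  · simp only [lift_new, renVal, Ren.lift_new]

end Sub

namespace Meta

variable {Γ Δ Θ : Ctx} {s : Srt}

theorem subst_ofRen (r : Ren Γ Δ) (T : Meta s Γ) : T.subst (Sub.ofRen r) = T.rename r := by
  refine bisim (fun s Δ T U => ∃ (Γ : Ctx) (r : Ren Γ Δ) (V : Meta s Γ),
    T = V.subst (Sub.ofRen r) ∧ U = V.rename r) ?_ ⟨_, r, T, rfl, rfl⟩
  rintro s Δ _ _ ⟨Γ, r, T, rfl, rfl⟩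
  cases T.view with
  | bot => simp only [rename_bot, subst_bot]; exact .bot
  | num n => simp only [rename_num, subst_num]; exact .num n
  | case G E =>
    simp only [rename_case, subst_case]
    exact .case ⟨_, _, _, rfl, rfl⟩ fun _ => ⟨_, _, _, rfl, rfl⟩
  | app x Q =>
    rw [rename_app, subst_app_inl (Sub.ofRen r) rfl]
    exact .app _ fun v => ⟨_, _, _, by rw [Sub.lift_ofRen], rfl⟩
  | beta P Q =>
    simp only [rename_beta, subst_beta]
    exact .beta ⟨_, _, _, by rw [Sub.lift_ofRen], rfl⟩
      fun v => ⟨_, _, _, by rw [Sub.lift_ofRen], rfl⟩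

theorem subst_id (T : Meta s Γ) : T.subst (fun _ v => .inl v) = T :=
  (subst_ofRen (fun _ v => v) T).trans (rename_id T)

theorem rename_subst (r : Ren Γ Δ) (θ : Sub Δ Θ) (T : Meta s Γ) :
    (T.rename r).subst θ = T.subst fun ρ v => θ ρ (r ρ v) := by
  -- The alternative `T = U` is for the operator that substitution places in front of the arguments:
  -- it is inserted as it stands and is the same on both sides.
  refine bisim (fun s Θ T U => T = U ∨ ∃ (Γ Δ : Ctx) (r : Ren Γ Δ) (θ : Sub Δ Θ) (V : Meta s Γ),
    T = (V.rename r).subst θ ∧ U = V.subst fun ρ v => θ ρ (r ρ v)) ?_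
    (.inr ⟨_, _, r, θ, T, rfl, rfl⟩)
  rintro s Θ _ _ (rfl | ⟨Γ, Δ, r, θ, T, rfl, rfl⟩)
  · exact Node.refl (fun _ _ _ => .inl rfl) _
  cases T.view with
  | bot => simp only [rename_bot, subst_bot]; exact .bot
  | num n => simp only [rename_num, subst_num]; exact .num n
  | case G E =>
    simp only [rename_case, subst_case]
    exact .case (.inr ⟨_, _, _, _, _, rfl, rfl⟩) fun _ => .inr ⟨_, _, _, _, _, rfl, rfl⟩
  | app x Q =>
    rw [rename_app]
    rcases h : θ _ (r _ x) with y | P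
    · rw [subst_app_inl θ h, subst_app_inl (fun ρ v => θ ρ (r ρ v)) h]
      exact .app _ fun v => .inr ⟨_, _, _, _, _, rfl, by rw [Sub.lift_ren]⟩
    · rw [subst_app_inr θ h, subst_app_inr (fun ρ v => θ ρ (r ρ v)) h]
      exact .beta (.inl rfl) fun v => .inr ⟨_, _, _, _, _, rfl, by rw [Sub.lift_ren]⟩
  | beta P Q =>
    simp only [rename_beta, subst_beta]
    exact .beta (.inr ⟨_, _, _, _, _, rfl, by rw [Sub.lift_ren]⟩)
      fun v => .inr ⟨_, _, _, _, _, rfl, by rw [Sub.lift_ren]⟩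

theorem subst_rename (θ : Sub Γ Δ) (r : Ren Δ Θ) (T : Meta s Γ) :
    (T.subst θ).rename r = T.subst fun ρ v => Sub.renVal r (θ ρ v) := by
  refine bisim (fun s Θ T U => T = U ∨ ∃ (Γ Δ : Ctx) (θ : Sub Γ Δ) (r : Ren Δ Θ) (V : Meta s Γ),
    T = (V.subst θ).rename r ∧ U = V.subst fun ρ v => Sub.renVal r (θ ρ v)) ?_
    (.inr ⟨_, _, θ, r, T, rfl, rfl⟩)
  rintro s Θ _ _ (rfl | ⟨Γ, Δ, θ, r, T, rfl, rfl⟩)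
  · exact Node.refl (fun _ _ _ => .inl rfl) _
  cases T.view with
  | bot => simp only [rename_bot, subst_bot]; exact .bot
  | num n => simp only [rename_num, subst_num]; exact .num n
  | case G E =>
    simp only [rename_case, subst_case]
    exact .case (.inr ⟨_, _, _, _, _, rfl, rfl⟩) fun _ => .inr ⟨_, _, _, _, _, rfl, rfl⟩
  | app x Q =>
    rcases h : θ _ x with y | P
    · rw [subst_app_inl θ h, rename_app, subst_app_inl (fun ρ v => Sub.renVal r (θ ρ v))
        (y := r _ y) (by simp only [h, Sub.renVal])]
      exact .app _ fun v => .inr ⟨_, _, _, _, _, rfl, by rw [Sub.ren_lift]⟩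
    · rw [subst_app_inr θ h, rename_beta, subst_app_inr (fun ρ v => Sub.renVal r (θ ρ v))
        (P := P.rename (r.lift _)) (by simp only [h, Sub.renVal])]
      exact .beta (.inl rfl) fun v => .inr ⟨_, _, _, _, _, rfl, by rw [Sub.ren_lift]⟩
  | beta P Q =>
    simp only [rename_beta, subst_beta]
    exact .beta (.inr ⟨_, _, _, _, _, rfl, by rw [Sub.ren_lift]⟩)
      fun v => .inr ⟨_, _, _, _, _, rfl, by rw [Sub.ren_lift]⟩

end Meta

namespace Sub

variable {Γ Δ Θ : Ctx}

/-- Composition of substitutions. -/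
def comp (θ : Sub Γ Δ) (θ' : Sub Δ Θ) : Sub Γ Θ := fun _ v => subVal θ' (θ _ v)

theorem subVal_renVal (r : Ren Γ Δ) (θ : Sub Δ Θ) {ρ : Ty} (a : Var Γ ρ ⊕ MProc Γ ρ) :
    subVal θ (renVal r a) = subVal (fun ρ v => θ ρ (r ρ v)) a := by
  cases a with
  | inl y => rfl
  | inr P => simp only [renVal, subVal, Meta.rename_subst, lift_ren]

theorem renVal_subVal (θ : Sub Γ Δ) (r : Ren Δ Θ) {ρ : Ty} (a : Var Γ ρ ⊕ MProc Γ ρ) :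
    renVal r (subVal θ a) = subVal (fun ρ v => renVal r (θ ρ v)) a := by
  cases a with
  | inl y => rfl
  | inr P =>
    change Sum.inr _ = Sum.inr _
    rw [Meta.subst_rename, ren_lift]

theorem lift_comp (θ : Sub Γ Δ) (θ' : Sub Δ Θ) (σs : List Ty) :
    (θ.lift σs).comp (θ'.lift σs) = (θ.comp θ').lift σs := by
  refine ext' (fun ρ v => ?_) fun ρ v => ?_
  · simp only [comp, lift_wk, subVal_renVal, renVal_subVal]
    congr; funext ρ v; exact lift_wk _ _
  · simp only [comp, lift_new, subVal]

end Sub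

namespace Meta

variable {Γ Δ Θ : Ctx} {s : Srt}

/-- The two mixed laws for renaming and substitution must come first, because lifting a substitution
under a binder renames its values. -/
theorem subst_subst (θ : Sub Γ Δ) (θ' : Sub Δ Θ) (T : Meta s Γ) :
    (T.subst θ).subst θ' = T.subst (θ.comp θ') := by
  refine bisim (fun s Θ T U => T = U ∨ ∃ (Γ Δ : Ctx) (θ : Sub Γ Δ) (θ' : Sub Δ Θ) (V : Meta s Γ),
    T = (V.subst θ).subst θ' ∧ U = V.subst (θ.comp θ')) ?_ (.inr ⟨_, _, θ, θ', T, rfl, rfl⟩)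
  rintro s Θ _ _ (rfl | ⟨Γ, Δ, θ, θ', T, rfl, rfl⟩)
  · exact Node.refl (fun _ _ _ => .inl rfl) _
  cases T.view with
  | bot => simp only [subst_bot]; exact .bot
  | num n => simp only [subst_num]; exact .num n
  | case G E =>
    simp only [subst_case]
    exact .case (.inr ⟨_, _, _, _, _, rfl, rfl⟩) fun _ => .inr ⟨_, _, _, _, _, rfl, rfl⟩
  | app x Q =>
    rcases h : θ _ x with y | P
    · have hc : θ.comp θ' _ x = θ' _ y := by simp only [Sub.comp, h, Sub.subVal]
      rw [subst_app_inl θ h]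
      rcases h' : θ' _ y with z | P
      · rw [subst_app_inl θ' h', subst_app_inl _ (hc.trans h')]
        exact .app _ fun v => .inr ⟨_, _, _, _, _, rfl, by rw [Sub.lift_comp]⟩
      · rw [subst_app_inr θ' h', subst_app_inr _ (hc.trans h')]
        exact .beta (.inl rfl) fun v => .inr ⟨_, _, _, _, _, rfl, by rw [Sub.lift_comp]⟩
    · have hc : θ.comp θ' _ x = .inr (P.subst (θ'.lift _)) := by
        simp only [Sub.comp, h, Sub.subVal]
      rw [subst_app_inr θ h, subst_beta, subst_app_inr _ hc]
      exact .beta (.inl rfl) fun v => .inr ⟨_, _, _, _, _, rfl, by rw [Sub.lift_comp]⟩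
  | beta P Q =>
    simp only [subst_beta]
    exact .beta (.inr ⟨_, _, _, _, _, rfl, by rw [Sub.lift_comp]⟩)
      fun v => .inr ⟨_, _, _, _, _, rfl, by rw [Sub.lift_comp]⟩

end Meta

end

end NSP

/-! ### Head-reduction machine and similarity of configurations -/

namespace NSP

noncomputable section

namespace Sub

variable {Γ Δ Θ : Ctx}

theorem lift_inl (σs : List Ty) : Sub.lift (fun _ v => .inl v : Sub Γ Γ) σs = fun _ v => .inl v :=
  ext' (fun _ _ => by rw [lift_wk]; rfl) (fun _ _ => by rw [lift_new])

theorem subVal_inl {ρ : Ty} (a : Var Γ ρ ⊕ MProc Γ ρ) : subVal (fun _ v => .inl v) a = a := by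
  cases a with
  | inl y => rfl
  | inr P => simp only [subVal, lift_inl, Meta.subst_id]

theorem subVal_single_renVal {σs : List Ty} (Q : ∀ v : Place σs, MProc Γ v.1) {ρ : Ty}
    (a : Var Γ ρ ⊕ MProc Γ ρ) : subVal (single σs Q) (renVal (Ren.wk Γ σs) a) = a := by
  rw [subVal_renVal]
  refine Eq.trans ?_ (subVal_inl a)
  congr; funext ρ v; exact single_wk _ _

/-- The substitution lemma for a β-redex: substituting after contraction is contraction after
substituting in operator and arguments. It is the reason why machine steps commute with
substitution. -/
theorem single_comp (θ : Sub Γ Δ) {σs : List Ty} (Q : ∀ v : Place σs, MProc Γ v.1) :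
    (single σs Q).comp θ =
      (θ.lift σs).comp (single σs fun v => (Q v).subst (θ.lift v.1.args)) := by
  refine ext' (fun ρ v => ?_) fun ρ v => ?_
  · simp only [comp, lift_wk, single_wk, subVal_single_renVal]
    rfl
  · simp only [comp, lift_new, single_new, subVal]

end Sub

/-! ### A head-reduction machine -/

/-- Configurations: a meta-term and a stack of families of branches waiting for its value. -/
structure Cfg (Γ : Ctx) where
  {s : Srt}
  T : Meta s Γ
  S : List (ℕ → Meta .exp Γ)

/-- Final results of the machine. -/
inductive Hd (Γ : Ctx)
  | num (n : ℕ) : Hd Γ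
  | app {σ : Ty} (x : Var Γ σ) (Q : ∀ v : Place σ.args, MProc Γ v.1)
      (S : List (ℕ → Meta .exp Γ)) : Hd Γ

namespace Cfg

variable {Γ Δ : Ctx} {s : Srt}

/-- One step of head reduction; `⊥` loops. -/
def step : Cfg Γ → Cfg Γ ⊕ Hd Γ
  | ⟨T, S⟩ =>
    match Tree.dest (S := metaSig) T with
    | ⟨.bot, _⟩ => .inl ⟨Meta.bot .exp Γ, S⟩
    | ⟨.num n, _⟩ =>
      match S with
      | [] => .inr (.num n)
      | E :: S => .inl ⟨E n, S⟩
    | ⟨.case, c⟩ => .inl ⟨c none, (fun j => c (some j)) :: S⟩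
    | ⟨.app _ _ x, c⟩ => .inr (.app x c S)
    | ⟨.beta _ σ, c⟩ => .inl ⟨Meta.subst (Sub.single σ.args fun v => c (some v)) (c none), S⟩

variable {S L : List (ℕ → Meta .exp Γ)}

@[simp] theorem step_bot : step ⟨Meta.bot s Γ, S⟩ = .inl ⟨Meta.bot .exp Γ, S⟩ := by
  rw [step, Meta.dest_bot]

@[simp] theorem step_num (n : ℕ) : step ⟨(Meta.num n : Meta s Γ), []⟩ = .inr (.num n) := by
  rw [step, Meta.dest_num]

@[simp] theorem step_num_cons (n : ℕ) (E : ℕ → Meta .exp Γ) :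
    step ⟨(Meta.num n : Meta s Γ), E :: S⟩ = .inl ⟨E n, S⟩ := by
  rw [step, Meta.dest_num]

@[simp] theorem step_case (G : Meta .gnd Γ) (E : ℕ → Meta .exp Γ) :
    step ⟨(Meta.case G E : Meta s Γ), S⟩ = .inl ⟨G, E :: S⟩ := by
  rw [step, Meta.dest_case]

@[simp] theorem step_app {σ : Ty} (x : Var Γ σ) (Q : ∀ v : Place σ.args, MProc Γ v.1) :
    step ⟨Meta.app x Q, S⟩ = .inr (.app x Q S) := by
  rw [step, Meta.dest_app]

@[simp] theorem step_beta {σ : Ty} (P : MProc Γ σ) (Q : ∀ v : Place σ.args, MProc Γ v.1) :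
    step ⟨Meta.beta P Q, S⟩ = .inl ⟨P.subst (Sub.single σ.args Q), S⟩ := by
  rw [step, Meta.dest_beta]

theorem step_ofExp (E : Meta .exp Γ) : step ⟨Meta.ofExp s E, S⟩ = step ⟨E, S⟩ := by
  cases E.view with
  | bot => simp
  | num n => cases S <;> simp
  | case G E => simp

/-- The machine stops after `n` steps with result `h`. -/
def HaltsIn : ℕ → Cfg Γ → Hd Γ → Prop
  | 0, c, h => step c = .inr h
  | n + 1, c, h => ∃ d, step c = .inl d ∧ HaltsIn n d h

/-- Machine runs. -/
def Reach (c d : Cfg Γ) : Prop := Relation.ReflTransGen (fun c d => step c = .inl d) c d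

/-- The machine does not stop. -/
def Div (c : Cfg Γ) : Prop := ∀ n h, ¬ HaltsIn n c h

theorem Reach.refl (c : Cfg Γ) : Reach c c := Relation.ReflTransGen.refl

theorem Reach.trans {c d e : Cfg Γ} (h : Reach c d) (h' : Reach d e) : Reach c e :=
  Relation.ReflTransGen.trans h h'

theorem Reach.of_step {c d : Cfg Γ} (h : step c = .inl d) : Reach c d :=
  Relation.ReflTransGen.single h

theorem Reach.head {c d e : Cfg Γ} (h : step c = .inl d) (h' : Reach d e) : Reach c e :=
  Relation.ReflTransGen.head h h'

theorem HaltsIn.det {n : ℕ} {c : Cfg Γ} {h : Hd Γ} : ∀ {m : ℕ} {h' : Hd Γ}, HaltsIn n c h →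
    HaltsIn m c h' → h = h' := by
  induction n generalizing c with
  | zero =>
    rintro (_ | m) h' hh hh'
    · exact Sum.inr.inj (hh.symm.trans hh')
    · obtain ⟨d, hd, -⟩ := hh'
      cases hh.symm.trans hd
  | succ n ih =>
    rintro (_ | m) h' ⟨d, hd, hh⟩ hh'
    · cases hd.symm.trans hh'
    · obtain ⟨d', hd', hh'⟩ := hh'
      cases Sum.inl.inj (hd.symm.trans hd')
      exact ih hh hh'

theorem Reach.haltsIn {c d : Cfg Γ} (hr : Reach c d) {n : ℕ} {h : Hd Γ} (hh : HaltsIn n c h) :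
    ∃ m ≤ n, HaltsIn m d h := by
  induction hr with
  | refl => exact ⟨n, le_rfl, hh⟩
  | tail _ hs ih =>
    obtain ⟨m, hm, hh⟩ := ih
    cases m with
    | zero => cases hs.symm.trans hh
    | succ m =>
      obtain ⟨d', hd', hh⟩ := hh
      cases Sum.inl.inj (hs.symm.trans hd')
      exact ⟨m, by omega, hh⟩

theorem Reach.halts_back {c d : Cfg Γ} (hr : Reach c d) {n : ℕ} {h : Hd Γ} (hh : HaltsIn n d h) :
    ∃ m, HaltsIn m c h := by
  induction hr using Relation.ReflTransGen.head_induction_on with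
  | refl => exact ⟨n, hh⟩
  | head hs _ ih =>
    obtain ⟨m, hm⟩ := ih
    exact ⟨m + 1, _, hs, hm⟩

theorem Reach.div_iff {c d : Cfg Γ} (hr : Reach c d) : Div c ↔ Div d :=
  ⟨fun hc _ h hn => let ⟨m, hm⟩ := hr.halts_back hn; hc m h hm,
    fun hd _ h hn => let ⟨m, _, hm⟩ := hr.haltsIn hn; hd m h hm⟩

theorem div_bot : Div ⟨Meta.bot s Γ, S⟩ := by
  intro n h hn
  induction n generalizing s with
  | zero => cases (step_bot (s := s)).symm.trans hn
  | succ n ih =>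
    obtain ⟨d, hd, hn⟩ := hn
    cases Sum.inl.inj ((step_bot (s := s)).symm.trans hd)
    exact ih hn

theorem HaltsIn.reach {n : ℕ} {c : Cfg Γ} {h : Hd Γ} (hn : HaltsIn n c h) :
    ∃ d, Reach c d ∧ step d = .inr h := by
  induction n generalizing c with
  | zero => exact ⟨c, .refl c, hn⟩
  | succ n ih =>
    obtain ⟨d, hd, hn⟩ := hn
    obtain ⟨e, he, hs⟩ := ih hn
    exact ⟨e, .head hd he, hs⟩

/-- Final configurations. -/
inductive Final : Cfg Γ → Hd Γ → Prop
  | num {s : Srt} (n : ℕ) : Final ⟨(Meta.num n : Meta s Γ), []⟩ (.num n)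
  | app {σ : Ty} (x : Var Γ σ) (Q : ∀ v : Place σ.args, MProc Γ v.1)
      (S : List (ℕ → Meta .exp Γ)) : Final ⟨Meta.app x Q, S⟩ (.app x Q S)

theorem final_of_step {c : Cfg Γ} {h : Hd Γ} (hs : step c = .inr h) : Final c h := by
  obtain ⟨T, S⟩ := c
  cases T.view with
  | bot => simp at hs
  | num n =>
    cases S with
    | nil => simp at hs; subst hs; exact .num n
    | cons E S => simp at hs
  | case G E => simp at hs
  | app x Q => simp at hs; subst hs; exact .app x Q S
  | beta P Q => simp at hs

/-! ### Appending to the stack and substitution in configurations -/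

/-- Extension of the stack at its far end. -/
def append (c : Cfg Γ) (L : List (ℕ → Meta .exp Γ)) : Cfg Γ := ⟨c.T, c.S ++ L⟩

theorem step_append {c d : Cfg Γ} (h : step c = .inl d) (L : List (ℕ → Meta .exp Γ)) :
    step (c.append L) = .inl (d.append L) := by
  obtain ⟨T, S⟩ := c
  unfold append
  cases T.view with
  | bot => simp at h ⊢; subst h; simp
  | num n =>
    cases S with
    | nil => simp at h
    | cons E S => simp at h ⊢; subst h; simp
  | case G E => simp at h ⊢; subst h; simp
  | app x Q => simp at h
  | beta P Q => simp at h ⊢; subst h; simp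

theorem Reach.append {c d : Cfg Γ} (h : Reach c d) (L : List (ℕ → Meta .exp Γ)) :
    Reach (c.append L) (d.append L) :=
  Relation.ReflTransGen.lift (fun c : Cfg Γ => c.append L) (fun _ _ h => step_append h L) _ _ h

/-- Added frames are reached only when a numeral has used up the original stack, that is, only when
the original run halts. -/
theorem Div.append {c : Cfg Γ} (h : Div c) (L : List (ℕ → Meta .exp Γ)) : Div (c.append L) := by
  intro n
  induction n generalizing c with
  | zero =>
    intro hd hn
    rcases hs : step c with d | hd'
    · cases (step_append hs L).symm.trans hn
    · exact h 0 hd' hs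
  | succ n ih =>
    rintro hd ⟨d, hs', hn⟩
    rcases hs : step c with d' | hd'
    · cases Sum.inl.inj ((step_append hs L).symm.trans hs')
      exact ih ((Reach.of_step hs).div_iff.1 h) hd hn
    · exact h 0 hd' hs

/-- Substitution in a configuration. -/
def subst (θ : Sub Γ Δ) (c : Cfg Γ) : Cfg Δ :=
  ⟨c.T.subst θ, c.S.map fun E i => (E i).subst θ⟩

theorem step_subst {c d : Cfg Γ} (h : step c = .inl d) (θ : Sub Γ Δ) :
    step (c.subst θ) = .inl (d.subst θ) := by
  obtain ⟨T, S⟩ := c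
  unfold subst
  cases T.view with
  | bot => simp at h ⊢; subst h; simp
  | num n =>
    cases S with
    | nil => simp at h
    | cons E S => simp at h ⊢; subst h; simp
  | case G E => simp at h ⊢; subst h; simp
  | app x Q => simp at h
  | beta P Q =>
    simp only [step_beta, Sum.inl.injEq, Meta.subst_beta] at h ⊢
    subst h
    rw [Meta.subst_subst, Meta.subst_subst, Sub.single_comp]

theorem Reach.subst {c d : Cfg Γ} (h : Reach c d) (θ : Sub Γ Δ) :
    Reach (c.subst θ) (d.subst θ) :=
  Relation.ReflTransGen.lift (fun c : Cfg Γ => c.subst θ) (fun _ _ h => step_subst h θ) _ _ h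

/-- Substitution can change the course of a run only at a variable in head position, and a run that
arrives there has halted. -/
theorem Div.subst {c : Cfg Γ} (h : Div c) (θ : Sub Γ Δ) : Div (c.subst θ) := by
  intro n
  induction n generalizing c with
  | zero =>
    intro hd hn
    rcases hs : step c with d | hd'
    · cases (step_subst hs θ).symm.trans hn
    · exact h 0 hd' hs
  | succ n ih =>
    rintro hd ⟨d, hs', hn⟩
    rcases hs : step c with d' | hd'
    · cases Sum.inl.inj ((step_subst hs θ).symm.trans hs')
      exact ih ((Reach.of_step hs).div_iff.1 h) hd hn
    · exact h 0 hd' hs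

end Cfg

/-! ### Similarity of configurations -/

open Cfg

/-- A numeral with a stack. -/
abbrev Cfg.numCfg {Γ : Ctx} (i : ℕ) (S : List (ℕ → Meta .exp Γ)) : Cfg Γ :=
  ⟨(Meta.num i : Meta .exp Γ), S⟩

/-- A relation between configurations. -/
abbrev CRel : Type := ∀ Γ, Cfg Γ → Cfg Γ → Prop

/-- The two configurations have the same root, and `R` relates their parts. -/
inductive CMatch (R : CRel) {Γ : Ctx} : Cfg Γ → Cfg Γ → Prop
  | num {s s' : Srt} (n : ℕ) :
      CMatch R ⟨(Meta.num n : Meta s Γ), []⟩ ⟨(Meta.num n : Meta s' Γ), []⟩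
  | case {s s' : Srt} {G G' : Meta .gnd Γ} {E E' : ℕ → Meta .exp Γ}
      {S S' : List (ℕ → Meta .exp Γ)} : R Γ ⟨G, []⟩ ⟨G', []⟩ →
      (∀ i, R Γ ⟨E i, []⟩ ⟨E' i, []⟩) → (∀ i, R Γ (numCfg i S) (numCfg i S')) →
      CMatch R ⟨(Meta.case G E : Meta s Γ), S⟩ ⟨(Meta.case G' E' : Meta s' Γ), S'⟩
  | app {σ : Ty} (x : Var Γ σ) {Q Q' : ∀ v : Place σ.args, MProc Γ v.1}
      {S S' : List (ℕ → Meta .exp Γ)} : (∀ v, R _ ⟨Q v, []⟩ ⟨Q' v, []⟩) →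
      (∀ i, R Γ (numCfg i S) (numCfg i S')) →
      CMatch R ⟨Meta.app x Q, S⟩ ⟨Meta.app x Q', S'⟩
  | beta {σ : Ty} {P P' : MProc Γ σ} {Q Q' : ∀ v : Place σ.args, MProc Γ v.1}
      {S S' : List (ℕ → Meta .exp Γ)} : R _ ⟨P, []⟩ ⟨P', []⟩ →
      (∀ v, R _ ⟨Q v, []⟩ ⟨Q' v, []⟩) → (∀ i, R Γ (numCfg i S) (numCfg i S')) →
      CMatch R ⟨Meta.beta P Q, S⟩ ⟨Meta.beta P' Q', S'⟩

theorem CMatch.mono {R R' : CRel} (h : ∀ Γ c d, R Γ c d → R' Γ c d) {Γ : Ctx} {c d : Cfg Γ}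
    (hm : CMatch R c d) : CMatch R' c d := by
  cases hm with
  | num n => exact .num n
  | case hG hE hS => exact .case (h _ _ _ hG) (fun i => h _ _ _ (hE i)) fun i => h _ _ _ (hS i)
  | app x hQ hS => exact .app x (fun i => h _ _ _ (hQ i)) fun i => h _ _ _ (hS i)
  | beta hP hQ hS => exact .beta (h _ _ _ hP) (fun i => h _ _ _ (hQ i)) fun i => h _ _ _ (hS i)

theorem CMatch.symm {R : CRel} {Γ : Ctx} {c d : Cfg Γ}
    (hm : CMatch R c d) : CMatch (fun Γ c d => R Γ d c) d c := by
  cases hm with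
  | num n => exact .num n
  | case hG hE hS => exact .case hG hE hS
  | app x hQ hS => exact .app x hQ hS
  | beta hP hQ hS => exact .beta hP hQ hS

/-- One unfolding of similarity. -/
def CStep (R : CRel) {Γ : Ctx} (c d : Cfg Γ) : Prop :=
  (Div c ∧ Div d) ∨ ∃ c' d', Reach c c' ∧ Reach d d' ∧ CMatch R c' d'

theorem CStep.mono {R R' : CRel} (h : ∀ Γ c d, R Γ c d → R' Γ c d) {Γ : Ctx} {c d : Cfg Γ}
    (hm : CStep R c d) : CStep R' c d :=
  hm.imp_right fun ⟨c', d', hc, hd, hm⟩ => ⟨c', d', hc, hd, hm.mono h⟩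

theorem CStep.back {R : CRel} {Γ : Ctx} {c d c' d' : Cfg Γ} (hc : Reach c c') (hd : Reach d d')
    (h : CStep R c' d') : CStep R c d := by
  rcases h with ⟨h, h'⟩ | ⟨c'', d'', hc', hd', hm⟩
  · exact .inl ⟨hc.div_iff.2 h, hd.div_iff.2 h'⟩
  · exact .inr ⟨c'', d'', hc.trans hc', hd.trans hd', hm⟩

theorem CStep.flip {R : CRel} {Γ : Ctx} {c d : Cfg Γ} (h : CStep R c d) :
    CStep (fun Γ c d => R Γ d c) d c := by
  rcases h with ⟨h, h'⟩ | ⟨c', d', hc, hd, hm⟩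
  exacts [.inl ⟨h', h⟩, .inr ⟨d', c', hd, hc, hm.symm⟩]

theorem CMatch.num_inv {R : CRel} {Γ : Ctx} {s : Srt} {n : ℕ} {L : List (ℕ → Meta .exp Γ)}
    {d : Cfg Γ} (h : CMatch R ⟨(Meta.num n : Meta s Γ), L⟩ d) :
    L = [] ∧ ∃ s', d = ⟨(Meta.num n : Meta s' Γ), []⟩ := by
  generalize hc : (⟨(Meta.num n : Meta s Γ), L⟩ : Cfg Γ) = c at h
  have key : ∀ {s' : Srt} {T : Meta s' Γ} {S : List (ℕ → Meta .exp Γ)},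
      (⟨(Meta.num n : Meta s Γ), L⟩ : Cfg Γ) = ⟨T, S⟩ → T = Meta.num n ∧ L = S := by
    rintro s' T S ⟨⟩
    exact ⟨rfl, rfl⟩
  cases h with
  | num m =>
    obtain ⟨h, rfl⟩ := key hc
    have := congrArg (Tree.dest (S := metaSig)) h
    simp only [Meta.dest_num] at this
    cases this
    exact ⟨rfl, _, rfl⟩
  | case => cases congrArg (Tree.dest (S := metaSig)) (key hc).1
  | app => cases congrArg (Tree.dest (S := metaSig)) (key hc).1
  | beta => cases congrArg (Tree.dest (S := metaSig)) (key hc).1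

/-- The sort of a numeral is invisible to the machine: with a non-empty stack the numeral disappears
in one step, and with an empty stack `CMatch.num` ignores sorts. This is needed because runs end in
numerals of either sort, while frames are compared on numerals of sort `exp`. -/
theorem CStep.num_sort {R : CRel} {Γ : Ctx} {s s' : Srt} {n : ℕ} {L : List (ℕ → Meta .exp Γ)}
    {d : Cfg Γ} (h : CStep R ⟨(Meta.num n : Meta s Γ), L⟩ d) :
    CStep R ⟨(Meta.num n : Meta s' Γ), L⟩ d := by
  cases L with
  | cons E S =>
    rcases h with ⟨h, h'⟩ | ⟨c, d', hc, hd, hm⟩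
    · exact .inl ⟨(Reach.of_step (step_num_cons ..)).div_iff.2
        ((Reach.of_step (step_num_cons ..)).div_iff.1 h), h'⟩
    · rcases Relation.ReflTransGen.cases_head hc with rfl | ⟨e, he, hc⟩
      · cases hm.num_inv.1
      · exact .inr ⟨c, d', .head (by simpa using he) hc, hd, hm⟩
  | nil =>
    rcases h with ⟨h, -⟩ | ⟨c, d', hc, hd, hm⟩
    · exact absurd (step_num (s := s) n) (h 0 _)
    · rcases Relation.ReflTransGen.cases_head hc with rfl | ⟨e, he, -⟩
      · obtain ⟨-, s'', rfl⟩ := hm.num_inv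
        exact .inr ⟨_, _, .refl _, hd, .num n⟩
      · simp at he

/-- Similarity: the two configurations have the same infinitary normal form, up to contexts (the
largest relation closed under `CStep`). -/
def CSim {Γ : Ctx} (c d : Cfg Γ) : Prop :=
  ∃ R : CRel, R Γ c d ∧ ∀ Γ c d, R Γ c d → CStep R c d

namespace CSim

variable {Γ Δ : Ctx}

/-- Coinduction up to similarity: parts already known to be similar need not belong to the candidate
relation. -/
theorem coind {R : CRel} (hR : ∀ Γ c d, R Γ c d → CStep (fun Γ c d => R Γ c d ∨ CSim c d) c d)
    {c d : Cfg Γ} (h : R Γ c d) : CSim c d := by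
  refine ⟨fun Γ c d => R Γ c d ∨ CSim c d, .inl h, ?_⟩
  rintro Γ c d (h | ⟨R', h, hR'⟩)
  · exact hR _ _ _ h
  · exact (hR' _ _ _ h).mono fun _ _ _ h => .inr ⟨R', h, hR'⟩

theorem unfold {c d : Cfg Γ} : CSim c d → CStep (fun _ => CSim) c d
  | ⟨R, h, hR⟩ => (hR _ _ _ h).mono fun _ _ _ h => ⟨R, h, hR⟩

theorem fold {c d : Cfg Γ} (h : CStep (fun _ => CSim) c d) : CSim c d :=
  coind (R := fun _ c d => CStep (fun _ => CSim) c d)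
    (fun _ _ _ h => h.mono fun _ _ _ h => .inr h) h

theorem back {c d c' d' : Cfg Γ} (hc : Reach c c') (hd : Reach d d') (h : CSim c' d') :
    CSim c d := fold (h.unfold.back hc hd)

theorem symm {c d : Cfg Γ} (h : CSim c d) : CSim d c := by
  refine ⟨fun _ c d => CSim d c, h, ?_⟩
  intro Γ c d h
  rcases h.unfold with ⟨h, h'⟩ | ⟨c', d', hc, hd, hm⟩
  · exact .inl ⟨h', h⟩
  · exact .inr ⟨d', c', hd, hc, hm.symm⟩

theorem refl (c : Cfg Γ) : CSim c c := by
  refine ⟨fun _ c d => c = d, rfl, ?_⟩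
  rintro Γ c _ rfl
  by_cases hc : Div c
  · exact .inl ⟨hc, hc⟩
  simp only [Cfg.Div, not_forall, not_not] at hc
  obtain ⟨n, h, hn⟩ := hc
  obtain ⟨d, hr, hs⟩ := hn.reach
  refine .inr ⟨d, d, hr, hr, ?_⟩
  cases final_of_step hs with
  | num n => exact .num n
  | app x Q S => exact .app x (fun _ => rfl) fun _ => rfl

/-- Stacks are compared only by what they do to numerals. Hence frames may be added below both
stacks without a bijection between frames, and an identity frame may face an empty stack. -/
theorem append {c d : Cfg Γ} (h : CSim c d) {L L' : List (ℕ → Meta .exp Γ)}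
    (hL : ∀ i, CSim (numCfg i L) (numCfg i L')) : CSim (c.append L) (d.append L') := by
  refine coind (R := fun Γ c d => ∃ (c₀ d₀ : Cfg Γ) (L L' : _), CSim c₀ d₀ ∧
    (∀ i, CSim (numCfg i L) (numCfg i L')) ∧ c = c₀.append L ∧ d = d₀.append L') ?_
    ⟨c, d, L, L', h, hL, rfl, rfl⟩
  rintro Γ _ _ ⟨c, d, L, L', h, hL, rfl, rfl⟩
  rcases h.unfold with ⟨h, h'⟩ | ⟨c', d', hc, hd, hm⟩
  · exact .inl ⟨h.append L, h'.append L'⟩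
  refine CStep.back (hc.append L) (hd.append L') ?_
  cases hm with
  | num n =>
    -- The original runs have ended in the numeral `n`, so the added frames take over and `hL n`
    -- applies once both sorts are adjusted.
    exact (((hL n).unfold.mono fun _ _ _ => .inr).num_sort.flip.num_sort).flip
  | case hG hE hS =>
    exact .inr ⟨_, _, .refl _, .refl _,
      .case (.inr hG) (fun i => .inr (hE i)) fun i => .inl ⟨_, _, L, L', hS i, hL, rfl, rfl⟩⟩
  | app x hQ hS =>
    exact .inr ⟨_, _, .refl _, .refl _,
      .app x (fun i => .inr (hQ i)) fun i => .inl ⟨_, _, L, L', hS i, hL, rfl, rfl⟩⟩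
  | beta hP hQ hS =>
    exact .inr ⟨_, _, .refl _, .refl _,
      .beta (.inr hP) (fun i => .inr (hQ i)) fun i => .inl ⟨_, _, L, L', hS i, hL, rfl, rfl⟩⟩

end CSim

end

end NSP

/-! ### Compatibility of similarity with substitution, and infinitary normal forms -/

namespace NSP

noncomputable section

open Cfg

/-! ### η-expansions as meta-terms -/

/-- The η-expansion of a variable as a meta-procedure. -/
def etaM {Γ : Ctx} {σ : Ty} (x : Var Γ σ) : MProc Γ σ := Meta.ofTerm (eta σ Γ x).body

theorem etaM_eq {Γ : Ctx} {σ : Ty} (x : Var Γ σ) :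
    etaM x = Meta.case (Meta.app (Var.wk σ.args x) fun v => etaM (Var.new Γ v.2)) Meta.num := by
  rw [etaM, eta]
  refine (Meta.ofTerm_case _ _ _).trans ?_
  congr 1
  funext i
  exact Meta.ofTerm_num i

theorem etaM_subst {Γ Δ : Ctx} {σ : Ty} {x : Var Γ σ} {θ : Sub Γ Δ} {y : Var Δ σ}
    (h : θ σ x = .inl y) : (etaM x).subst (θ.lift σ.args) = etaM y := by
  rw [etaM_eq, etaM_eq, Meta.subst_case,
    Meta.subst_app_inl (θ.lift σ.args) (y := Var.wk σ.args y) (by rw [Sub.lift_wk, h]; rfl)]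
  simp only [Meta.subst_num]
  congr 2
  funext v
  have := Var.sizeOf_lt v.2
  exact etaM_subst (Sub.lift_new θ v.2)
termination_by sizeOf σ

theorem etaM_rename {Γ Δ : Ctx} {σ : Ty} (x : Var Γ σ) (r : Ren Γ Δ) :
    (etaM x).rename (r.lift σ.args) = etaM (r σ x) := by
  rw [← Meta.subst_ofRen, ← Sub.lift_ofRen]
  exact etaM_subst rfl

namespace Sub

theorem subVal_ofRen {Γ Δ : Ctx} (r : Ren Γ Δ) {ρ : Ty} (a : Var Γ ρ ⊕ MProc Γ ρ) :
    subVal (ofRen r) a = renVal r a := by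
  cases a with
  | inl y => rfl
  | inr P => simp only [subVal, renVal, lift_ofRen, Meta.subst_ofRen]

/-- The substitution of new variables by their η-expansions. -/
def etaNew (Γ : Ctx) (σs : List Ty) : Sub (ext Γ σs) (ext Γ σs) := fun _ v =>
  match Var.split σs v with
  | .inl w => .inl (Var.wk σs w)
  | .inr w => .inr (etaM (Var.new Γ w))

@[simp] theorem etaNew_wk {Γ : Ctx} {σs : List Ty} {ρ : Ty} (v : Var Γ ρ) :
    etaNew Γ σs ρ (Var.wk σs v) = .inl (Var.wk σs v) := by simp [etaNew]

@[simp] theorem etaNew_new {Γ : Ctx} {σs : List Ty} {ρ : Ty} (v : Var σs ρ) :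
    etaNew Γ σs ρ (Var.new Γ v) = .inr (etaM (Var.new Γ v)) := by simp [etaNew]

end Sub

/-- An η-expansion with `P` substituted for its variable runs to `P` itself, up to two harmless
changes: the bound variables of `P` are η-expanded, and an identity frame `Meta.num` is left on the
stack. -/
theorem etaM_subst_reach {Γ Δ : Ctx} {σ : Ty} {x : Var Γ σ} {θ : Sub Γ Δ} {P : MProc Δ σ}
    (h : θ σ x = .inr P) (L : List (ℕ → Meta .exp (ext Δ σ.args))) :
    Reach ⟨(etaM x).subst (θ.lift σ.args), L⟩
      ⟨P.subst (Sub.etaNew Δ σ.args), Meta.num :: L⟩ := by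
  rw [etaM_eq, Meta.subst_case, Meta.subst_app_inr (θ.lift σ.args)
    (P := P.rename ((Ren.wk Δ σ.args).lift σ.args)) (by rw [Sub.lift_wk, h]; rfl)]
  simp only [Meta.subst_num]
  refine Reach.head (step_case _ _) (Reach.of_step ?_)
  rw [step_beta, Meta.rename_subst]
  congr 3
  refine Sub.ext' (fun ρ v => ?_) fun ρ v => ?_
  · simp only [Ren.lift_wk, Sub.single_wk, Sub.etaNew_wk]; rfl
  · simp only [Ren.lift_new, Sub.single_new, Sub.etaNew_new]
    congr 1
    exact etaM_subst (Sub.lift_new θ v)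

/-! ### Similar substitutions in similar configurations -/

/-- A relation between meta-procedures. -/
abbrev PRel : Type := ∀ Γ ρ, MProc Γ ρ → MProc Γ ρ → Prop

/-- Related values of substitutions: equal variables, a variable and its η-expansion, or
meta-procedures related by `B`. -/
inductive ValRel (B : PRel) {Γ : Ctx} {ρ : Ty} : Var Γ ρ ⊕ MProc Γ ρ → Var Γ ρ ⊕ MProc Γ ρ → Prop
  | var (y : Var Γ ρ) : ValRel B (.inl y) (.inl y)
  | eta (y : Var Γ ρ) : ValRel B (.inl y) (.inr (etaM y))
  | proc {P P' : MProc Γ ρ} : B Γ ρ P P' → ValRel B (.inr P) (.inr P')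

/-- Related substitutions. -/
def SubRel (B : PRel) {Γ Δ : Ctx} (θ θ' : Sub Γ Δ) : Prop := ∀ ρ x, ValRel B (θ ρ x) (θ' ρ x)

/-- Stability under renaming. -/
def RenClosed (B : PRel) : Prop := ∀ ⦃Γ Δ : Ctx⦄ (r : Ren Γ Δ) ⦃ρ : Ty⦄ ⦃P P' : MProc Γ ρ⦄,
  B Γ ρ P P' → B Δ ρ (P.rename (r.lift ρ.args)) (P'.rename (r.lift ρ.args))

theorem ValRel.rename {B : PRel} (hr : RenClosed B) {Γ Δ : Ctx} (r : Ren Γ Δ) {ρ : Ty}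
    {a a' : Var Γ ρ ⊕ MProc Γ ρ} (h : ValRel B a a') :
    ValRel B (Sub.renVal r a) (Sub.renVal r a') := by
  cases h with
  | var y => exact .var _
  | eta y =>
    simp only [Sub.renVal, etaM_rename]
    exact .eta _
  | proc h => exact .proc (hr r h)

theorem SubRel.lift {B : PRel} (hr : RenClosed B) {Γ Δ : Ctx} {θ θ' : Sub Γ Δ} (h : SubRel B θ θ')
    (σs : List Ty) : SubRel B (θ.lift σs) (θ'.lift σs) := by
  intro ρ x
  rcases Var.wk_or_new σs x with ⟨w, rfl⟩ | ⟨w, rfl⟩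
  · rw [Sub.lift_wk, Sub.lift_wk]
    exact (h _ _).rename hr _
  · rw [Sub.lift_new, Sub.lift_new]
    exact .var _

/-- This is the situation below a binder after `etaM_subst_reach` has acted on the right: the bound
variables are kept on the left and η-expanded on the right. -/
theorem SubRel.lift_eta {B : PRel} (hr : RenClosed B) {Γ Δ : Ctx} {θ θ' : Sub Γ Δ}
    (h : SubRel B θ θ') (σs : List Ty) :
    SubRel B (θ.lift σs) ((θ'.lift σs).comp (Sub.etaNew Δ σs)) := by
  intro ρ x
  rcases Var.wk_or_new σs x with ⟨w, rfl⟩ | ⟨w, rfl⟩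
  · rw [Sub.comp, Sub.lift_wk, Sub.lift_wk, Sub.subVal_renVal]
    have : (fun ρ v => Sub.etaNew Δ σs ρ (Ren.wk Δ σs ρ v)) = Sub.ofRen (Ren.wk Δ σs) := by
      funext ρ v
      exact Sub.etaNew_wk v
    rw [this, Sub.subVal_ofRen]
    exact (h _ _).rename hr _
  · rw [Sub.comp, Sub.lift_new, Sub.lift_new, Sub.subVal, Sub.etaNew_new]
    exact .eta _

theorem CSim.num_frame {Γ : Ctx} (i : ℕ) :
    CSim (numCfg i ([] : List (ℕ → Meta .exp Γ))) (numCfg i [Meta.num]) :=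
  CSim.back (.refl _) (.of_step (step_num_cons ..)) (.refl _)

/-- Pairs of configurations that run to related instances of similar configurations. -/
def SubstCand (B : PRel) : CRel := fun Δ c d =>
  ∃ (Γ : Ctx) (c₀ d₀ : Cfg Γ) (θ θ' : Sub Γ Δ), CSim c₀ d₀ ∧ SubRel B θ θ' ∧
    Reach c (c₀.subst θ) ∧ Reach d (d₀.subst θ')

/-- The central coinduction. Matching roots stay matching after substitution. Where a head variable
is replaced on both sides, the resulting redexes are matched part by part without being run, so only
the operators need attention, and `hB` makes them candidates again. The parameter `B` is later taken
empty, then as similarity, then as the pairs formed by a fixed point and `F_σ`. -/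
theorem SubstCand.csim {B : PRel} (hr : RenClosed B)
    (hB : ∀ Γ ρ P P', B Γ ρ P P' → SubstCand B _ ⟨P, []⟩ ⟨P', []⟩) {Δ : Ctx} {c d : Cfg Δ}
    (h : SubstCand B Δ c d) : CSim c d := by
  refine CSim.coind (R := SubstCand B) ?_ h
  rintro Δ c d ⟨Γ, c₀, d₀, θ, θ', hs, hθ, hc, hd⟩
  rcases hs.unfold with ⟨h, h'⟩ | ⟨c', d', hc', hd', hm⟩
  · exact .inl ⟨hc.div_iff.2 (h.subst θ), hd.div_iff.2 (h'.subst θ')⟩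
  refine CStep.back (hc.trans (hc'.subst θ)) (hd.trans (hd'.subst θ')) ?_
  have key : ∀ {c d : Cfg Γ}, CSim c d → SubstCand B Δ (c.subst θ) (d.subst θ') :=
    fun h => ⟨Γ, _, _, θ, θ', h, hθ, .refl _, .refl _⟩
  have num : ∀ {S S' : List (ℕ → Meta .exp Γ)}, (∀ i, CSim (numCfg i S) (numCfg i S')) → ∀ i,
      SubstCand B Δ (numCfg i (S.map fun E i => (E i).subst θ))
        (numCfg i (S'.map fun E i => (E i).subst θ')) := fun h i => by
    have := key (h i)
    simpa only [Cfg.subst, Meta.subst_num] using this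
  have lift : ∀ (σs : List Ty) {P P' : Meta .exp (ext Γ σs)}, CSim ⟨P, []⟩ ⟨P', []⟩ →
      SubstCand B _ ⟨P.subst (θ.lift σs), []⟩ ⟨P'.subst (θ'.lift σs), []⟩ :=
    fun σs P P' h => ⟨_, _, _, _, _, h, hθ.lift hr σs, .refl _, .refl _⟩
  cases hm with
  | num n =>
    simp only [Cfg.subst, Meta.subst_num]
    exact .inr ⟨_, _, .refl _, .refl _, .num n⟩
  | case hG hE hS =>
    simp only [Cfg.subst, Meta.subst_case]
    exact .inr ⟨_, _, .refl _, .refl _,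
      .case (.inl (key hG)) (fun i => .inl (key (hE i))) fun i => .inl (num hS i)⟩
  | @app σ x Q Q' S S' hQ hS =>
    have hx := hθ σ x
    unfold Cfg.subst
    generalize ha : θ σ x = a at hx
    generalize ha' : θ' σ x = a' at hx
    cases hx with
    | var y =>
      dsimp only
      rw [Meta.subst_app_inl θ ha, Meta.subst_app_inl θ' ha']
      exact .inr ⟨_, _, .refl _, .refl _,
        .app _ (fun v => .inl (lift _ (hQ v))) fun i => .inl (num hS i)⟩
    | proc h =>
      dsimp only
      rw [Meta.subst_app_inr θ ha, Meta.subst_app_inr θ' ha']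
      exact .inr ⟨_, _, .refl _, .refl _,
        .beta (.inl (hB _ _ _ _ h)) (fun v => .inl (lift _ (hQ v))) fun i => .inl (num hS i)⟩
    | eta y =>
      dsimp only
      rw [Meta.subst_app_inl θ ha, Meta.subst_app_inr θ' ha']
      -- On the right the redex with operator `etaM y` fires and exposes `y` again. Its new
      -- arguments are η-expanded variables with `Q'` substituted, and they run to `Q' v` with
      -- η-expanded bound variables, so `lift_eta` makes each pair of arguments a candidate. The
      -- frames `Meta.num` left behind act as the identity.
      refine .inr ⟨_, ⟨Meta.app y _, Meta.num :: S'.map fun E i => (E i).subst θ'⟩, .refl _, .head (step_beta ..) ?_,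
        .app _ (Q' := fun v => (etaM (Var.new Δ v.2)).subst ((Sub.single σ.args fun v =>
          (Q' v).subst (θ'.lift v.1.args)).lift v.1.args))
          (S' := Meta.num :: S'.map fun E i => (E i).subst θ') (fun v => .inl ?_) fun i => .inl ?_⟩
      · rw [etaM_eq, Meta.subst_case, Meta.subst_app_inl _ (Sub.single_wk _ _)]
        simp only [Meta.subst_num]
        exact .of_step (step_case ..)
      · refine ⟨_, ⟨Q v, []⟩, ⟨Q' v, [Meta.num]⟩, _, _, (hQ v).append CSim.num_frame,
          hθ.lift_eta hr v.1.args, .refl _, ?_⟩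
        have := etaM_subst_reach (θ := Sub.single σ.args fun v =>
          (Q' v).subst (θ'.lift v.1.args)) (Sub.single_new _ v.2) []
        rw [Meta.subst_subst] at this
        simpa only [Cfg.subst, List.map, Meta.subst_num] using this
      · obtain ⟨Γ', c, d, θ₁, θ₂, h₁, h₂, h₃, h₄⟩ := num hS i
        exact ⟨Γ', c, d, θ₁, θ₂, h₁, h₂, h₃, .head (step_num_cons ..) h₄⟩
  | beta hP hQ hS =>
    simp only [Cfg.subst, Meta.subst_beta]
    exact .inr ⟨_, _, .refl _, .refl _,
      .beta (.inl (lift _ hP)) (fun v => .inl (lift _ (hQ v))) fun i => .inl (num hS i)⟩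

/-- Similarity of meta-procedures. -/
def PSim : PRel := fun _ _ P P' => CSim ⟨P, []⟩ ⟨P', []⟩

/-- First use of the coinduction, with the empty `B`: only variables and η-expansions are
substituted. It yields stability of `PSim` under renaming, which the general case takes as a
hypothesis. -/
theorem CSim.subst_of_vars {Γ Δ : Ctx} {c d : Cfg Γ} (h : CSim c d) {θ θ' : Sub Γ Δ}
    (hθ : SubRel (fun _ _ _ _ => False) θ θ') : CSim (c.subst θ) (d.subst θ') :=
  SubstCand.csim (B := fun _ _ _ _ => False) (fun _ _ _ _ _ _ => id) (fun _ _ _ _ => False.elim)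
    ⟨_, _, _, _, _, h, hθ, .refl _, .refl _⟩

theorem PSim.renClosed : RenClosed PSim := fun Γ Δ r ρ P P' h => by
  have := CSim.subst_of_vars h (θ := Sub.ofRen (r.lift ρ.args))
    (θ' := Sub.ofRen (r.lift ρ.args)) (fun _ _ => .var _)
  simpa only [PSim, Cfg.subst, List.map, Meta.subst_ofRen] using this

theorem SubstCand.of_csim {B : PRel} {Γ : Ctx} {c d : Cfg Γ} (h : CSim c d) :
    SubstCand B Γ c d :=
  ⟨Γ, c, d, fun _ v => .inl v, fun _ v => .inl v, h, fun _ _ => .var _, by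
    simp only [Cfg.subst, Meta.subst_id, List.map_id']; exact .refl _, by
    simp only [Cfg.subst, Meta.subst_id, List.map_id']; exact .refl _⟩

theorem CSim.subst {Γ Δ : Ctx} {c d : Cfg Γ} (h : CSim c d) {θ θ' : Sub Γ Δ}
    (hθ : SubRel PSim θ θ') : CSim (c.subst θ) (d.subst θ') :=
  SubstCand.csim PSim.renClosed (fun _ _ _ _ h => .of_csim h)
    ⟨_, _, _, _, _, h, hθ, .refl _, .refl _⟩

theorem SubRel.rfl' {Γ Δ : Ctx} (θ : Sub Γ Δ) : SubRel PSim θ θ := by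
  intro ρ x
  rcases θ ρ x with y | P
  exacts [.var _, .proc (.refl _)]

/-! ### Similar configurations have equal values -/

/-- Similar final results. -/
inductive HRel {Γ : Ctx} : Hd Γ → Hd Γ → Prop
  | num (n : ℕ) : HRel (.num n) (.num n)
  | app {σ : Ty} (x : Var Γ σ) {Q Q' : ∀ v : Place σ.args, MProc Γ v.1}
      {S S' : List (ℕ → Meta .exp Γ)} : (∀ v, CSim ⟨Q v, []⟩ ⟨Q' v, []⟩) →
      (∀ i, CSim (numCfg i S) (numCfg i S')) → HRel (.app x Q S) (.app x Q' S')

/-- Similarity may stop at a redex, so it says nothing directly about results. Here the matched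
redexes are fired: the contracta are similar by `CSim.append` and `CSim.subst`, and the run of the
left side has become strictly shorter. -/
theorem CSim.haltsIn {Γ : Ctx} {n : ℕ} {c d : Cfg Γ} {h : Hd Γ} (hs : CSim c d)
    (hn : HaltsIn n c h) : ∃ m h', HaltsIn m d h' ∧ HRel h h' := by
  induction n using Nat.strong_induction_on generalizing c d with
  | _ n ih =>
  rcases hs.unfold with ⟨hc, -⟩ | ⟨c', d', hc, hd, hm⟩
  · exact absurd hn (hc n h)
  suffices ∃ m h', HaltsIn m d' h' ∧ HRel h h' by
    obtain ⟨m, h', hm, hh⟩ := this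
    obtain ⟨m', hm'⟩ := hd.halts_back hm
    exact ⟨m', h', hm', hh⟩
  obtain ⟨k, hk, hn'⟩ := hc.haltsIn hn
  have next : ∀ {c'' d'' : Cfg Γ}, step c' = .inl c'' → step d' = .inl d'' → CSim c'' d'' →
      ∃ m h', HaltsIn m d' h' ∧ HRel h h' := by
    intro c'' d'' h₁ h₂ h₃
    cases k with
    | zero => cases h₁.symm.trans hn'
    | succ k =>
      obtain ⟨e, he, hn'⟩ := hn'
      cases Sum.inl.inj (h₁.symm.trans he)
      obtain ⟨m, h', hm, hh⟩ := ih k (by omega) h₃ hn'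
      exact ⟨m + 1, h', ⟨_, h₂, hm⟩, hh⟩
  cases hm with
  | num n =>
    cases HaltsIn.det hn' (m := 0) (step_num n)
    exact ⟨0, _, step_num n, .num n⟩
  | app x hQ hS =>
    cases HaltsIn.det hn' (m := 0) (step_app ..)
    exact ⟨0, _, step_app .., .app x hQ hS⟩
  | @case _ _ G G' E E' S S' hG hE hS =>
    refine next (step_case ..) (step_case ..) (hG.append (L := E :: S) (L' := E' :: S') fun i => ?_)
    exact CSim.back (.of_step (step_num_cons ..)) (.of_step (step_num_cons ..))
      ((hE i).append hS)
  | @beta σ P P' Q Q' S S' hP hQ hS =>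
    refine next (step_beta ..) (step_beta ..)
      ((hP.subst (θ := Sub.single _ Q) (θ' := Sub.single _ Q') ?_).append hS)
    intro ρ v
    rcases Var.wk_or_new σ.args v with ⟨w, rfl⟩ | ⟨w, rfl⟩
    · simp only [Sub.single_wk]; exact .var _
    · simp only [Sub.single_new]; exact .proc (hQ _)

open Classical in
/-- One step of the unfolding of the infinitary normal form. -/
def evStep (Γ : Ctx) (c : Cfg Γ) : expSig.Obj Cfg Γ :=
  if h : ∃ h n, HaltsIn n c h then
    match h.choose with
    | .num n => ⟨ExpShape.num n, fun b => nomatch b⟩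
    | .app (σ := σ) x Q S => ⟨ExpShape.case σ x, fun
        | .inl v => ⟨Q v, []⟩
        | .inr i => numCfg i S⟩
  else ⟨ExpShape.bot, fun b => nomatch b⟩

/-- The infinitary normal form of a configuration. -/
def ev {Γ : Ctx} (c : Cfg Γ) : Exp Γ := Tree.corec evStep c

/-- The infinitary normal form of a final result. -/
def evHd {Γ : Ctx} : Hd Γ → Exp Γ
  | .num n => Exp.num n
  | .app x Q S => Exp.case x (fun ρ v => Proc.mk ρ (ev ⟨Q ⟨ρ, v⟩, []⟩)) fun i => ev (numCfg i S)

theorem ev_of_div {Γ : Ctx} {c : Cfg Γ} (h : Div c) : ev c = Exp.bot Γ := by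
  have h' : ¬ ∃ h n, HaltsIn n c h := by
    rintro ⟨h', n, hn⟩
    exact h n h' hn
  rw [ev, Tree.corec_eq]
  have : evStep Γ c = ⟨ExpShape.bot, fun b => nomatch b⟩ := by rw [evStep, dif_neg h']
  rw [this]
  exact Exp.mk_bot _

theorem ev_of_halts {Γ : Ctx} {c : Cfg Γ} {n : ℕ} {h : Hd Γ} (hn : HaltsIn n c h) :
    ev c = evHd h := by
  have h' : ∃ h n, HaltsIn n c h := ⟨h, n, hn⟩
  have hc : h'.choose = h := by
    obtain ⟨m, hm⟩ := h'.choose_spec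
    exact hm.det hn
  rw [ev, Tree.corec_eq]
  cases h with
  | num n =>
    have : evStep Γ c = ⟨ExpShape.num n, fun b => nomatch b⟩ := by rw [evStep, dif_pos h', hc]
    rw [this]
    exact Exp.mk_num _ _
  | app x Q S =>
    have : evStep Γ c = ⟨ExpShape.case _ x, fun
        | .inl v => ⟨Q v, []⟩
        | .inr i => numCfg i S⟩ := by rw [evStep, dif_pos h', hc]
    rw [this]
    exact Exp.mk_case _ _

theorem ev_cases {Γ : Ctx} (c : Cfg Γ) :
    (Div c ∧ ev c = Exp.bot Γ) ∨ ∃ d h, Reach c d ∧ Final d h ∧ ev c = evHd h := by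
  by_cases hc : Div c
  · exact .inl ⟨hc, ev_of_div hc⟩
  · simp only [Cfg.Div, not_forall, not_not] at hc
    obtain ⟨n, h, hn⟩ := hc
    obtain ⟨d, hr, hs⟩ := hn.reach
    exact .inr ⟨d, h, hr, final_of_step hs, ev_of_halts hn⟩

theorem ev_reach {Γ : Ctx} {c d : Cfg Γ} (h : Reach c d) : ev c = ev d := by
  by_cases hd : Div d
  · rw [ev_of_div hd, ev_of_div (h.div_iff.2 hd)]
  · simp only [Cfg.Div, not_forall, not_not] at hd
    obtain ⟨n, h', hn⟩ := hd
    obtain ⟨m, hm⟩ := h.halts_back hn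
    rw [ev_of_halts hn, ev_of_halts hm]

theorem ev_of_step {Γ : Ctx} {c d : Cfg Γ} (h : step c = .inl d) : ev c = ev d :=
  ev_reach (.of_step h)

/-- Soundness of similarity. This is how all later equations between values are obtained;
transitivity of `CSim` is never needed. -/
theorem CSim.ev_eq {Γ : Ctx} {c d : Cfg Γ} (h : CSim c d) : ev c = ev d := by
  refine Exp.bisim (fun Γ t u => ∃ c d : Cfg Γ, CSim c d ∧ t = ev c ∧ u = ev d) ?_
    ⟨c, d, h, rfl, rfl⟩
  rintro Γ _ _ ⟨c, d, h, rfl, rfl⟩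
  by_cases hc : Div c
  · have hd : Div d := fun n h' hn => by
      obtain ⟨m, h', hm, -⟩ := h.symm.haltsIn hn
      exact hc m h' hm
    rw [ev_of_div hc, ev_of_div hd]
    exact .bot
  · simp only [Cfg.Div, not_forall, not_not] at hc
    obtain ⟨n, h₁, hn⟩ := hc
    obtain ⟨m, h₂, hm, hh⟩ := h.haltsIn hn
    rw [ev_of_halts hn, ev_of_halts hm]
    cases hh with
    | num n => exact .num n
    | app x hQ hS =>
      exact .case x (fun ρ v => ⟨_, _, hQ ⟨ρ, v⟩, rfl, rfl⟩) fun i => ⟨_, _, hS i, rfl, rfl⟩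

/-- A configuration is similar to its infinitary normal form. -/
theorem CSim.ofTerm_ev {Γ : Ctx} (c : Cfg Γ) : CSim c ⟨Meta.ofTerm (ev c), []⟩ := by
  -- Equality with the normal form would be too strict: a branch of the right-hand side appears as a
  -- numeral facing a frame, one step before the branch itself.
  refine CSim.coind (R := fun Γ c d => Reach d ⟨Meta.ofTerm (ev c), []⟩) ?_ (.refl _)
  intro Γ c d hd
  rcases ev_cases c with ⟨h, he⟩ | ⟨c', h, hc, hf, he⟩
  · rw [he, Meta.ofTerm_bot] at hd
    exact .inl ⟨h, hd.div_iff.2 div_bot⟩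
  · refine CStep.back hc hd ?_
    rw [he]
    cases hf with
    | num n =>
      rw [evHd, Meta.ofTerm_num]
      exact .inr ⟨_, _, .refl _, .refl _, .num n⟩
    | app x Q S =>
      rw [evHd, Meta.ofTerm_case]
      exact .inr ⟨_, _, .refl _, .of_step (step_case ..),
        .app x (fun v => .inl (.refl _)) fun i => .inl (.of_step (step_num_cons ..))⟩

theorem ev_ofTerm {Γ : Ctx} (t : Exp Γ) : ev ⟨Meta.ofTerm t, []⟩ = t := by
  refine Exp.bisim (fun Γ t u => ∃ c : Cfg Γ, t = ev c ∧ Reach c ⟨Meta.ofTerm u, []⟩) ?_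
    ⟨_, rfl, .refl _⟩
  rintro Γ _ t ⟨c, rfl, hc⟩
  rw [ev_reach hc]
  cases t.view with
  | bot =>
    rw [Meta.ofTerm_bot, ev_of_div div_bot]
    exact .bot
  | num n =>
    rw [Meta.ofTerm_num, ev_of_halts (n := 0) (step_num n)]
    exact .num n
  | case x q e =>
    rw [Meta.ofTerm_case, ev_of_step (step_case ..), ev_of_halts (n := 0) (step_app ..)]
    exact .case x (fun ρ v => ⟨_, rfl, .refl _⟩) fun i => ⟨_, rfl, .of_step (step_num_cons ..)⟩

end

end NSP

/-! ### Evaluation by finite reductions computes the infinitary normal form -/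

namespace NSP

noncomputable section

open Cfg

/-! ### The order on expressions and meta-terms -/

namespace Exp

variable {Γ : Ctx}

theorem num_ne_bot (n : ℕ) : (Exp.num n : Exp Γ) ≠ Exp.bot Γ := fun h => by
  have := congrArg (fun t : Exp Γ => (Tree.dest t).1) h
  simp only [dest_num, dest_bot] at this
  cases this

theorem case_ne_bot {σ : Ty} (x : Var Γ σ) (q : ∀ ρ, Var σ.args ρ → Proc Γ ρ) (e : ℕ → Exp Γ) :
    Exp.case x q e ≠ Exp.bot Γ := fun h => by
  have := congrArg (fun t : Exp Γ => (Tree.dest t).1) h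
  simp only [dest_case, dest_bot] at this
  cases this

theorem num_le_iff {n : ℕ} {u : Exp Γ} : Exp.num n ≤ u ↔ u = Exp.num n := by
  constructor
  · intro h
    obtain ⟨g, rfl, -⟩ := (Tree.mk_le_iff (num_ne_bot n)).1 h
    exact mk_num n g
  · rintro rfl
    exact le_rfl

theorem case_le_iff {σ : Ty} {x : Var Γ σ} {q : ∀ ρ, Var σ.args ρ → Proc Γ ρ} {e : ℕ → Exp Γ}
    {u : Exp Γ} : Exp.case x q e ≤ u ↔ ∃ q' e', u = Exp.case x q' e' ∧
      (∀ ρ v, (q ρ v).body ≤ (q' ρ v).body) ∧ ∀ i, e i ≤ e' i := by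
  constructor
  · intro h
    obtain ⟨g, rfl, hg⟩ := (Tree.mk_le_iff (case_ne_bot x q e)).1 h
    exact ⟨_, _, mk_case x g, fun ρ v => hg (.inl ⟨ρ, v⟩), fun i => hg (.inr i)⟩
  · rintro ⟨q', e', rfl, hq, he⟩
    exact Tree.mk_le_mk (fun | .inl ⟨ρ, v⟩ => hq ρ v | .inr i => he i)

theorem num_injective {n m : ℕ} (h : (Exp.num n : Exp Γ) = Exp.num m) : n = m := by
  cases congrArg (fun t : Exp Γ => (Tree.dest t).1) h
  rfl

theorem num_ne_case {n : ℕ} {σ : Ty} {x : Var Γ σ} {q : ∀ ρ, Var σ.args ρ → Proc Γ ρ}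
    {e : ℕ → Exp Γ} : Exp.num n ≠ Exp.case x q e := fun h => by
  cases congrArg (fun t : Exp Γ => (Tree.dest t).1) h

theorem case_inj {σ : Ty} {x x' : Var Γ σ} {q q' : ∀ ρ, Var σ.args ρ → Proc Γ ρ}
    {e e' : ℕ → Exp Γ} (h : Exp.case x q e = Exp.case x' q' e') : x = x' ∧ q = q' ∧ e = e' := by
  have h := Tree.mk_injective h
  simp only [Sigma.mk.injEq, ExpShape.case.injEq, heq_eq_eq, true_and] at h
  obtain ⟨rfl, h⟩ := h
  have h := eq_of_heq h
  exact ⟨rfl, funext fun ρ => funext fun v => congrFun h (.inl ⟨ρ, v⟩),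
    funext fun i => congrFun h (.inr i)⟩

theorem case_inj_ty {σ σ' : Ty} {x : Var Γ σ} {x' : Var Γ σ'} {q q'} {e e' : ℕ → Exp Γ}
    (h : Exp.case x q e = Exp.case x' q' e') : σ = σ' := by
  cases congrArg (fun t : Exp Γ => (Tree.dest t).1) h
  rfl

open Classical in
-- Finite expressions detect the order. The root is probed by a `case` with all subterms `⊥`, and
-- each subterm by a `case` that is `⊥` everywhere else.
theorem le_of_finite {e u : Exp Γ} (h : ∀ t : Exp Γ, t.Finite → t ≤ e → t ≤ u) : e ≤ u := by
  refine Tree.le_coind (S := expSig)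
    (fun Γ (e u : Exp Γ) => ∀ t : Exp Γ, t.Finite → t ≤ e → t ≤ u) ?_ h
  intro Γ e u h
  cases Exp.view e with
  | bot => exact .inl rfl
  | num n =>
    rw [num_le_iff.1 (h _ (.num n) le_rfl)]
    exact .inr ⟨_, _, _, rfl, rfl, fun b => nomatch b⟩
  | @case σ x q e =>
    right
    have h₀ := h (Exp.case x (fun ρ v => Proc.mk ρ (Exp.bot _)) fun _ => Exp.bot _)
      (.case _ _ _ 0 (fun _ _ => .bot _) (fun _ => .bot _) fun _ _ => rfl)
      (case_le_iff.2 ⟨_, _, rfl, fun _ _ => Tree.bot_le _, fun _ => Tree.bot_le _⟩)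
    obtain ⟨q', e', rfl, -, -⟩ := case_le_iff.1 h₀
    refine ⟨_, _, _, rfl, rfl, ?_⟩
    rintro (⟨ρ, v⟩ | i) t ht hle
    -- The probe for the argument at `v`: `t` in this place and `⊥` in all others, which keeps it
    -- finite and below the original `case`.
    · let p₀ : ∀ ρ, Var σ.args ρ → Proc Γ ρ := fun ρ _ => Proc.mk ρ (Exp.bot _)
      let p : ∀ ρ, Var σ.args ρ → Proc Γ ρ :=
        Function.update p₀ ρ (Function.update (p₀ ρ) v (Proc.mk ρ t))
      have hp : p ρ v = Proc.mk ρ t := by simp only [p, Function.update_self]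
      have hp' : ∀ ρ' v', (⟨ρ', v'⟩ : Place σ.args) = ⟨ρ, v⟩ ∨ p ρ' v' = Proc.mk ρ' (Exp.bot _) := by
        intro ρ' v'
        by_cases hρ : ρ' = ρ
        · subst hρ
          by_cases hv : v' = v
          · exact .inl (by rw [hv])
          · exact .inr (by simp only [p, Function.update_self, Function.update_of_ne hv, p₀])
        · exact .inr (by simp only [p, Function.update_of_ne hρ, p₀])
      have := h (Exp.case x p fun _ => Exp.bot _)
        (.case _ _ _ 0 (fun ρ' v' => ?_) (fun _ => .bot _) fun _ _ => rfl)
        (case_le_iff.2 ⟨_, _, rfl, fun ρ' v' => ?_, fun _ => Tree.bot_le _⟩)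
      · obtain ⟨q'', e'', heq, hq, -⟩ := case_le_iff.1 this
        obtain ⟨-, rfl, -⟩ := case_inj heq
        have := hq ρ v
        rwa [hp] at this
      · rcases hp' ρ' v' with h' | h'
        · cases h'; rw [hp]; exact ht
        · rw [h']; exact .bot _
      · rcases hp' ρ' v' with h' | h'
        · cases h'; rw [hp]; exact hle
        · rw [h']; exact Tree.bot_le _
    · have := h (Exp.case x (fun ρ v => Proc.mk ρ (Exp.bot _))
          (Function.update (fun _ => Exp.bot _) i t))
        (.case _ _ _ (i + 1) (fun _ _ => .bot _) (fun j => ?_) fun j hj => ?_)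
        (case_le_iff.2 ⟨_, _, rfl, fun _ _ => Tree.bot_le _, fun j => ?_⟩)
      · obtain ⟨q'', e'', heq, -, he⟩ := case_le_iff.1 this
        obtain ⟨-, -, rfl⟩ := case_inj heq
        have := he i
        simpa only [Function.update_self] using this
      · by_cases hj : j = i
        · subst hj; simpa only [Function.update_self] using ht
        · simp only [Function.update_of_ne hj]; exact .bot _
      · rw [Function.update_of_ne (by omega)]
      · by_cases hj : j = i
        · subst hj; simpa only [Function.update_self] using hle
        · simp only [Function.update_of_ne hj]; exact Tree.bot_le _

end Exp

namespace Meta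

variable {Γ : Ctx} {s : Srt}

theorem num_le_iff {n : ℕ} {U : Meta s Γ} : Meta.num n ≤ U ↔ U = Meta.num n := by
  constructor
  · intro h
    obtain ⟨g, rfl, -⟩ := (Tree.mk_le_iff (S := metaSig) (i := (s, Γ)) fun e => by
      have := congrArg (Tree.dest (S := metaSig) (i := (s, Γ))) e
      rw [Tree.dest_mk] at this
      cases congrArg Sigma.fst (this.trans dest_bot)).1 h
    exact mk_num n g
  · rintro rfl
    exact le_rfl

theorem case_le_iff {G : Meta .gnd Γ} {E : ℕ → Meta .exp Γ} {U : Meta s Γ} :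
    Meta.case G E ≤ U ↔ ∃ G' E', U = Meta.case G' E' ∧ G ≤ G' ∧ ∀ i, E i ≤ E' i := by
  constructor
  · intro h
    obtain ⟨g, rfl, hg⟩ := (Tree.mk_le_iff (S := metaSig) (i := (s, Γ)) fun e => by
      have := congrArg (Tree.dest (S := metaSig) (i := (s, Γ))) e
      rw [Tree.dest_mk] at this
      cases congrArg Sigma.fst (this.trans dest_bot)).1 h
    exact ⟨_, _, mk_case g, hg none, fun i => hg (some i)⟩
  · rintro ⟨G', E', rfl, hG, hE⟩
    exact Tree.mk_le_mk (S := metaSig) (i := (s, Γ)) (fun | none => hG | some i => hE i)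

theorem app_le_iff {σ : Ty} {x : Var Γ σ} {Q : ∀ v : Place σ.args, MProc Γ v.1}
    {U : Meta .gnd Γ} : Meta.app x Q ≤ U ↔ ∃ Q', U = Meta.app x Q' ∧ ∀ v, Q v ≤ Q' v := by
  constructor
  · intro h
    obtain ⟨g, rfl, hg⟩ := (Tree.mk_le_iff (S := metaSig) (i := (.gnd, Γ)) fun e => by
      have := congrArg (Tree.dest (S := metaSig) (i := (.gnd, Γ))) e
      rw [Tree.dest_mk] at this
      cases congrArg Sigma.fst (this.trans dest_bot)).1 h
    exact ⟨_, mk_app x g, hg⟩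
  · rintro ⟨Q', rfl, hQ⟩
    exact Tree.mk_le_mk (S := metaSig) (i := (.gnd, Γ)) hQ

theorem beta_le_iff {σ : Ty} {P : MProc Γ σ} {Q : ∀ v : Place σ.args, MProc Γ v.1}
    {U : Meta .gnd Γ} : Meta.beta P Q ≤ U ↔
      ∃ P' Q', U = Meta.beta P' Q' ∧ P ≤ P' ∧ ∀ v, Q v ≤ Q' v := by
  constructor
  · intro h
    obtain ⟨g, rfl, hg⟩ := (Tree.mk_le_iff (S := metaSig) (i := (.gnd, Γ)) fun e => by
      have := congrArg (Tree.dest (S := metaSig) (i := (.gnd, Γ))) e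
      rw [Tree.dest_mk] at this
      cases congrArg Sigma.fst (this.trans dest_bot)).1 h
    exact ⟨_, _, mk_beta g, hg none, fun v => hg (some v)⟩
  · rintro ⟨P', Q', rfl, hP, hQ⟩
    exact Tree.mk_le_mk (S := metaSig) (i := (.gnd, Γ)) (fun | none => hP | some v => hQ v)

end Meta

/-! ### General reduction preserves the infinitary normal form -/

variable {Γ : Ctx} {s : Srt}

theorem CSim.ofExp (s : Srt) (E : Meta .exp Γ) (S : List (ℕ → Meta .exp Γ)) :
    CSim ⟨Meta.ofExp s E, S⟩ ⟨E, S⟩ := by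
  cases E.view with
  | bot => simp only [Meta.ofExp_bot]; exact CSim.fold (.inl ⟨div_bot, div_bot⟩)
  | num n => simp only [Meta.ofExp_num]; exact CSim.fold (CSim.refl _).unfold.num_sort
  | case G E =>
    simp only [Meta.ofExp_case]
    exact CSim.back (.of_step (step_case ..)) (.of_step (step_case ..)) (.refl _)

theorem CSim.stack {T : Meta s Γ} {L L' : List (ℕ → Meta .exp Γ)}
    (h : ∀ i, CSim (numCfg i L) (numCfg i L')) : CSim ⟨T, L⟩ ⟨T, L'⟩ :=
  (CSim.refl ⟨T, []⟩).append h

theorem CSim.frame {T T' : Meta s Γ} (h : CSim ⟨T, []⟩ ⟨T', []⟩) (L : List (ℕ → Meta .exp Γ)) :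
    CSim ⟨T, L⟩ ⟨T', L⟩ := h.append fun _ => .refl _

/-- Each basic reduction is a machine step or a rearrangement of the stack: `case_case` replaces two
successive frames by one composite frame. -/
theorem Meta.Basic.csim {T T' : Meta s Γ} (h : Meta.Basic T T') : CSim ⟨T, []⟩ ⟨T', []⟩ := by
  cases h with
  | beta E Q => exact CSim.back (.of_step (step_beta ..)) (.refl _) (CSim.ofExp ..).symm
  | case_bot E =>
    exact CSim.fold (.inl ⟨(Reach.of_step (step_case ..)).div_iff.2 div_bot, div_bot⟩)
  | case_num n E =>
    exact CSim.back (.head (step_case ..) (.of_step (step_num_cons ..))) (.refl _)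
      (CSim.ofExp ..).symm
  | case_case G E F =>
    refine CSim.back (.head (step_case ..) (.of_step (step_case ..))) (.of_step (step_case ..))
      (.stack fun i => ?_)
    exact CSim.back (.of_step (step_num_cons ..))
      (.head (step_num_cons ..) (.of_step (step_case ..))) (CSim.ofExp ..).symm

theorem Meta.Head.csim {T T' : Meta s Γ} (h : Meta.Head T T') : CSim ⟨T, []⟩ ⟨T', []⟩ := by
  induction h with
  | basic h => exact h.csim
  | scrutinee E _ _ ih =>
    exact CSim.back (.of_step (step_case ..)) (.of_step (step_case ..)) (ih.frame _)

open Classical in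
theorem Meta.Red.csim {T T' : Meta s Γ} (h : Meta.Red T T') : CSim ⟨T, []⟩ ⟨T', []⟩ := by
  have upd : ∀ {Γ : Ctx} {σ : Ty} (Q : ∀ v : Place σ.args, MProc Γ v.1) (v : Place σ.args)
      (Q' : MProc Γ v.1), CSim ⟨Q v, []⟩ ⟨Q', []⟩ → ∀ [DecidableEq (Place σ.args)] w,
      CSim ⟨Q w, []⟩ ⟨Function.update Q v Q' w, []⟩ := by
    intro Γ σ Q v Q' h _ w
    by_cases hw : w = v
    · subst hw; rw [Function.update_self]; exact h
    · rw [Function.update_of_ne hw]; exact .refl _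
  induction h with
  | head h => exact h.csim
  | arg x Q v Q' _ ih =>
    exact CSim.fold (.inr ⟨_, _, .refl _, .refl _, .app x (upd _ _ _ ih) fun _ => .refl _⟩)
  | case_arg x Q E v Q' _ ih =>
    exact CSim.fold (.inr ⟨_, _, .of_step (step_case ..), .of_step (step_case ..),
      .app x (upd _ _ _ ih) fun _ => .refl _⟩)
  | branch x Q E j E' _ ih =>
    refine CSim.back (.of_step (step_case ..)) (.of_step (step_case ..)) (.stack fun i => ?_)
    refine CSim.back (.of_step (step_num_cons ..)) (.of_step (step_num_cons ..)) ?_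
    by_cases hi : i = j
    · subst hi; rw [Function.update_self]; exact ih
    · rw [Function.update_of_ne hi]; exact .refl _

theorem ev_reds {T T' : Meta .exp Γ} (h : Relation.ReflTransGen Meta.Red T T') :
    ev ⟨T, []⟩ = ev ⟨T', []⟩ := by
  induction h with
  | refl => rfl
  | tail _ h ih => exact ih.trans h.csim.ev_eq

/-- A part of a meta-term that is already a term contains no redex, so the machine leaves it in
place. -/
theorem le_ev_of_ofTerm_le {t : Exp Γ} {T : Meta .exp Γ} (h : Meta.ofTerm t ≤ T) :
    t ≤ ev ⟨T, []⟩ := by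
  refine Tree.le_coind (S := expSig) (fun Γ (t u : Exp Γ) => ∃ T : Meta .exp Γ,
    Meta.ofTerm t ≤ T ∧ u = ev ⟨T, []⟩) ?_ ⟨T, h, rfl⟩
  rintro Γ t _ ⟨T, h, rfl⟩
  cases Exp.view t with
  | bot => exact .inl rfl
  | num n =>
    rw [Meta.ofTerm_num, Meta.num_le_iff] at h
    subst h
    rw [ev_of_halts (n := 0) (step_num n)]
    exact .inr ⟨_, _, _, rfl, rfl, fun b => nomatch b⟩
  | case x q e =>
    rw [Meta.ofTerm_case, Meta.case_le_iff] at h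
    obtain ⟨G, E, rfl, hG, hE⟩ := h
    obtain ⟨Q, rfl, hQ⟩ := Meta.app_le_iff.1 hG
    rw [ev_of_step (step_case ..), ev_of_halts (n := 0) (step_app ..)]
    refine .inr ⟨_, _, _, rfl, rfl, ?_⟩
    rintro (⟨ρ, v⟩ | i)
    · exact ⟨_, hQ ⟨ρ, v⟩, rfl⟩
    · exact ⟨_, hE i, ev_of_step (step_num_cons ..)⟩

/-! ### Finite parts of the infinitary normal form are reached by reduction -/

/-- `K` is the composition of the families of branches in a stack. -/
inductive StackComp : (ℕ → Meta .exp Γ) → List (ℕ → Meta .exp Γ) → Prop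
  | single (E : ℕ → Meta .exp Γ) : StackComp E [E]
  | cons (E : ℕ → Meta .exp Γ) {K : ℕ → Meta .exp Γ} {S : List (ℕ → Meta .exp Γ)} :
      StackComp K S → StackComp (fun i => Meta.case (Meta.ofExp .gnd (E i)) K) (E :: S)

theorem StackComp.csim {K : ℕ → Meta .exp Γ} {S : List (ℕ → Meta .exp Γ)} (h : StackComp K S)
    (i : ℕ) : CSim (numCfg i [K]) (numCfg i S) := by
  induction h generalizing i with
  | single E => exact .refl _
  | cons E _ ih =>
    exact CSim.back (.head (step_num_cons ..) (.of_step (step_case ..)))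
      (.of_step (step_num_cons ..)) ((CSim.ofExp .gnd (E i) []).append ih)

/-- Head normal forms of meta-expressions that present a final result. -/
inductive Presents : Meta .exp Γ → Hd Γ → Prop
  | num (n : ℕ) : Presents (Meta.num n) (.num n)
  | app {σ : Ty} (x : Var Γ σ) (Q : ∀ v : Place σ.args, MProc Γ v.1) {K : ℕ → Meta .exp Γ}
      {S : List (ℕ → Meta .exp Γ)} : StackComp K S →
      Presents (Meta.case (Meta.app x Q) K) (.app x Q S)

theorem haltsIn_ofExp {n : ℕ} {E : Meta .exp Γ} {S : List (ℕ → Meta .exp Γ)} {h : Hd Γ} :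
    HaltsIn n ⟨Meta.ofExp s E, S⟩ h ↔ HaltsIn n ⟨E, S⟩ h := by
  cases n <;> simp only [HaltsIn, step_ofExp]

/-- The machine is simulated by head reduction. A stack has no counterpart in the syntax, so its
frames are merged into one family of branches by `StackComp`, which is exactly what repeated
`case_case` produces. The two statements, for an empty and a non-empty stack, feed each other along
the run. -/
theorem heads_of_haltsIn (n : ℕ) {h : Hd Γ} :
    (∀ T : Meta .exp Γ, HaltsIn n ⟨T, []⟩ h →
      ∃ F, Presents F h ∧ Relation.ReflTransGen Meta.Head T F) ∧
    ∀ (G : Meta .gnd Γ) (K : ℕ → Meta .exp Γ) (S : List (ℕ → Meta .exp Γ)), StackComp K S →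
      HaltsIn n ⟨G, S⟩ h → ∃ F, Presents F h ∧ Relation.ReflTransGen Meta.Head (Meta.case G K) F := by
  induction n with
  | zero =>
    constructor
    · intro T hn
      cases T.view with
      | bot => exact absurd hn (div_bot _ _)
      | num n => cases (step_num n).symm.trans hn; exact ⟨_, .num n, .refl⟩
      | case G E => cases (step_case ..).symm.trans hn
    · intro G K S hK hn
      cases G.view with
      | bot => exact absurd hn (div_bot _ _)
      | num n => cases hK <;> cases (step_num_cons ..).symm.trans hn
      | case G E => cases (step_case ..).symm.trans hn
      | app x Q => cases (step_app ..).symm.trans hn; exact ⟨_, .app x Q hK, .refl⟩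
      | beta P Q => cases (step_beta ..).symm.trans hn
  | succ n ih =>
    constructor
    · intro T hn
      cases T.view with
      | bot => exact absurd hn (div_bot _ _)
      | num n => obtain ⟨d, hd, -⟩ := hn; cases (step_num _).symm.trans hd
      | case G E =>
        obtain ⟨d, hd, hn⟩ := hn
        cases (step_case ..).symm.trans hd
        exact ih.2 _ _ _ (.single E) hn
    · intro G K S hK hn
      have head : ∀ {T T' : Meta .exp Γ}, Meta.Head T T' →
          (∃ F, Presents F h ∧ Relation.ReflTransGen Meta.Head T' F) →
          ∃ F, Presents F h ∧ Relation.ReflTransGen Meta.Head T F :=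
        fun h ⟨F, hF, hr⟩ => ⟨F, hF, .head h hr⟩
      cases G.view with
      | bot => exact absurd hn (div_bot _ _)
      | num i =>
        obtain ⟨d, hd, hn⟩ := hn
        refine head (.basic (.case_num i K)) ?_
        rw [Meta.ofExp_exp]
        cases hK with
        | single =>
          cases (step_num_cons ..).symm.trans hd
          exact ih.1 _ hn
        | cons E hK =>
          cases (step_num_cons ..).symm.trans hd
          exact ih.2 _ _ _ hK (haltsIn_ofExp.2 hn)
      | case G E =>
        obtain ⟨d, hd, hn⟩ := hn
        cases (step_case ..).symm.trans hd
        exact head (.basic (.case_case ..)) (ih.2 _ _ _ (.cons E hK) hn)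
      | app x Q => obtain ⟨d, hd, -⟩ := hn; cases (step_app ..).symm.trans hd
      | beta P Q =>
        obtain ⟨d, hd, hn⟩ := hn
        cases (step_beta ..).symm.trans hd
        -- Head reduction enters a scrutinee only if it is not a `case`; an application `P Q⃗` has a
        -- different root shape.
        refine head (.scrutinee K (.basic (.beta ..)) fun H F e => ?_)
          (ih.2 _ _ _ hK (haltsIn_ofExp.2 hn))
        cases congrArg (fun t => (Tree.dest (S := metaSig) t).1) e

theorem finite_place : ∀ σs : List Ty, Finite (Place σs)
  | [] => Finite.of_injective (β := Empty) (fun v => nomatch v.2) fun v => nomatch v.2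
  | σ :: σs =>
    have := finite_place σs
    Finite.of_surjective (α := Option (Place σs))
      (fun | none => (⟨σ, .here⟩ : Place (σ :: σs)) | some v => ⟨v.1, .there v.2⟩) fun
      | ⟨_, .here⟩ => ⟨none, rfl⟩
      | ⟨_, .there v⟩ => ⟨some ⟨_, v⟩, rfl⟩

open Classical in
-- `Red` rewrites one argument at a time. There are finitely many argument places, so all of them
-- are treated by induction on a finite set of places.
theorem reds_args {σ : Ty} (x : Var Γ σ) {Q Q' : ∀ v : Place σ.args, MProc Γ v.1}
    (K : ℕ → Meta .exp Γ) (h : ∀ v, Relation.ReflTransGen Meta.Red (Q v) (Q' v)) :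
    Relation.ReflTransGen Meta.Red (Meta.case (Meta.app x Q) K : Meta s Γ)
      (Meta.case (Meta.app x Q') K) := by
  have one : ∀ (R : ∀ v : Place σ.args, MProc Γ v.1) (v : Place σ.args) (T : MProc Γ v.1),
      Relation.ReflTransGen Meta.Red (R v) T →
      Relation.ReflTransGen Meta.Red (Meta.case (Meta.app x R) K : Meta s Γ)
        (Meta.case (Meta.app x (Function.update R v T)) K) := by
    intro R v T hT
    induction hT with
    | refl => rw [Function.update_eq_self]
    | tail _ hr ih =>
      refine ih.tail ?_
      have := Meta.Red.case_arg (s := s) x (Function.update R v _) K v _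
        (by rw [Function.update_self]; exact hr)
      rwa [Function.update_idem] at this
  have := finite_place σ.args
  have := Fintype.ofFinite (Place σ.args)
  have key : ∀ A : Finset (Place σ.args), Relation.ReflTransGen Meta.Red
      (Meta.case (Meta.app x Q) K : Meta s Γ)
      (Meta.case (Meta.app x fun v => if v ∈ A then Q' v else Q v) K) := by
    intro A
    induction A using Finset.induction_on with
    | empty => simp only [Finset.notMem_empty, if_false]; exact .refl
    | insert v A hv ih =>
      refine ih.trans ?_
      have := one (fun v => if v ∈ A then Q' v else Q v) v (Q' v) (by simpa only [hv, if_false] using h v)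
      convert this using 3
      funext w
      by_cases hw : w = v
      · subst hw; simp
      · simp [hw]
  simpa using key Finset.univ

/-- There are infinitely many branches, and a finite reduction can treat only those below a bound
`N`. This suffices for a finite term, whose remaining branches are `⊥`. -/
theorem reds_branches {σ : Ty} (x : Var Γ σ) (Q : ∀ v : Place σ.args, MProc Γ v.1)
    {K K' : ℕ → Meta .exp Γ} (N : ℕ) (h : ∀ i, Relation.ReflTransGen Meta.Red (K i) (K' i)) :
    Relation.ReflTransGen Meta.Red (Meta.case (Meta.app x Q) K : Meta s Γ)
      (Meta.case (Meta.app x Q) fun i => if i < N then K' i else K i) := by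
  classical
  have one : ∀ (R : ℕ → Meta .exp Γ) (v : ℕ) (T : Meta .exp Γ),
      Relation.ReflTransGen Meta.Red (R v) T →
      Relation.ReflTransGen Meta.Red (Meta.case (Meta.app x Q) R : Meta s Γ)
        (Meta.case (Meta.app x Q) (Function.update R v T)) := by
    intro R v T hT
    induction hT with
    | refl => rw [Function.update_eq_self]
    | tail _ hr ih =>
      refine ih.tail ?_
      have := Meta.Red.branch (s := s) x Q (Function.update R v _) v _
        (by rw [Function.update_self]; exact hr)
      rw [Function.update_idem] at this
      convert this
  induction N with
  | zero => simp only [Nat.not_lt_zero, if_false]; exact .refl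
  | succ N ih =>
    refine ih.trans ?_
    have := one (fun i => if i < N then K' i else K i) N (K' N) (by simpa using h N)
    convert this using 3 with w
    by_cases hw : w = N
    · subst hw; simp
    · have : w < N + 1 ↔ w < N := by omega
      simp [hw, this]

/-- Induction on the finite term: head reduction exposes the root of the normal form, and the
arguments and the finitely many relevant branches are then reduced by the induction hypotheses. -/
theorem mem_finiteApprox {t : Exp Γ} (ht : t.Finite) {T : Meta .exp Γ} (h : t ≤ ev ⟨T, []⟩) :
    ∃ T', Relation.ReflTransGen Meta.Red T T' ∧ Meta.ofTerm t ≤ T' := by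
  have heads : ∀ {Γ : Ctx} {T T' : Meta .exp Γ}, Relation.ReflTransGen Meta.Head T T' →
      Relation.ReflTransGen Meta.Red T T' :=
    fun h => Relation.ReflTransGen.mono (fun _ _ h => .head h) _ _ h
  induction ht with
  | bot Γ => exact ⟨T, .refl, by rw [Meta.ofTerm_bot]; exact Tree.bot_le _⟩
  | num n =>
    rw [Exp.num_le_iff] at h
    by_cases hd : Div ⟨T, []⟩
    · rw [ev_of_div hd] at h
      exact absurd h.symm (Exp.num_ne_bot n)
    simp only [Cfg.Div, not_forall, not_not] at hd
    obtain ⟨m, h', hm⟩ := hd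
    obtain ⟨F, hF, hr⟩ := (heads_of_haltsIn m).1 T hm
    rw [ev_of_halts hm] at h
    refine ⟨F, heads hr, ?_⟩
    cases hF with
    | num k => cases Exp.num_injective h; rw [Meta.ofTerm_num]
    | app => exact absurd h.symm Exp.num_ne_case
  | @case Γ σ x q e N hq he hN ihq ihe =>
    obtain ⟨q', e', h, hq', he'⟩ := Exp.case_le_iff.1 h
    by_cases hd : Div ⟨T, []⟩
    · rw [ev_of_div hd] at h
      exact (Exp.case_ne_bot _ _ _ h.symm).elim
    simp only [Cfg.Div, not_forall, not_not] at hd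
    obtain ⟨m, h', hm⟩ := hd
    obtain ⟨F, hF, hr⟩ := (heads_of_haltsIn m).1 T hm
    rw [ev_of_halts hm] at h
    cases hF with
    | num => exact absurd h Exp.num_ne_case
    | app y Q hK =>
      cases Exp.case_inj_ty h
      obtain ⟨rfl, rfl, rfl⟩ := Exp.case_inj h
      have hQ := fun v : Place σ.args => ihq v.1 v.2 (T := Q v) (hq' v.1 v.2)
      have hE := fun i : ℕ => ihe i (T := _) (by
        have := he' i
        beta_reduce at this
        rw [← (hK.csim i).ev_eq, ev_of_step (step_num_cons ..)] at this
        exact this)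
      choose Q' hQr hQ' using hQ
      choose K' hKr hK' using hE
      refine ⟨_, (heads hr).trans ((reds_args y _ hQr).trans (reds_branches y Q' N hKr)), ?_⟩
      rw [Meta.ofTerm_case, Meta.case_le_iff]
      refine ⟨_, _, rfl, Meta.app_le_iff.2 ⟨_, rfl, hQ'⟩, fun i => ?_⟩
      by_cases hi : i < N
      · simpa only [hi, if_true] using hK' i
      · rw [hN i (by omega), Meta.ofTerm_bot]
        exact Tree.bot_le _

/-- Reduction leaves `ev` unchanged, so it is an upper bound of the finite approximations; its own
finite parts all occur among them, so it is the least one. -/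
theorem eval_eq_ev (T : Meta .exp Γ) : Meta.eval T = ev ⟨T, []⟩ := by
  refine Tree.sup_eq
    ⟨?_, fun u hu => Exp.le_of_finite fun t ht hle => hu ⟨ht, mem_finiteApprox ht hle⟩⟩
  rintro t ⟨-, T', hT, hle⟩
  rw [ev_reds hT]
  exact le_ev_of_ofTerm_le hle

end

end NSP

/-! ### Evaluated substitution, leaf replacement and application -/

namespace NSP

noncomputable section

open Cfg

variable {Γ Δ Θ : Ctx}

/-! ### Substitution of procedures in procedures -/

/-- Assignments of procedures to variables. -/
abbrev SSub (Γ Δ : Ctx) : Type := ∀ ρ, Var Γ ρ → Proc Δ ρ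

namespace SSub

/-- An assignment as a substitution in meta-terms. -/
def toSub (θ : SSub Γ Δ) : Sub Γ Δ := fun ρ v => .inr (Meta.ofTerm (θ ρ v).body)

/-- An assignment below a binder. -/
def lift (θ : SSub Γ Δ) (σs : List Ty) : SSub (ext Γ σs) (ext Δ σs) := fun ρ v =>
  match Var.split σs v with
  | .inl w => (θ ρ w).wk σs
  | .inr w => eta ρ _ (Var.new Δ w)

/-- The assignment of `q` to new variables. -/
def single (σs : List Ty) (q : ∀ ρ, Var σs ρ → Proc Γ ρ) : SSub (ext Γ σs) Γ := fun ρ v =>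
  match Var.split σs v with
  | .inl w => eta ρ Γ w
  | .inr w => q ρ w

@[simp] theorem lift_wk (θ : SSub Γ Δ) {σs : List Ty} {ρ : Ty} (v : Var Γ ρ) :
    θ.lift σs ρ (Var.wk σs v) = (θ ρ v).wk σs := by simp [lift]

@[simp] theorem lift_new (θ : SSub Γ Δ) {σs : List Ty} {ρ : Ty} (v : Var σs ρ) :
    θ.lift σs ρ (Var.new Γ v) = eta ρ _ (Var.new Δ v) := by simp [lift]

@[simp] theorem single_wk {σs : List Ty} (q : ∀ ρ, Var σs ρ → Proc Γ ρ) {ρ : Ty} (v : Var Γ ρ) :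
    single σs q ρ (Var.wk σs v) = eta ρ Γ v := by simp [single]

@[simp] theorem single_new {σs : List Ty} (q : ∀ ρ, Var σs ρ → Proc Γ ρ) {ρ : Ty}
    (v : Var σs ρ) : single σs q ρ (Var.new Γ v) = q ρ v := by simp [single]

theorem ext' {σs : List Ty} {θ θ' : SSub (ext Γ σs) Δ}
    (h : ∀ ρ (v : Var Γ ρ), θ ρ (Var.wk σs v) = θ' ρ (Var.wk σs v))
    (h' : ∀ ρ (v : Var σs ρ), θ ρ (Var.new Γ v) = θ' ρ (Var.new Γ v)) : θ = θ' := by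
  funext ρ v
  rcases Var.wk_or_new σs v with ⟨w, rfl⟩ | ⟨w, rfl⟩
  exacts [h _ _, h' _ _]

end SSub

/-- Substitution of procedures in an expression, followed by evaluation. -/
def Exp.inst (θ : SSub Γ Δ) (e : Exp Γ) : Exp Δ := ev ⟨(Meta.ofTerm e).subst θ.toSub, []⟩

/-- Substitution of procedures in a procedure, followed by evaluation. -/
def Proc.inst (θ : SSub Γ Δ) {σ : Ty} (p : Proc Γ σ) : Proc Δ σ :=
  Proc.mk σ (p.body.inst (θ.lift σ.args))

/-- Composition of assignments. -/
def SSub.comp (θ : SSub Γ Δ) (θ' : SSub Δ Θ) : SSub Γ Θ := fun ρ v => (θ ρ v).inst θ'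

/-- An `SSub` assigns a procedure to every variable, so a bound variable that `Sub.lift` keeps is
assigned its η-expansion. Similarity is insensitive to the difference. -/
theorem SubRel.toSub_lift {θ : Sub Γ Δ} {θ' : SSub Γ Δ} (h : SubRel PSim θ θ'.toSub)
    (σs : List Ty) : SubRel PSim (θ.lift σs) (θ'.lift σs).toSub := by
  intro ρ x
  rcases Var.wk_or_new σs x with ⟨w, rfl⟩ | ⟨w, rfl⟩
  · have := (h ρ w).rename PSim.renClosed (Ren.wk Δ σs)
    rw [Sub.lift_wk, SSub.toSub, SSub.lift_wk]
    rw [SSub.toSub, Sub.renVal, ← Meta.ofTerm_rename] at this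
    exact this
  · rw [Sub.lift_new, SSub.toSub, SSub.lift_new]
    exact .eta _

theorem SubRel.ev_eq {s : Srt} {θ θ' : Sub Γ Δ} (h : SubRel PSim θ θ') (T : Meta s Γ) :
    ev ⟨T.subst θ, []⟩ = ev ⟨T.subst θ', []⟩ :=
  ((CSim.refl ⟨T, []⟩).subst h).ev_eq

theorem PSim.of_ev_eq {ρ : Ty} {P P' : MProc Γ ρ} (h : ev ⟨P, []⟩ = ev ⟨P', []⟩) :
    PSim Γ ρ P (Meta.ofTerm (ev ⟨P', []⟩)) := by
  rw [← h]
  exact CSim.ofTerm_ev _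

theorem Exp.inst_eq (θ : SSub Γ Δ) {T : Meta .exp Γ} (e : Exp Γ) (h : CSim ⟨T, []⟩ ⟨Meta.ofTerm e, []⟩)
    {θ' : Sub Γ Δ} (hθ : SubRel PSim θ' θ.toSub) : e.inst θ = ev ⟨T.subst θ', []⟩ :=
  ((h.subst hθ).ev_eq).symm

/-- Evaluation between the two substitutions can be omitted, because a meta-term is similar to its
normal form and similarity survives the second substitution. -/
theorem Exp.inst_inst (θ : SSub Γ Δ) (θ' : SSub Δ Θ) (e : Exp Γ) :
    (e.inst θ).inst θ' = e.inst (θ.comp θ') := by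
  rw [Exp.inst_eq θ' (e.inst θ) (CSim.ofTerm_ev _) (SubRel.rfl' _), Meta.subst_subst]
  refine SubRel.ev_eq (fun ρ v => ?_) _
  exact .proc (PSim.of_ev_eq (((SubRel.rfl' θ'.toSub).toSub_lift ρ.args).ev_eq _))

theorem eta_rename {Γ Δ : Ctx} {σ : Ty} (x : Var Γ σ) (r : Ren Γ Δ) :
    (eta σ Γ x).rename r = eta σ Δ (r σ x) := by
  rw [eta, eta]
  refine (Exp.rename_case _ _ _ _).trans ?_
  rw [Ren.lift_wk]
  refine congrArg₂ _ ?_ (funext fun i => Exp.rename_num _ i)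
  funext ρ v
  have := Var.sizeOf_lt v
  have h := eta_rename (Var.new Γ v) (r.lift σ.args)
  rw [Ren.lift_new] at h
  exact h
termination_by sizeOf σ

@[simp] theorem eta_wk {σ : Ty} (x : Var Γ σ) (σs : List Ty) :
    (eta σ Γ x).wk σs = eta σ _ (Var.wk σs x) := eta_rename x _

/-- Renamings as assignments. -/
def SSub.ofRen (r : Ren Γ Δ) : SSub Γ Δ := fun ρ v => eta ρ Δ (r ρ v)

theorem SSub.lift_ofRen (r : Ren Γ Δ) (σs : List Ty) :
    (SSub.ofRen r).lift σs = SSub.ofRen (r.lift σs) :=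
  SSub.ext' (by simp [SSub.ofRen]) (by simp [SSub.ofRen])

theorem SSub.ofRen_rel (r : Ren Γ Δ) : SubRel PSim (Sub.ofRen r) (SSub.ofRen r).toSub :=
  fun _ _ => .eta _

theorem Exp.inst_ofRen (r : Ren Γ Δ) (e : Exp Γ) : e.inst (SSub.ofRen r) = e.rename r := by
  rw [Exp.inst_eq _ e (.refl _) (SSub.ofRen_rel r), Meta.subst_ofRen, ← Meta.ofTerm_rename,
    ev_ofTerm]

theorem Proc.inst_ofRen (r : Ren Γ Δ) {σ : Ty} (p : Proc Γ σ) :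
    p.inst (SSub.ofRen r) = p.rename r := by
  rw [Proc.inst, SSub.lift_ofRen, Exp.inst_ofRen]
  rfl

theorem Exp.inst_eta (e : Exp Γ) : e.inst (fun ρ v => eta ρ Γ v) = e := by
  rw [Exp.inst_eq (θ' := fun _ v => .inl v) _ e (.refl _) fun _ _ => .eta _, Meta.subst_id,
    ev_ofTerm]

theorem SSub.lift_eta (σs : List Ty) :
    SSub.lift (fun ρ v => eta ρ Γ v) σs = fun ρ v => eta ρ _ v :=
  SSub.ext' (by simp) (by simp)

@[simp] theorem Proc.inst_eta {σ : Ty} (p : Proc Γ σ) : p.inst (fun ρ v => eta ρ Γ v) = p := by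
  rw [Proc.inst, SSub.lift_eta, Exp.inst_eta]
  rfl

-- The residue of `etaM_subst_reach`, η-expanded bound variables and an identity frame, does not
-- change the value. With `Exp.inst_eta` this makes η-expansion a two-sided unit.
@[simp] theorem inst_of_eta {σ : Ty} (x : Var Γ σ) (θ : SSub Γ Δ) :
    (eta σ Γ x).inst θ = θ σ x := by
  change ev ⟨(etaM x).subst _, []⟩ = _
  rw [← (((SubRel.rfl' θ.toSub).toSub_lift σ.args).ev_eq (etaM x)),
    ev_reach (etaM_subst_reach (θ := θ.toSub) rfl [])]
  have h : CSim ⟨Meta.ofTerm (θ σ x).body, []⟩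
      ⟨(Meta.ofTerm (θ σ x).body).subst (Sub.etaNew Δ σ.args), []⟩ := by
    have := (CSim.refl ⟨Meta.ofTerm (θ σ x).body, []⟩).subst (θ := fun _ v => .inl v)
      (θ' := Sub.etaNew Δ σ.args) fun ρ v => by
        rcases Var.wk_or_new σ.args v with ⟨w, rfl⟩ | ⟨w, rfl⟩
        · rw [Sub.etaNew_wk]; exact .var _
        · rw [Sub.etaNew_new]; exact .eta _
    simpa only [Cfg.subst, Meta.subst_id, List.map] using this
  refine (h.append CSim.num_frame).ev_eq.symm.trans (ev_ofTerm _)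

theorem Proc.wk_inst_of {σs : List Ty} {θ : SSub (ext Γ σs) Δ} {θ' : SSub Γ Δ}
    (h : ∀ ρ v, θ ρ (Var.wk σs v) = θ' ρ v) : (SSub.ofRen (Ren.wk Γ σs)).comp θ = θ' := by
  funext ρ v
  rw [SSub.comp, SSub.ofRen, inst_of_eta]
  exact h ρ v

theorem Exp.wk_eq (σs : List Ty) (e : Exp Γ) : e.wk σs = e.inst (SSub.ofRen (Ren.wk Γ σs)) :=
  (Exp.inst_ofRen _ e).symm

theorem Proc.wk_eq (σs : List Ty) {σ : Ty} (p : Proc Γ σ) :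
    p.wk σs = p.inst (SSub.ofRen (Ren.wk Γ σs)) :=
  (Proc.inst_ofRen _ p).symm

theorem Exp.wk_inst {σs : List Ty} {θ : SSub (ext Γ σs) Δ} {θ' : SSub Γ Δ}
    (h : ∀ ρ v, θ ρ (Var.wk σs v) = θ' ρ v) (e : Exp Γ) : (e.wk σs).inst θ = e.inst θ' := by
  rw [Exp.wk_eq, Exp.inst_inst, Proc.wk_inst_of h]

theorem Exp.rename_rename (r : Ren Γ Δ) (r' : Ren Δ Θ) (e : Exp Γ) :
    (e.rename r).rename r' = e.rename fun ρ v => r' ρ (r ρ v) := by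
  rw [← ev_ofTerm ((e.rename r).rename r'), Meta.ofTerm_rename, Meta.ofTerm_rename,
    Meta.rename_rename, ← Meta.ofTerm_rename, ev_ofTerm]

theorem Proc.rename_rename (r : Ren Γ Δ) (r' : Ren Δ Θ) {σ : Ty} (p : Proc Γ σ) :
    (p.rename r).rename r' = p.rename fun ρ v => r' ρ (r ρ v) := by
  refine (Exp.rename_rename _ _ _).trans ?_
  rw [Ren.lift_lift]
  rfl

theorem SSub.lift_comp (θ : SSub Γ Δ) (θ' : SSub Δ Θ) (σs : List Ty) :
    (θ.lift σs).comp (θ'.lift σs) = (θ.comp θ').lift σs := by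
  refine SSub.ext' (fun ρ v => ?_) fun ρ v => ?_
  · rw [SSub.lift_wk, SSub.comp, SSub.lift_wk, SSub.comp]
    change Exp.inst _ (Exp.rename _ _) = Exp.rename _ (Exp.inst _ _)
    rw [← Exp.inst_ofRen, ← Exp.inst_ofRen, Exp.inst_inst, Exp.inst_inst]
    congr 1
    refine SSub.ext' (fun τ w => ?_) fun τ w => ?_
    · rw [SSub.comp, SSub.comp, SSub.ofRen, inst_of_eta, Ren.lift_wk, SSub.lift_wk, SSub.lift_wk,
        Proc.inst_ofRen]
      rw [SSub.lift_wk, Proc.wk, Proc.wk, Proc.wk, Proc.rename_rename, Proc.rename_rename]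
      simp only [Ren.lift_wk]
    · simp only [SSub.comp, SSub.ofRen, SSub.lift_new, Ren.lift_new, inst_of_eta]
  · simp only [SSub.lift_new, SSub.comp, inst_of_eta]

theorem Proc.inst_inst (θ : SSub Γ Δ) (θ' : SSub Δ Θ) {σ : Ty} (p : Proc Γ σ) :
    (p.inst θ).inst θ' = p.inst (θ.comp θ') := by
  rw [Proc.inst, Proc.inst, Proc.inst, ← SSub.lift_comp, ← Exp.inst_inst]
  rfl

theorem Proc.wk_inst {σs : List Ty} {θ : SSub (ext Γ σs) Δ} {θ' : SSub Γ Δ}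
    (h : ∀ ρ v, θ ρ (Var.wk σs v) = θ' ρ v) {σ : Ty} (p : Proc Γ σ) :
    (p.wk σs).inst θ = p.inst θ' := by
  rw [Proc.wk_eq, Proc.inst_inst, Proc.wk_inst_of h]

theorem Proc.wk_inst_single {σs : List Ty} (q : ∀ ρ, Var σs ρ → Proc Γ ρ) {σ : Ty} (p : Proc Γ σ) :
    (p.wk σs).inst (SSub.single σs q) = p :=
  (Proc.wk_inst (fun _ _ => SSub.single_wk _ _) p).trans p.inst_eta

theorem Exp.wk_inst_lift (θ : SSub Γ Δ) (σs : List Ty) (e : Exp Γ) :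
    (e.wk σs).inst (θ.lift σs) = (e.inst θ).wk σs := by
  rw [Exp.wk_inst (θ' := θ.comp (SSub.ofRen (Ren.wk Δ σs))), Exp.wk_eq, Exp.inst_inst]
  intro ρ v
  rw [SSub.lift_wk, Proc.wk_eq]
  rfl

theorem Proc.wk_inst_lift (θ : SSub Γ Δ) (σs : List Ty) {σ : Ty} (p : Proc Γ σ) :
    (p.wk σs).inst (θ.lift σs) = (p.inst θ).wk σs := by
  rw [Proc.wk_inst (θ' := θ.comp (SSub.ofRen (Ren.wk Δ σs))), Proc.wk_eq, Proc.inst_inst]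
  intro ρ v
  rw [SSub.lift_wk, Proc.wk_eq]
  rfl

/-! ### Leaf replacement -/

/-- A rightward leaf of the normal form is a numeral reached with an exhausted stack, and this is
where the added frames begin to act. Leaf replacement is thus evaluation with more pending branches.
-/
theorem ev_append (c : Cfg Γ) {L : List (ℕ → Meta .exp Γ)} {e : ℕ → Exp Γ}
    (h : ∀ i, ev (numCfg i L) = e i) : ev (c.append L) = (ev c).replaceLeaves e := by
  refine Exp.bisim (fun Γ t u => t = u ∨ ∃ (c : Cfg Γ) (L : _) (e : ℕ → Exp Γ),
    (∀ i, ev (numCfg i L) = e i) ∧ t = ev (c.append L) ∧ u = (ev c).replaceLeaves e) ?_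
    (.inr ⟨c, L, e, h, rfl, rfl⟩)
  have node : ∀ {R : ∀ Γ, Exp Γ → Exp Γ → Prop} (_ : ∀ Γ t, R Γ t t) {Γ : Ctx} (t : Exp Γ),
      Exp.Node R t t := by
    intro R hR Γ t
    cases t.view with
    | bot => exact .bot
    | num n => exact .num n
    | case x q e => exact .case x (fun _ _ => hR _ _) fun _ => hR _ _
  rintro Γ t u (rfl | ⟨c, L, e, h, rfl, rfl⟩)
  · exact node (fun _ _ => .inl rfl) t
  rcases ev_cases c with ⟨hc, he⟩ | ⟨d, hd, hc, hf, he⟩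
  · rw [he, ev_of_div (hc.append L), Exp.replaceLeaves_bot]
    exact .bot
  rw [he, ev_reach (hc.append L)]
  cases hf with
  | num n =>
    have : ∀ s, ev ⟨(Meta.num n : Meta s Γ), L⟩ = ev (numCfg n L) := fun s =>
      CSim.ev_eq (CSim.fold (CStep.num_sort (s := .exp) (CSim.refl (numCfg n L)).unfold))
    rw [append, List.nil_append, this, evHd, Exp.replaceLeaves_num, h]
    exact node (fun _ _ => .inl rfl) _
  | app x Q S =>
    rw [evHd, Exp.replaceLeaves_case, append, ev_of_halts (n := 0) (step_app ..)]
    exact .case x (fun _ _ => .inl rfl) fun i => .inr ⟨numCfg i S, L, e, h, rfl, rfl⟩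

theorem ev_frame {s : Srt} (T : Meta s Γ) (E : ℕ → Meta .exp Γ) :
    ev ⟨T, [E]⟩ = (ev ⟨T, []⟩).replaceLeaves fun i => ev ⟨E i, []⟩ :=
  ev_append ⟨T, []⟩ fun _ => ev_of_step (step_num_cons ..)

theorem ev_ofTerm_frame (t : Exp Γ) (e : ℕ → Exp Γ) :
    ev ⟨Meta.ofTerm t, [fun i => Meta.ofTerm (e i)]⟩ = t.replaceLeaves e := by
  simp only [ev_frame, ev_ofTerm]

/-- With leaf replacement read as a frame on the stack, this is compatibility of similarity with
substitution in a configuration. -/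
theorem Exp.replaceLeaves_inst (θ : SSub Γ Δ) (t : Exp Γ) (e : ℕ → Exp Γ) :
    (t.replaceLeaves e).inst θ = (t.inst θ).replaceLeaves fun i => (e i).inst θ := by
  rw [← ev_ofTerm_frame]
  exact ((CSim.ofTerm_ev ⟨Meta.ofTerm t, [fun i => Meta.ofTerm (e i)]⟩).subst
    (SubRel.rfl' θ.toSub)).ev_eq.symm.trans (ev_frame _ _)

theorem Proc.replaceLeaves_inst (θ : SSub Γ Δ) {σ : Ty} (p : Proc Γ σ) (e : ℕ → Exp Γ) :
    (p.replaceLeaves e).inst θ = (p.inst θ).replaceLeaves fun i => (e i).inst θ := by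
  refine (Exp.replaceLeaves_inst _ _ _).trans ?_
  simp only [Exp.wk_inst_lift]
  rfl

theorem Exp.replaceLeaves_num_self (t : Exp Γ) : t.replaceLeaves Exp.num = t := by
  rw [← ev_ofTerm_frame]
  refine ((CSim.refl ⟨Meta.ofTerm t, []⟩).append (L := [])
    (L' := [fun i => Meta.ofTerm (Exp.num i)]) fun i => ?_).ev_eq.symm.trans (ev_ofTerm t)
  exact CSim.back (.refl _) (.of_step (step_num_cons ..)) (by rw [Meta.ofTerm_num]; exact .refl _)

theorem Exp.inst_num (θ : SSub Γ Δ) (n : ℕ) : (Exp.num n : Exp Γ).inst θ = Exp.num n := by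
  rw [Exp.inst, Meta.ofTerm_num, Meta.subst_num, ev_of_halts (n := 0) (step_num n)]
  rfl

theorem Exp.inst_bot (θ : SSub Γ Δ) : (Exp.bot Γ).inst θ = Exp.bot Δ := by
  rw [Exp.inst, Meta.ofTerm_bot, Meta.subst_bot, ev_of_div div_bot]

theorem SSub.single_rel {σs : List Ty} {Q : ∀ v : Place σs, MProc Γ v.1}
    {q : ∀ ρ, Var σs ρ → Proc Γ ρ} (h : ∀ v : Place σs, ev ⟨Q v, []⟩ = (q v.1 v.2).body) :
    SubRel PSim (Sub.single σs Q) (SSub.single σs q).toSub := by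
  intro ρ x
  rcases Var.wk_or_new σs x with ⟨w, rfl⟩ | ⟨w, rfl⟩
  · rw [Sub.single_wk, SSub.toSub, SSub.single_wk]
    exact .eta _
  · rw [Sub.single_new, SSub.toSub, SSub.single_new, ← h ⟨ρ, w⟩]
    exact .proc (CSim.ofTerm_ev _)

theorem ev_subst_lift (θ : SSub Γ Δ) {σs : List Ty} (e : Exp (ext Γ σs)) :
    ev ⟨(Meta.ofTerm e).subst (θ.toSub.lift σs), []⟩ = e.inst (θ.lift σs) :=
  ((SubRel.rfl' θ.toSub).toSub_lift σs).ev_eq _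

/-- The equation of hereditary substitution: the value of the head variable receives the
instantiated arguments, and the branches act on the leaves of the result. -/
theorem Exp.inst_case (θ : SSub Γ Δ) {σ : Ty} (x : Var Γ σ) (q : ∀ ρ, Var σ.args ρ → Proc Γ ρ)
    (e : ℕ → Exp Γ) : (Exp.case x q e).inst θ =
      ((θ σ x).body.inst (SSub.single σ.args fun ρ v => (q ρ v).inst θ)).replaceLeaves
        fun i => (e i).inst θ := by
  rw [Exp.inst, Meta.ofTerm_case, Meta.subst_case, Meta.subst_app_inr θ.toSub rfl,
    ev_of_step (step_case ..), ev_of_step (step_beta ..), ev_frame,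
    Exp.inst_eq _ (θ σ x).body (.refl _) (SSub.single_rel fun v => ev_subst_lift θ _)]
  rfl

/-! ### Abstraction and application -/

theorem SSub.lift_cons (θ : SSub Γ Δ) (σ : Ty) (σs : List Ty) :
    θ.lift (σ :: σs) = (θ.lift [σ]).lift σs := by
  refine SSub.ext' (fun ρ v => ?_) fun ρ v => ?_
  · rw [SSub.lift_wk]
    change _ = (θ.lift [σ]).lift σs ρ (Var.wk σs (Var.wk [σ] v))
    rw [SSub.lift_wk, SSub.lift_wk, Proc.wk, Proc.wk, Proc.wk, Proc.rename_rename]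
    rfl
  · rw [SSub.lift_new]
    cases v with
    | here =>
      change _ = (θ.lift [σ]).lift σs _ (Var.wk σs (Var.new Γ Var.here))
      rw [SSub.lift_wk, SSub.lift_new, eta_wk]
      rfl
    | there v =>
      change _ = (θ.lift [σ]).lift σs _ (Var.new (σ :: Γ) v)
      rw [SSub.lift_new]
      rfl

theorem Proc.inst_lam (θ : SSub Γ Δ) {σ τ : Ty} (p : Proc (σ :: Γ) τ) :
    p.lam.inst θ = Proc.lam (p.inst (θ.lift [σ])) := by
  change Exp.inst (θ.lift (σ :: τ.args)) _ = Exp.inst _ _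
  rw [SSub.lift_cons]
  rfl

/-- The family of procedures over a one-element list of types. -/
def oneArg {σ : Ty} (q : Proc Γ σ) : ∀ ρ, Var [σ] ρ → Proc Γ ρ
  | _, .here => q

/-- From here on application is an instance of `inst`, and reduction is no longer mentioned. -/
theorem Proc.apply_eq {σ τ : Ty} (p : Proc Γ (.arrow σ τ)) (q : Proc Γ σ) :
    p.apply q = p.unlam.inst (SSub.single [σ] (oneArg q)) := by
  rw [Proc.apply, eval_eq_ev]
  refine SubRel.ev_eq (SubRel.toSub_lift (SSub.single_rel ?_) _) _
  rintro ⟨_, _ | ⟨⟨⟩⟩⟩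
  exact ev_ofTerm _

/-- Application of a procedure to all of its arguments. -/
def Proc.apps {σ : Ty} (p : Proc Γ σ) (q : ∀ ρ, Var σ.args ρ → Proc Γ ρ) : Proc Γ .nat :=
  Proc.const (p.body.inst (SSub.single σ.args q))

/-- Supplying the first argument and then the others is a composite of two assignments, which agrees
with the simultaneous one on each variable. -/
theorem Proc.apps_apply {σ τ : Ty} (p : Proc Γ (.arrow σ τ))
    (q : ∀ ρ, Var (Ty.arrow σ τ).args ρ → Proc Γ ρ) :
    (p.apply (q _ .here)).apps (fun ρ v => q ρ (.there v)) = p.apps q := by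
  rw [Proc.apply_eq, Proc.apps, Proc.inst]
  change Exp.inst _ (Exp.inst _ _) = Exp.inst _ _
  rw [Exp.inst_inst]
  congr 1
  refine SSub.ext' (σs := τ.args) (fun ρ v => ?_) fun ρ v => ?_
  · rw [SSub.comp, SSub.lift_wk, Proc.wk_inst_single]
    cases v with
    | here =>
      have h₁ := SSub.single_new (Γ := Γ) (σs := [σ]) (oneArg (q σ .here)) .here
      exact h₁.trans (SSub.single_new (σs := σ :: τ.args) q .here).symm
    | there v =>
      have h₁ := SSub.single_wk (Γ := Γ) (σs := [σ]) (oneArg (q σ .here)) v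
      exact h₁.trans (SSub.single_wk (σs := σ :: τ.args) q v).symm
  · rw [SSub.comp, SSub.lift_new, inst_of_eta, SSub.single_new]
    exact (SSub.single_new (σs := σ :: τ.args) q (.there v)).symm

theorem Proc.apps_inst (θ : SSub Γ Δ) {σ : Ty} (p : Proc Γ σ)
    (q : ∀ ρ, Var σ.args ρ → Proc Γ ρ) :
    (p.apps q).body.inst θ = ((p.inst θ).apps fun ρ v => (q ρ v).inst θ).body := by
  change Exp.inst _ (Exp.inst _ _) = Exp.inst _ (Exp.inst _ _)
  rw [Exp.inst_inst, Exp.inst_inst]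
  congr 1
  refine SSub.ext' (fun ρ v => ?_) fun ρ v => ?_
  · rw [SSub.comp, SSub.comp, SSub.single_wk, SSub.lift_wk, inst_of_eta, Proc.wk_inst_single]
  · rw [SSub.comp, SSub.comp, SSub.single_new, SSub.lift_new, inst_of_eta, SSub.single_new]

end

end NSP

/-! ### Recursion operators and plugging as solutions of one fixed point equation -/

namespace NSP

noncomputable section

open Cfg

/-! ### The recursion operators -/

section Fix

variable {Γ Δ : Ctx}

theorem y_done {σ : Ty} (t : Exp Γ) : Tree.corec (S := expSig) (yStep σ) (.done t) = t := by
  refine Tree.bisim (S := expSig) (fun Γ t u => t = Tree.corec (S := expSig) (yStep σ) (.done u)) ?_ rfl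
  rintro Γ _ u rfl
  exact ⟨u.dest.1, _, u.dest.2, Tree.dest_corec .., rfl, fun _ => rfl⟩

/-- Families of procedures over a non-empty list of types. -/
def consArg {σ : Ty} {σs : List Ty} (p : Proc Γ σ) (q : ∀ ρ, Var σs ρ → Proc Γ ρ) :
    ∀ ρ, Var (σ :: σs) ρ → Proc Γ ρ
  | _, .here => p
  | ρ, .there v => q ρ v

theorem procF_eq (σ : Ty) (g : Var Γ (.arrow σ σ)) : procF σ g =
    Proc.mk σ (Exp.case (Var.wk σ.args g)
      (consArg (procF σ (Var.wk σ.args g)) fun ρ v => eta ρ _ (Var.new Γ v)) Exp.num) := by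
  refine (Tree.corec_eq (S := expSig) (yStep σ) _).trans ?_
  refine (Exp.mk_case _ _).trans ?_
  refine congrArg₂ _ ?_ ?_
  · funext ρ v
    cases v with
    | here => rfl
    | there v => exact y_done _
  · funext i
    exact y_done _

/-- The application of the recursion operator to a procedure. -/
def Proc.fix {σ : Ty} (p : Proc Γ (.arrow σ σ)) : Proc Γ σ := (procY Γ σ).apply p

theorem Proc.fix_eq {σ : Ty} (p : Proc Γ (.arrow σ σ)) :
    p.fix = (procF σ .here).inst (SSub.single [.arrow σ σ] (oneArg p)) := Proc.apply_eq _ _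

/-- An instance of `F_σ[g]` as a meta-procedure. -/
def fixM (σ : Ty) (g : Var Γ (.arrow σ σ)) (θ : Sub Γ Δ) : MProc Δ σ :=
  (Meta.ofTerm (procF σ g).body).subst (θ.lift σ.args)

/-- The family of arguments in the unfolding of `fixM`. -/
def fixArgs (σ : Ty) (g : Var Γ (.arrow σ σ)) (θ : Sub Γ Δ) :
    ∀ v : Place (σ :: σ.args), MProc (ext Δ σ.args) v.1
  | ⟨_, .here⟩ => fixM σ (Var.wk σ.args g) (θ.lift σ.args)
  | ⟨_, .there v⟩ => etaM (Var.new Δ v)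

/-- One unfolding of `F_σ`: its value is `P` applied to `F_σ` again and to the η-expanded arguments,
under an identity frame. -/
theorem fixM_reach {σ : Ty} {g : Var Γ (.arrow σ σ)} {θ : Sub Γ Δ} {P : MProc Δ (.arrow σ σ)}
    (h : θ _ g = .inr P) (L : List (ℕ → Meta .exp (ext Δ σ.args))) :
    Reach ⟨fixM σ g θ, L⟩
      ⟨(P.rename ((Ren.wk Δ σ.args).lift (σ :: σ.args))).subst
        (Sub.single (σ :: σ.args) (fixArgs σ g θ)), Meta.num :: L⟩ := by
  rw [fixM, procF_eq]
  change Reach ⟨Meta.subst _ (Meta.ofTerm (Exp.case _ _ _)), L⟩ _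
  rw [Meta.ofTerm_case, Meta.subst_case, Meta.subst_app_inr (θ.lift σ.args)
    (P := P.rename ((Ren.wk Δ σ.args).lift (σ :: σ.args))) (by rw [Sub.lift_wk, h]; rfl)]
  simp only [Meta.ofTerm_num, Meta.subst_num]
  refine Reach.head (step_case _ _) (Reach.of_step ?_)
  rw [step_beta]
  congr 4
  funext v
  obtain ⟨ρ, _ | v⟩ := v
  · rfl
  · exact etaM_subst (Sub.lift_new θ v)

/-- A solution of the fixed point equation of a procedure is similar to the value of the recursion
operator. -/
theorem fixM_csim {σ : Ty} {E : MProc Γ (.arrow σ σ)} {A : MProc Γ σ}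
    (hA : A = Meta.subst ((Sub.single [σ] fun | ⟨_, .here⟩ => A).lift σ.args) E)
    {g : Var Δ (.arrow σ σ)} {θ : Sub Δ Γ} (hg : θ _ g = .inr E) :
    CSim ⟨A, []⟩ ⟨fixM σ g θ, []⟩ := by
  -- The relation pairs renamings of `A` with instances of `F_σ` at a correspondingly renamed `E`;
  -- the renaming is carried along because both move below binders.
  let B : PRel := fun Δ ρ P P' => ∃ (h : ρ = σ) (Γ' : Ctx) (g : Var Γ' (.arrow σ σ))
    (θ : Sub Γ' Δ) (r : Ren Γ Δ), θ _ g = .inr (E.rename (r.lift (σ :: σ.args))) ∧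
    h ▸ P = A.rename (r.lift σ.args) ∧ h ▸ P' = fixM σ g θ
  have hr : RenClosed B := by
    rintro Δ Δ' r ρ P P' ⟨rfl, Γ', g, θ, r', hg, rfl, rfl⟩
    refine ⟨rfl, Γ', g, fun ρ v => Sub.renVal r (θ ρ v), fun ρ v => r _ (r' _ v), ?_, ?_, ?_⟩
    · beta_reduce
      rw [hg, Sub.renVal, Meta.rename_rename]
      congr 2
      exact Ren.lift_lift _ _ _
    · rw [Meta.rename_rename, Ren.lift_lift]
    · simp only [fixM, Meta.subst_rename, Sub.ren_lift]
  have hB : ∀ Γ ρ P P', B Γ ρ P P' → SubstCand B _ ⟨P, []⟩ ⟨P', []⟩ := by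
    rintro Δ ρ _ _ ⟨rfl, Γ', g, θ, r, hg, rfl, rfl⟩
    have hP : A.rename (r.lift _) = E.subst _ :=
      (congrArg (Meta.rename (r.lift _)) hA).trans (Meta.subst_rename _ _ _)
    have hP' := fixM_reach hg []
    rw [Meta.rename_rename, Meta.rename_subst] at hP'
    -- Both sides are instances of `E`: the left by the equation for `A`, the right by one
    -- unfolding. The recursion variable receives a pair in `B`, and an argument is a variable on
    -- the left and its η-expansion on the right.
    refine ⟨_, ⟨E, []⟩, ⟨E, [Meta.num]⟩, _,
      fun τ v => Sub.single (ρ :: ρ.args) (fixArgs ρ g θ) τ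
        ((Ren.wk Δ ρ.args).lift (ρ :: ρ.args) τ (r.lift (ρ :: ρ.args) τ v)),
      (CSim.refl ⟨E, []⟩).append (L := []) (L' := [Meta.num]) CSim.num_frame, ?_,
      by rw [hP]; exact .refl _, ?_⟩
    rotate_left
    · simp only [Cfg.subst, List.map, Meta.subst_num]
      exact hP'
    intro τ x
    beta_reduce
    rcases Var.wk_or_new (Γ := Γ) (_ :: _) x with ⟨w, rfl⟩ | ⟨w, rfl⟩
    · rw [Ren.lift_wk, Ren.lift_wk, Sub.single_wk]
      change ValRel B (Sub.renVal (r.lift _) (Sub.lift _ _ τ (Var.wk _ (Var.wk [_] w)))) _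
      rw [Sub.lift_wk, Sub.single_wk, Sub.renVal, Sub.renVal, Ren.wk, Ren.lift_wk]
      exact .var _
    · rw [Ren.lift_new, Ren.lift_new, Sub.single_new]
      cases w with
      | here =>
        change ValRel B (Sub.renVal (r.lift _) (Sub.lift _ _ _ (Var.wk _ (Var.new Γ Var.here)))) _
        rw [Sub.lift_wk, Sub.single_new]
        refine .proc ⟨rfl, _, Var.wk _ g, θ.lift _, fun ρ v => Var.wk _ (r _ v), ?_, ?_, rfl⟩
        · rw [Sub.lift_wk, hg, Sub.renVal, Meta.rename_rename]
          congr 2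
          exact Ren.lift_lift _ _ _
        · change Meta.rename _ (Meta.rename _ A) = _
          rw [Meta.rename_rename, Ren.lift_lift]
          congr 2
          funext ρ v
          exact Ren.lift_wk _ _ _
      | there v =>
        change ValRel B (Sub.renVal (r.lift _) (Sub.lift _ _ _ (Var.new _ v))) _
        rw [Sub.lift_new, Sub.renVal, Ren.lift_new]
        exact .eta _
  refine SubstCand.csim hr hB (hB _ _ _ _ ⟨rfl, _, g, θ, fun _ v => v, ?_, ?_, rfl⟩)
  · rw [hg, Ren.lift_id]
    exact congrArg _ (Meta.rename_id E).symm
  · rw [Ren.lift_id, Meta.rename_id]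

end Fix

/-! ### Plugging -/

namespace Meta

variable {Γ Δ Θ : Ctx} {s : Srt}

/-- Pruning along a partial renaming. -/
def pruneAlong (r : ∀ ρ, Var Γ ρ → Option (Var Δ ρ)) (T : Meta s Γ) : Meta s Δ :=
  Tree.corec (i := (s, Δ)) pruneStep ⟨Γ, r, T⟩

variable (r : ∀ ρ, Var Γ ρ → Option (Var Δ ρ))

theorem pruneAlong_bot : pruneAlong r (Meta.bot s Γ) = Meta.bot s Δ := by
  rw [pruneAlong, Tree.corec_eq]
  simp only [pruneStep]
  rw [dest_bot]
  exact mk_bot _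

theorem pruneAlong_num (n : ℕ) : pruneAlong r (Meta.num n : Meta s Γ) = Meta.num n := by
  rw [pruneAlong, Tree.corec_eq]
  simp only [pruneStep]
  rw [dest_num]
  exact mk_num _ _

theorem pruneAlong_case (G : Meta .gnd Γ) (E : ℕ → Meta .exp Γ) :
    pruneAlong r (Meta.case G E : Meta s Γ) =
      Meta.case (pruneAlong r G) fun i => pruneAlong r (E i) := by
  rw [pruneAlong, Tree.corec_eq]
  simp only [pruneStep]
  rw [dest_case]
  exact mk_case _

theorem pruneAlong_app_some {σ : Ty} {x : Var Γ σ} {y : Var Δ σ} (h : r σ x = some y)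
    (Q : ∀ v : Place σ.args, MProc Γ v.1) : pruneAlong r (Meta.app x Q) =
      Meta.app y fun v => pruneAlong (liftPartial r v.1.args) (Q v) := by
  rw [pruneAlong, Tree.corec_eq]
  simp only [pruneStep]
  rw [dest_app]
  dsimp only
  generalize r σ x = a at h ⊢
  subst h
  exact mk_app _ _

theorem pruneAlong_app_none {σ : Ty} {x : Var Γ σ} (h : r σ x = none)
    (Q : ∀ v : Place σ.args, MProc Γ v.1) : pruneAlong r (Meta.app x Q) = Meta.bot _ _ := by
  rw [pruneAlong, Tree.corec_eq]
  simp only [pruneStep]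
  rw [dest_app]
  dsimp only
  generalize r σ x = a at h ⊢
  subst h
  exact mk_bot _

theorem pruneAlong_beta {σ : Ty} (P : MProc Γ σ) (Q : ∀ v : Place σ.args, MProc Γ v.1) :
    pruneAlong r (Meta.beta P Q) = Meta.beta (pruneAlong (liftPartial r σ.args) P)
      fun v => pruneAlong (liftPartial r v.1.args) (Q v) := by
  rw [pruneAlong, Tree.corec_eq]
  simp only [pruneStep]
  rw [dest_beta]
  exact mk_beta _

variable {Z : List Ty}

/-- Variables of `Γ` are variables of `Δ` or variables to be expanded. -/
abbrev Sorting (Z : List Ty) (Γ Δ : Ctx) : Type := ∀ ρ, Var Γ ρ → Var Δ ρ ⊕ Var Z ρ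

/-- The extension of a sorting of variables to bound variables. -/
def Sorting.lift (κ : Sorting Z Γ Δ) (σs : List Ty) : Sorting Z (ext Γ σs) (ext Δ σs) := fun ρ v =>
  match Var.split σs v with
  | .inl w => (κ ρ w).map (Var.wk σs) id
  | .inr w => .inl (Var.new Δ w)

@[simp] theorem Sorting.lift_wk (κ : Sorting Z Γ Δ) {σs : List Ty} {ρ : Ty} (v : Var Γ ρ) :
    κ.lift σs ρ (Var.wk σs v) = (κ ρ v).map (Var.wk σs) id := by simp [Sorting.lift]

@[simp] theorem Sorting.lift_new (κ : Sorting Z Γ Δ) {σs : List Ty} {ρ : Ty} (v : Var σs ρ) :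
    κ.lift σs ρ (Var.new Γ v) = .inl (Var.new Δ v) := by simp [Sorting.lift]

/-- The partial renaming that forgets the variables to be expanded. -/
def Sorting.partial (κ : Sorting Z Γ Δ) : ∀ ρ, Var Γ ρ → Option (Var Δ ρ) :=
  fun ρ v => (κ ρ v).getLeft?

theorem Sorting.partial_lift (κ : Sorting Z Γ Δ) (σs : List Ty) :
    liftPartial κ.partial σs = (κ.lift σs).partial := by
  funext ρ v
  rcases Var.wk_or_new σs v with ⟨w, rfl⟩ | ⟨w, rfl⟩
  · simp only [liftPartial, Sorting.partial, Var.split_wk, Sorting.lift_wk]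
    cases κ ρ w <;> rfl
  · simp only [liftPartial, Sorting.partial, Var.split_new, Sorting.lift_new]
    rfl

variable {B : Ctx} (ξ : ∀ ρ, Var Z ρ → Proc B ρ)

/-- States of the infinite expansion. -/
abbrev ExpandState (Z : List Ty) (B : Ctx) (i : Srt × Ctx) : Type :=
  Σ Γ : Ctx, Ren B Γ × Sorting Z Γ i.2 × Meta i.1 Γ

/-- One step of the infinite expansion of variables according to `ξ`. -/
def expandStep (i : Srt × Ctx) : ExpandState Z B i → metaSig.Obj (ExpandState Z B) i
  | ⟨Γ, j, κ, T⟩ =>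
    match Tree.dest (S := metaSig) T with
    | ⟨.bot, _⟩ => ⟨MShape.bot, fun b => nomatch b⟩
    | ⟨.num n, _⟩ => ⟨MShape.num n, fun b => nomatch b⟩
    | ⟨.case, c⟩ => ⟨MShape.case, fun
        | none => ⟨Γ, j, κ, c none⟩
        | some i => ⟨Γ, j, κ, c (some i)⟩⟩
    | ⟨.app h σ x, c⟩ =>
      match κ σ x with
      | .inl y => ⟨MShape.app h σ y, fun v =>
          ⟨ext Γ v.1.args, fun _ w => Var.wk v.1.args (j _ w), κ.lift v.1.args, c v⟩⟩
      | .inr z => ⟨MShape.beta h σ, fun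
          | none => ⟨ext Γ σ.args, fun _ w => Var.wk σ.args (j _ w), κ.lift σ.args,
              (ofTerm (ξ σ z).body).rename (j.lift σ.args)⟩
          | some v =>
            ⟨ext Γ v.1.args, fun _ w => Var.wk v.1.args (j _ w), κ.lift v.1.args, c v⟩⟩
    | ⟨.beta h σ, c⟩ => ⟨MShape.beta h σ, fun
        | none => ⟨ext Γ σ.args, fun _ w => Var.wk σ.args (j _ w), κ.lift σ.args, c none⟩
        | some v =>
          ⟨ext Γ v.1.args, fun _ w => Var.wk v.1.args (j _ w), κ.lift v.1.args, c (some v)⟩⟩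

/-- The infinite expansion of the variables in `Z` according to `ξ`. -/
def expand (j : Ren B Γ) (κ : Sorting Z Γ Δ) (T : Meta s Γ) : Meta s Δ :=
  Tree.corec (i := (s, Δ)) (expandStep ξ) ⟨Γ, j, κ, T⟩

variable (j : Ren B Γ) (κ : Sorting Z Γ Δ)

/-- The renaming into an environment with bound variables. -/
def wkAfter (j : Ren B Γ) (σs : List Ty) : Ren B (ext Γ σs) := fun _ w => Var.wk σs (j _ w)

theorem expand_bot : expand ξ j κ (Meta.bot s Γ) = Meta.bot s Δ := by
  rw [expand, Tree.corec_eq]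
  simp only [expandStep]
  rw [dest_bot]
  exact mk_bot _

theorem expand_num (n : ℕ) : expand ξ j κ (Meta.num n : Meta s Γ) = Meta.num n := by
  rw [expand, Tree.corec_eq]
  simp only [expandStep]
  rw [dest_num]
  exact mk_num _ _

theorem expand_case (G : Meta .gnd Γ) (E : ℕ → Meta .exp Γ) :
    expand ξ j κ (Meta.case G E : Meta s Γ) =
      Meta.case (expand ξ j κ G) fun i => expand ξ j κ (E i) := by
  rw [expand, Tree.corec_eq]
  simp only [expandStep]
  rw [dest_case]
  exact mk_case _

theorem expand_app_inl {σ : Ty} {x : Var Γ σ} {y : Var Δ σ} (h : κ σ x = .inl y)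
    (Q : ∀ v : Place σ.args, MProc Γ v.1) : expand ξ j κ (Meta.app x Q) =
      Meta.app y fun v => expand ξ (wkAfter j v.1.args) (κ.lift v.1.args) (Q v) := by
  rw [expand, Tree.corec_eq]
  simp only [expandStep]
  rw [dest_app]
  dsimp only
  generalize κ σ x = a at h ⊢
  subst h
  exact mk_app _ _

theorem expand_app_inr {σ : Ty} {x : Var Γ σ} {z : Var Z σ} (h : κ σ x = .inr z)
    (Q : ∀ v : Place σ.args, MProc Γ v.1) : expand ξ j κ (Meta.app x Q) =
      Meta.beta (expand ξ (wkAfter j σ.args) (κ.lift σ.args)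
          ((ofTerm (ξ σ z).body).rename (j.lift σ.args)))
        fun v => expand ξ (wkAfter j v.1.args) (κ.lift v.1.args) (Q v) := by
  rw [expand, Tree.corec_eq]
  simp only [expandStep]
  rw [dest_app]
  dsimp only
  generalize κ σ x = a at h ⊢
  subst h
  exact mk_beta _

theorem expand_beta {σ : Ty} (P : MProc Γ σ) (Q : ∀ v : Place σ.args, MProc Γ v.1) :
    expand ξ j κ (Meta.beta P Q) =
      Meta.beta (expand ξ (wkAfter j σ.args) (κ.lift σ.args) P)
        fun v => expand ξ (wkAfter j v.1.args) (κ.lift v.1.args) (Q v) := by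
  rw [expand, Tree.corec_eq]
  simp only [expandStep]
  rw [dest_beta]
  exact mk_beta _

/-! #### The infinite expansion is a substitution -/

theorem wkAfter_lift (j : Ren B Γ) (r : Ren Γ Θ) (σs : List Ty) :
    wkAfter (fun ρ v => r ρ (j ρ v)) σs = fun ρ v => r.lift σs ρ (wkAfter j σs ρ v) := by
  funext ρ v
  simp only [wkAfter, Ren.lift_wk]

theorem Sorting.lift_rename {Γ' Δ' : Ctx} {κ : Sorting Z Γ Δ} {κ' : Sorting Z Γ' Δ'}
    {s : Ren Γ Γ'} {r : Ren Δ Δ'} (h : ∀ ρ v, κ' ρ (s ρ v) = (κ ρ v).map (r ρ) id) (σs : List Ty)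
    (ρ : Ty) (v : Var (ext Γ σs) ρ) :
    κ'.lift σs ρ (s.lift σs ρ v) = (κ.lift σs ρ v).map (r.lift σs ρ) id := by
  rcases Var.wk_or_new σs v with ⟨w, rfl⟩ | ⟨w, rfl⟩
  · rw [Ren.lift_wk, Sorting.lift_wk, Sorting.lift_wk, h]
    cases κ ρ w with
    | inl y => simp only [Sum.map_inl, Ren.lift_wk]
    | inr z => rfl
  · simp only [Ren.lift_new, Sorting.lift_new, Sum.map_inl]

/-- Naturality of the expansion; it makes `expandSub` commute with lifting, and hence allows the
expansion to be read as a substitution. -/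
theorem expand_rename {Γ' Δ' : Ctx} {κ : Sorting Z Γ Δ} {κ' : Sorting Z Γ' Δ'}
    {s' : Ren Γ Γ'} {r : Ren Δ Δ'} (h : ∀ ρ v, κ' ρ (s' ρ v) = (κ ρ v).map (r ρ) id)
    (j : Ren B Γ) (T : Meta s Γ) :
    expand ξ (fun ρ v => s' ρ (j ρ v)) κ' (T.rename s') = (expand ξ j κ T).rename r := by
  refine bisim (fun s Δ' T U => ∃ (Γ Δ Γ' : Ctx) (κ : Sorting Z Γ Δ) (κ' : Sorting Z Γ' Δ')
    (s' : Ren Γ Γ') (r : Ren Δ Δ') (j : Ren B Γ) (V : Meta s Γ),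
    (∀ ρ v, κ' ρ (s' ρ v) = (κ ρ v).map (r ρ) id) ∧
    T = expand ξ (fun ρ v => s' ρ (j ρ v)) κ' (V.rename s') ∧ U = (expand ξ j κ V).rename r) ?_
    ⟨_, _, _, κ, κ', s', r, j, T, h, rfl, rfl⟩
  rintro s Δ' _ _ ⟨Γ, Δ, Γ', κ, κ', s', r, j, T, h, rfl, rfl⟩
  cases T.view with
  | bot => simp only [expand_bot, rename_bot]; exact .bot
  | num n => simp only [expand_num, rename_num]; exact .num n
  | case G E =>
    simp only [expand_case, rename_case]
    exact .case ⟨_, _, _, κ, κ', s', r, j, _, h, rfl, rfl⟩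
      fun _ => ⟨_, _, _, κ, κ', s', r, j, _, h, rfl, rfl⟩
  | @app _ σ x Q =>
    rw [rename_app]
    rcases hx : κ _ x with y | z
    · rw [expand_app_inl ξ j κ hx, rename_app,
        expand_app_inl ξ _ κ' (y := r _ y) (by rw [h, hx]; rfl)]
      exact .app _ fun v => ⟨_, _, _, _, _, _, _, wkAfter j v.1.args, Q v,
        Sorting.lift_rename h v.1.args, by rw [wkAfter_lift], rfl⟩
    · rw [expand_app_inr ξ j κ hx, rename_beta,
        expand_app_inr ξ _ κ' (z := z) (by rw [h, hx]; rfl)]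
      exact .beta ⟨_, _, _, _, _, _, _, wkAfter j σ.args, _, Sorting.lift_rename h σ.args,
          by rw [wkAfter_lift, rename_rename, Ren.lift_lift], rfl⟩
        fun v => ⟨_, _, _, _, _, _, _, wkAfter j v.1.args, Q v,
          Sorting.lift_rename h v.1.args, by rw [wkAfter_lift], rfl⟩
  | @beta _ σ P Q =>
    rw [rename_beta, expand_beta, expand_beta, rename_beta]
    exact .beta ⟨_, _, _, _, _, _, _, wkAfter j σ.args, P, Sorting.lift_rename h σ.args,
        by rw [wkAfter_lift], rfl⟩
      fun v => ⟨_, _, _, _, _, _, _, wkAfter j v.1.args, Q v,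
        Sorting.lift_rename h v.1.args, by rw [wkAfter_lift], rfl⟩

/-- The substitution of the infinite expansions of the variables. -/
def expandSub (j : Ren B Γ) (κ : Sorting Z Γ Δ) : Sub Γ Δ := fun ρ v =>
  (κ ρ v).map id fun z => expand ξ (wkAfter j ρ.args) (κ.lift ρ.args)
    ((ofTerm (ξ ρ z).body).rename (j.lift ρ.args))

theorem expandSub_lift (σs : List Ty) :
    (expandSub ξ j κ).lift σs = expandSub ξ (wkAfter j σs) (κ.lift σs) := by
  refine Sub.ext' (fun ρ v => ?_) fun ρ v => ?_
  · rw [Sub.lift_wk, expandSub, expandSub, Sorting.lift_wk]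
    rcases κ ρ v with y | z
    · rfl
    · simp only [Sum.map_inr, Sub.renVal, id_eq]
      congr 1
      rw [← expand_rename ξ (κ := κ.lift ρ.args) (κ' := (κ.lift σs).lift ρ.args)
        (s' := Ren.lift (Ren.wk Γ σs) ρ.args)]
      · rw [rename_rename, Ren.lift_lift, ← wkAfter_lift]
        rfl
      · exact Sorting.lift_rename (fun ρ v => Sorting.lift_wk _ _) _
  · rw [Sub.lift_new, expandSub, Sorting.lift_new]
    rfl

/-- Expanding everywhere forever amounts to substituting once the fully expanded values. Applied to
those values themselves, this turns the corecursive definition into a fixed point equation. -/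
theorem expand_eq_subst (T : Meta s Γ) : expand ξ j κ T = T.subst (expandSub ξ j κ) := by
  refine bisim (fun s Δ T U => T = U ∨ ∃ (Γ : Ctx) (j : Ren B Γ) (κ : Sorting Z Γ Δ) (V : Meta s Γ),
    T = expand ξ j κ V ∧ U = V.subst (expandSub ξ j κ)) ?_ (.inr ⟨_, j, κ, T, rfl, rfl⟩)
  rintro s Δ _ _ (rfl | ⟨Γ, j, κ, T, rfl, rfl⟩)
  · exact Node.refl (fun _ _ _ => .inl rfl) _
  cases T.view with
  | bot => simp only [expand_bot, subst_bot]; exact .bot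
  | num n => simp only [expand_num, subst_num]; exact .num n
  | case G E =>
    simp only [expand_case, subst_case]
    exact .case (.inr ⟨_, _, _, _, rfl, rfl⟩) fun _ => .inr ⟨_, _, _, _, rfl, rfl⟩
  | app x Q =>
    rcases h : κ _ x with y | z
    · rw [expand_app_inl ξ j κ h, subst_app_inl _ (y := y) (by rw [expandSub, h]; rfl)]
      exact .app _ fun v => .inr ⟨_, _, _, _, rfl, by rw [expandSub_lift]⟩
    · rw [expand_app_inr ξ j κ h, subst_app_inr _ (by rw [expandSub, h]; rfl)]
      exact .beta (.inl rfl) fun v => .inr ⟨_, _, _, _, rfl, by rw [expandSub_lift]⟩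
  | beta P Q =>
    rw [expand_beta, subst_beta]
    exact .beta (.inr ⟨_, _, _, _, rfl, by rw [expandSub_lift]⟩)
      fun v => .inr ⟨_, _, _, _, rfl, by rw [expandSub_lift]⟩

/-! #### The infinite expansion is the supremum of the finite ones -/

/-- `Θ` expands once the variables to be expanded. -/
def Expands (j : Ren B Γ) (κ : Sorting Z Γ Δ) (Θ : Sub Γ Γ) : Prop := ∀ ρ v,
  (∀ y, κ ρ v = .inl y → Θ ρ v = .inl v) ∧
  ∀ z, κ ρ v = .inr z → Θ ρ v = .inr ((ofTerm (ξ ρ z).body).rename (j.lift ρ.args))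

variable {ξ j κ}

theorem Expands.lift {Θ : Sub Γ Γ} (h : Expands ξ j κ Θ) (σs : List Ty) :
    Expands ξ (wkAfter j σs) (κ.lift σs) (Θ.lift σs) := by
  intro ρ v
  rcases Var.wk_or_new σs v with ⟨w, rfl⟩ | ⟨w, rfl⟩
  · rw [Sorting.lift_wk, Sub.lift_wk]
    have hw := h ρ w
    rcases hk : κ ρ w with y | z
    · rw [hw.1 y hk]
      exact ⟨fun _ _ => rfl, fun z hz => by cases hz⟩
    · rw [hw.2 z hk]
      refine ⟨fun y hy => (by cases hy), fun z' hz => ?_⟩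
      cases hz
      rw [Sub.renVal, rename_rename, Ren.lift_lift]
      rfl
  · rw [Sorting.lift_new, Sub.lift_new]
    exact ⟨fun _ _ => rfl, fun z hz => by cases hz⟩

/-- The `m`-fold expansion, pruned. -/
def approx (κ : Sorting Z Γ Δ) (Θ : Sub Γ Γ) (m : ℕ) (T : Meta s Γ) : Meta s Δ :=
  pruneAlong κ.partial ((fun T : Meta s Γ => T.subst Θ)^[m] T)

theorem iterate_bot (Θ : Sub Γ Γ) (m : ℕ) :
    (fun T : Meta s Γ => T.subst Θ)^[m] (Meta.bot s Γ) = Meta.bot s Γ :=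
  Function.iterate_fixed (subst_bot Θ) m

theorem iterate_num (Θ : Sub Γ Γ) (m n : ℕ) :
    (fun T : Meta s Γ => T.subst Θ)^[m] (Meta.num n) = Meta.num n :=
  Function.iterate_fixed (subst_num Θ n) m

theorem iterate_case (Θ : Sub Γ Γ) (m : ℕ) (G : Meta .gnd Γ) (E : ℕ → Meta .exp Γ) :
    (fun T : Meta s Γ => T.subst Θ)^[m] (Meta.case G E) =
      Meta.case ((fun T => T.subst Θ)^[m] G) fun i => (fun T => T.subst Θ)^[m] (E i) := by
  induction m with
  | zero => rfl
  | succ m ih => simp only [Function.iterate_succ_apply', ih, subst_case]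

theorem iterate_app {Θ : Sub Γ Γ} {σ : Ty} {x : Var Γ σ} (h : Θ σ x = .inl x) (m : ℕ)
    (Q : ∀ v : Place σ.args, MProc Γ v.1) : (fun T : Meta .gnd Γ => T.subst Θ)^[m] (Meta.app x Q) =
      Meta.app x fun v => (fun T => T.subst (Θ.lift v.1.args))^[m] (Q v) := by
  induction m with
  | zero => rfl
  | succ m ih => simp only [Function.iterate_succ_apply', ih, subst_app_inl Θ h]

theorem iterate_beta (Θ : Sub Γ Γ) {σ : Ty} (m : ℕ) (P : MProc Γ σ)
    (Q : ∀ v : Place σ.args, MProc Γ v.1) : (fun T : Meta .gnd Γ => T.subst Θ)^[m] (Meta.beta P Q) =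
      Meta.beta ((fun T => T.subst (Θ.lift σ.args))^[m] P)
        fun v => (fun T => T.subst (Θ.lift v.1.args))^[m] (Q v) := by
  induction m with
  | zero => rfl
  | succ m ih => simp only [Function.iterate_succ_apply', ih, subst_beta]

theorem approx_bot (Θ : Sub Γ Γ) (m : ℕ) : approx κ Θ m (Meta.bot s Γ) = Meta.bot s Δ := by
  rw [approx, iterate_bot, pruneAlong_bot]

theorem approx_num (Θ : Sub Γ Γ) (m n : ℕ) : approx κ Θ m (Meta.num n : Meta s Γ) = Meta.num n := by
  rw [approx, iterate_num, pruneAlong_num]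

theorem approx_case (Θ : Sub Γ Γ) (m : ℕ) (G : Meta .gnd Γ) (E : ℕ → Meta .exp Γ) :
    approx κ Θ m (Meta.case G E : Meta s Γ) =
      Meta.case (approx κ Θ m G) fun i => approx κ Θ m (E i) := by
  rw [approx, iterate_case, pruneAlong_case]
  rfl

theorem approx_app_inl {Θ : Sub Γ Γ} (hΘ : Expands ξ j κ Θ) (m : ℕ) {σ : Ty} {x : Var Γ σ}
    {y : Var Δ σ} (h : κ σ x = .inl y) (Q : ∀ v : Place σ.args, MProc Γ v.1) :
    approx κ Θ m (Meta.app x Q) =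
      Meta.app y fun v => approx (κ.lift v.1.args) (Θ.lift v.1.args) m (Q v) := by
  rw [approx, iterate_app ((hΘ σ x).1 y h),
    pruneAlong_app_some (y := y) _ (by rw [Sorting.partial, h]; rfl)]
  simp only [Sorting.partial_lift]
  rfl

theorem approx_beta (Θ : Sub Γ Γ) (m : ℕ) {σ : Ty} (P : MProc Γ σ)
    (Q : ∀ v : Place σ.args, MProc Γ v.1) : approx κ Θ m (Meta.beta P Q) =
      Meta.beta (approx (κ.lift σ.args) (Θ.lift σ.args) m P)
        fun v => approx (κ.lift v.1.args) (Θ.lift v.1.args) m (Q v) := by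
  rw [approx, iterate_beta, pruneAlong_beta]
  simp only [Sorting.partial_lift]
  rfl

theorem approx_app_inr_zero {Θ : Sub Γ Γ} {σ : Ty} {x : Var Γ σ} {z : Var Z σ}
    (h : κ σ x = .inr z) (Q : ∀ v : Place σ.args, MProc Γ v.1) :
    approx κ Θ 0 (Meta.app x Q) = Meta.bot _ _ :=
  pruneAlong_app_none _ (by rw [Sorting.partial, h]; rfl) _

/-- The first round of substitution is spent on replacing `x`, so the inserted operator undergoes
only `m` further rounds, whereas the arguments undergo all `m + 1`. -/
theorem approx_app_inr_succ {Θ : Sub Γ Γ} (hΘ : Expands ξ j κ Θ) (m : ℕ) {σ : Ty} {x : Var Γ σ}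
    {z : Var Z σ} (h : κ σ x = .inr z) (Q : ∀ v : Place σ.args, MProc Γ v.1) :
    approx κ Θ (m + 1) (Meta.app x Q) =
      Meta.beta (approx (κ.lift σ.args) (Θ.lift σ.args) m
          ((ofTerm (ξ σ z).body).rename (j.lift σ.args)))
        fun v => approx (κ.lift v.1.args) (Θ.lift v.1.args) (m + 1) (Q v) := by
  rw [approx, Function.iterate_succ_apply, subst_app_inr Θ ((hΘ σ x).2 z h)]
  exact approx_beta _ _ _ _

/-- The finite stage agrees with the infinite expansion node by node, except where the rounds are
used up and pruning leaves `⊥`. -/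
theorem approx_le_expand {Θ : Sub Γ Γ} (hΘ : Expands ξ j κ Θ) (m : ℕ) (T : Meta s Γ) :
    approx κ Θ m T ≤ expand ξ j κ T := by
  refine Tree.le_coind (S := metaSig) (fun i t u => ∃ (Γ : Ctx) (j : Ren B Γ) (κ : Sorting Z Γ i.2)
    (Θ : Sub Γ Γ) (m : ℕ) (T : Meta i.1 Γ), Expands ξ j κ Θ ∧ t = approx κ Θ m T ∧
      u = expand ξ j κ T) ?_ ⟨Γ, j, κ, Θ, m, T, hΘ, rfl, rfl⟩
  rintro ⟨s, Δ⟩ _ _ ⟨Γ, j, κ, Θ, m, T, hΘ, rfl, rfl⟩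
  cases T.view with
  | bot => exact .inl (approx_bot _ _)
  | num n =>
    rw [approx_num, expand_num]
    exact .inr ⟨_, _, _, rfl, rfl, fun b => nomatch b⟩
  | case G E =>
    rw [approx_case, expand_case]
    refine .inr ⟨_, _, _, rfl, rfl, ?_⟩
    rintro (_ | i) <;> exact ⟨_, _, _, _, _, _, hΘ, rfl, rfl⟩
  | @app _ σ x Q =>
    rcases h : κ σ x with y | z
    · rw [approx_app_inl hΘ m h, expand_app_inl ξ j κ h]
      exact .inr ⟨_, _, _, rfl, rfl, fun v => ⟨_, _, _, _, _, _, hΘ.lift v.1.args, rfl, rfl⟩⟩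
    · cases m with
      | zero => exact .inl (approx_app_inr_zero h Q)
      | succ m =>
        rw [approx_app_inr_succ hΘ m h, expand_app_inr ξ j κ h]
        refine .inr ⟨_, _, _, rfl, rfl, ?_⟩
        rintro (_ | v)
        · exact ⟨_, _, _, _, _, _, hΘ.lift σ.args, rfl, rfl⟩
        · exact ⟨_, _, _, _, _, _, hΘ.lift v.1.args, rfl, rfl⟩
  | @beta _ σ P Q =>
    rw [approx_beta, expand_beta]
    refine .inr ⟨_, _, _, rfl, rfl, ?_⟩
    rintro (_ | v)
    · exact ⟨_, _, _, _, _, _, hΘ.lift σ.args, rfl, rfl⟩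
    · exact ⟨_, _, _, _, _, _, hΘ.lift v.1.args, rfl, rfl⟩

theorem case_le_case {G G' : Meta .gnd Γ} {E E' : ℕ → Meta .exp Γ}
    (h : (Meta.case G E : Meta s Γ) ≤ Meta.case G' E') : G ≤ G' ∧ ∀ i, E i ≤ E' i := by
  obtain ⟨G'', E'', he, hG, hE⟩ := case_le_iff.1 h
  have h := congrArg (Tree.dest (S := metaSig)) he
  simp only [dest_case, Sigma.mk.injEq, heq_eq_eq, true_and] at h
  have h₁ := congrFun h none
  have h₂ := fun i => congrFun h (some i)
  dsimp only at h₁ h₂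
  subst h₁
  exact ⟨hG, fun i => (h₂ i).symm ▸ hE i⟩

theorem app_le_app {σ : Ty} {x : Var Γ σ} {Q Q' : ∀ v : Place σ.args, MProc Γ v.1}
    (h : Meta.app x Q ≤ Meta.app x Q') (v : Place σ.args) : Q v ≤ Q' v := by
  obtain ⟨Q'', he, hQ⟩ := app_le_iff.1 h
  have h := congrArg (Tree.dest (S := metaSig)) he
  simp only [dest_app, Sigma.mk.injEq, heq_eq_eq, true_and] at h
  exact h ▸ hQ v

theorem beta_le_beta {σ : Ty} {P P' : MProc Γ σ} {Q Q' : ∀ v : Place σ.args, MProc Γ v.1}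
    (h : Meta.beta P Q ≤ Meta.beta P' Q') : P ≤ P' ∧ ∀ v, Q v ≤ Q' v := by
  obtain ⟨P'', Q'', he, hP, hQ⟩ := beta_le_iff.1 h
  have h := congrArg (Tree.dest (S := metaSig)) he
  simp only [dest_beta, Sigma.mk.injEq, heq_eq_eq, true_and] at h
  have h₁ := congrFun h none
  have h₂ := fun i => congrFun h (some i)
  dsimp only at h₁ h₂
  subst h₁
  exact ⟨hP, fun i => (h₂ i).symm ▸ hQ i⟩

/-- Stage `N`, or stage `N + 1` at a variable to be expanded, already fixes the root of `U`.
Bounding all stages from `N` on, and not one stage only, is what passes to the subterms in the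
coinduction. -/
theorem expand_le {Θ : Sub Γ Γ} (hΘ : Expands ξ j κ Θ) {T : Meta s Γ} {U : Meta s Δ} {N : ℕ}
    (h : ∀ m ≥ N, approx κ Θ m T ≤ U) : expand ξ j κ T ≤ U := by
  refine Tree.le_coind (S := metaSig) (fun i t u => ∃ (Γ : Ctx) (j : Ren B Γ) (κ : Sorting Z Γ i.2)
    (Θ : Sub Γ Γ) (N : ℕ) (T : Meta i.1 Γ), Expands ξ j κ Θ ∧ t = expand ξ j κ T ∧
      ∀ m ≥ N, approx κ Θ m T ≤ u) ?_ ⟨Γ, j, κ, Θ, N, T, hΘ, rfl, h⟩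
  rintro ⟨s, Δ⟩ _ U ⟨Γ, j, κ, Θ, N, T, hΘ, rfl, h⟩
  dsimp only at T κ
  cases T.view with
  | bot => exact .inl (expand_bot _ _ _)
  | num n =>
    have hN := h N le_rfl
    rw [approx_num, num_le_iff] at hN
    rw [expand_num, hN]
    exact .inr ⟨_, _, _, rfl, rfl, fun b => nomatch b⟩
  | case G E =>
    have hN := h N le_rfl
    rw [approx_case] at hN
    obtain ⟨G', E', rfl, -, -⟩ := case_le_iff.1 hN
    simp only [approx_case] at h
    have h := fun m hm => case_le_case (h m hm)
    rw [expand_case]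
    refine .inr ⟨_, _, _, rfl, rfl, ?_⟩
    rintro (_ | i)
    · exact ⟨_, _, _, _, N, _, hΘ, rfl, fun m hm => (h m hm).1⟩
    · exact ⟨_, _, _, _, N, _, hΘ, rfl, fun m hm => (h m hm).2 i⟩
  | @app _ σ x Q =>
    rcases hx : κ σ x with y | z
    · simp only [approx_app_inl hΘ _ hx] at h
      obtain ⟨Q', rfl, -⟩ := app_le_iff.1 (h N le_rfl)
      have h := fun m hm => app_le_app (h m hm)
      rw [expand_app_inl ξ j κ hx]
      exact .inr ⟨_, _, _, rfl, rfl, fun v =>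
        ⟨_, _, _, _, N, _, hΘ.lift v.1.args, rfl, fun m hm => h m hm v⟩⟩
    -- At stage `0` this application may be pruned to `⊥` and reveals nothing about `U`, so only
    -- successor stages are used.
    · have h : ∀ m ≥ N, approx κ Θ (m + 1) (Meta.app x Q) ≤ U := fun m hm => h _ (by omega)
      simp only [approx_app_inr_succ hΘ _ hx] at h
      obtain ⟨P', Q', rfl, -, -⟩ := beta_le_iff.1 (h N le_rfl)
      have h := fun m hm => beta_le_beta (h m hm)
      rw [expand_app_inr ξ j κ hx]
      refine .inr ⟨_, _, _, rfl, rfl, ?_⟩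
      rintro (_ | v)
      · exact ⟨_, _, _, _, N, _, hΘ.lift σ.args, rfl, fun m hm => (h m hm).1⟩
      -- The arguments are known to be bounded at stages `m + 1` with `m ≥ N`, so their threshold is
      -- `N + 1`; for the operator it remains `N`.
      · refine ⟨_, _, _, _, N + 1, _, hΘ.lift v.1.args, rfl, fun m hm => ?_⟩
        obtain ⟨m, rfl⟩ : ∃ k, m = k + 1 := ⟨m - 1, by omega⟩
        exact (h m (by omega)).2 v
  | @beta _ σ P Q =>
    simp only [approx_beta] at h
    obtain ⟨P', Q', rfl, -, -⟩ := beta_le_iff.1 (h N le_rfl)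
    have h := fun m hm => beta_le_beta (h m hm)
    rw [expand_beta]
    refine .inr ⟨_, _, _, rfl, rfl, ?_⟩
    rintro (_ | v)
    · exact ⟨_, _, _, _, N, _, hΘ.lift σ.args, rfl, fun m hm => (h m hm).1⟩
    · exact ⟨_, _, _, _, N, _, hΘ.lift v.1.args, rfl, fun m hm => (h m hm).2 v⟩

end Meta

variable {Γ : Ctx}

theorem plugIter_eq (Z : List Ty) (e : Exp (ext Γ Z)) (ξ : ∀ ρ, Var Z ρ → Proc (ext Γ Z) ρ)
    (m : ℕ) : plugIter Γ Z e ξ m =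
      (fun T : Meta .exp (ext Γ Z) => T.subst (plugSub Γ Z ξ))^[m] (Meta.ofTerm e) := by
  induction m with
  | zero => rfl
  | succ m ih => rw [plugIter, ih, Function.iterate_succ_apply']

theorem expands_plugSub (Z : List Ty) (ξ : ∀ ρ, Var Z ρ → Proc (ext Γ Z) ρ) :
    Meta.Expands (Γ := ext Γ Z) (Δ := Γ) ξ (fun _ v => v) (fun _ v => Var.split Z v)
      (plugSub Γ Z ξ) := by
  intro ρ v
  rcases Var.wk_or_new Z v with ⟨w, rfl⟩ | ⟨w, rfl⟩
  · simp only [Var.split_wk, plugSub]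
    exact ⟨fun y hy => (by cases hy; trivial), fun z hz => by cases hz⟩
  · simp only [Var.split_new, plugSub]
    refine ⟨fun y hy => (by cases hy), fun z hz => ?_⟩
    cases hz
    rw [Ren.lift_id, Meta.rename_id]

/-- Plugging is the infinite expansion. -/
theorem plug_eq (Z : List Ty) (e : Exp (ext Γ Z)) (ξ : ∀ ρ, Var Z ρ → Proc (ext Γ Z) ρ) :
    plug Γ Z e ξ = Meta.expand ξ (fun _ v => v) (fun _ v => Var.split Z v) (Meta.ofTerm e) := by
  have h := expands_plugSub Z ξ
  have heq : ∀ m, Meta.prune Z (plugIter Γ Z e ξ m) =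
      Meta.approx (fun _ v => Var.split Z v) (plugSub Γ Z ξ) m (Meta.ofTerm e) := fun m => by
    rw [plugIter_eq]; rfl
  refine Tree.sup_eq ⟨?_, fun U hU => Meta.expand_le h (N := 0) fun m _ => ?_⟩
  · rintro _ ⟨m, rfl⟩
    dsimp only
    rw [heq]
    exact Meta.approx_le_expand h m _
  · rw [← heq]
    exact hU ⟨m, rfl⟩

/-- The meta-procedure assigned to the recursion variable by plugging. -/
theorem exists_plug_eq_subst {σ : Ty} (e : Exp (ext Γ (σ :: σ.args)))
    (q : ∀ ρ, Var σ.args ρ → Proc Γ ρ) :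
    ∃ A : MProc Γ σ,
      A = Meta.subst ((Sub.single [σ] fun | ⟨_, .here⟩ => A).lift σ.args) (Meta.ofTerm e) ∧
      plug Γ (σ :: σ.args) e (recAssign (Proc.mk σ e) q) =
        (Meta.ofTerm e).subst (Sub.single (σ :: σ.args) fun
          | ⟨_, .here⟩ => A
          | ⟨ρ, .there v⟩ => Meta.ofTerm (q ρ v).body) := by
  set ξ := recAssign (Proc.mk σ e) q with hξ
  set S : Sub (ext Γ (σ :: σ.args)) Γ :=
    Meta.expandSub ξ (fun _ v => v) (fun _ v => Var.split (σ :: σ.args) v) with hS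
  have hwk : ∀ ρ (v : Var Γ ρ), S ρ (Var.wk (σ :: σ.args) v) = .inl v := fun ρ v => by
    rw [hS, Meta.expandSub]
    simp only [Var.split_wk]
    rfl
  -- The fixed point equation of plugging: the full expansion of a variable of `Z` is its assigned
  -- procedure, expanded by the same `S`.
  have hnew : ∀ ρ (v : Var (σ :: σ.args) ρ), S ρ (Var.new Γ v) =
      .inr ((Meta.ofTerm (ξ ρ v).body).subst (S.lift ρ.args)) := fun ρ v => by
    conv_lhs => rw [hS, Meta.expandSub]
    simp only [Var.split_new, Sum.map_inr, Meta.expand_eq_subst, ← Meta.expandSub_lift]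
    rw [Ren.lift_id, Meta.rename_id]
  -- `S` is the identity on `Γ`, so anything weakened from `Γ` is unaffected. In particular each
  -- `qᵢ` is already its own full expansion.
  have hrel : ∀ σs, (fun ρ v => S.lift σs ρ ((Ren.wk Γ (σ :: σ.args)).lift σs ρ v)) =
      (fun _ v => .inl v) := fun σs => by
    refine Sub.ext' (fun ρ v => ?_) fun ρ v => ?_
    · rw [Ren.lift_wk, Sub.lift_wk, Ren.wk, hwk]; rfl
    · rw [Ren.lift_new, Sub.lift_new]
  let A : MProc Γ σ := (Meta.ofTerm (ξ σ .here).body).subst (S.lift σ.args)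
  have hthere : ∀ ρ (v : Var σ.args ρ),
      (Meta.ofTerm (ξ ρ (.there v)).body).subst (S.lift ρ.args) = Meta.ofTerm (q ρ v).body := by
    intro ρ v
    change Meta.subst _ (Meta.ofTerm (Exp.rename _ _)) = _
    rw [Meta.ofTerm_rename, Meta.rename_subst]
    refine Eq.trans ?_ (Meta.subst_id _)
    congr 1
    exact hrel ρ.args
  refine ⟨A, ?_, ?_⟩
  -- The procedure assigned to `z` is `λ x⃗. e` weakened: it binds its own `x⃗`, and `z` is its only
  -- free variable from `Z`. Its expansion therefore replaces `z` by `A` and nothing else.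
  · change Meta.subst _ (Meta.ofTerm (Exp.rename _ _)) = _
    rw [Meta.ofTerm_rename, Meta.rename_subst]
    congr 1
    refine Sub.ext' (σs := σ.args) (fun ρ v => ?_) fun ρ v => ?_
    · rw [Ren.lift_wk, Sub.lift_wk, Sub.lift_wk]
      cases v with
      | here =>
        have h₁ := hnew σ .here
        have h₂ := Sub.single_new (Γ := Γ) (σs := [σ]) (fun | ⟨_, .here⟩ => A) .here
        exact congrArg _ (h₁.trans h₂.symm)
      | there v =>
        have h₁ := hwk ρ v
        have h₂ := Sub.single_wk (Γ := Γ) (σs := [σ]) (fun | ⟨_, .here⟩ => A) v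
        exact congrArg _ (h₁.trans h₂.symm)
    · rw [Ren.lift_new, Sub.lift_new, Sub.lift_new]
  · rw [plug_eq, Meta.expand_eq_subst, ← hS]
    congr 1
    refine Sub.ext' (fun ρ v => ?_) fun ρ v => ?_
    · rw [hwk, Sub.single_wk]
    · rw [hnew, Sub.single_new]
      cases v with
      | here => rfl
      | there v => rw [hthere]; rfl

/-- The right-hand side involves an arbitrary assignment with `g ↦ p`, the left-hand side does not,
so comparing two assignments through `A` shows that only the value at `g` matters. -/
theorem ev_eq_procF_inst {σ : Ty} {p : Proc Γ (.arrow σ σ)} {A : MProc Γ σ}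
    (hA : A = Meta.subst ((Sub.single [σ] fun | ⟨_, .here⟩ => A).lift σ.args) (Meta.ofTerm p.body))
    {Δ : Ctx} {g : Var Δ (.arrow σ σ)} {θ : SSub Δ Γ} (hg : θ _ g = p) :
    ev ⟨A, []⟩ = ((procF σ g).inst θ).body := by
  rw [(fixM_csim hA (g := g) (θ := θ.toSub) (by rw [SSub.toSub, hg])).ev_eq]
  exact ev_subst_lift _ _

theorem single_oneArg {σ : Ty} (p : Proc Γ σ) : SSub.single [σ] (oneArg p) σ .here = p :=
  SSub.single_new (Γ := Γ) (σs := [σ]) (oneArg p) .here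

/-- Instances of `F_σ[g]` depend on the value of `g` only. -/
theorem procF_inst {Δ : Ctx} {σ : Ty} (g : Var Δ (.arrow σ σ)) (θ : SSub Δ Γ) :
    (procF σ g).inst θ = (θ _ g).fix := by
  -- Plugging serves here only to supply a solution `A` of the equation; the arguments play no role
  -- and are taken to be `⊥`.
  obtain ⟨A, hA, -⟩ := exists_plug_eq_subst (θ _ g).body fun ρ _ => Proc.mk ρ (Exp.bot _)
  rw [Proc.fix_eq]
  exact (ev_eq_procF_inst hA rfl).symm.trans (ev_eq_procF_inst hA (single_oneArg _))

theorem procF_eq_fix {σ : Ty} (g : Var Γ (.arrow σ σ)) : procF σ g = (eta _ Γ g).fix := by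
  rw [← procF_inst g fun ρ v => eta ρ Γ v, Proc.inst_eta]

theorem Proc.fix_inst {Δ : Ctx} {σ : Ty} (p : Proc Γ (.arrow σ σ)) (θ : SSub Γ Δ) :
    p.fix.inst θ = (p.inst θ).fix := by
  rw [Proc.fix_eq, Proc.inst_inst, procF_inst, SSub.comp, single_oneArg]

/-- The recursion rule in terms of application and the recursion operator. -/
theorem eval_plug {σ : Ty} (e : Exp (ext Γ (σ :: σ.args)))
    (q : ∀ ρ, Var σ.args ρ → Proc Γ ρ) :
    Proc.const (Meta.eval (plug Γ (σ :: σ.args) e (recAssign (Proc.mk σ e) q))) =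
      (Proc.fix (Proc.mk (.arrow σ σ) e)).apps q := by
  obtain ⟨A, hA, hplug⟩ := exists_plug_eq_subst e q
  set p : Proc Γ (.arrow σ σ) := Proc.mk (.arrow σ σ) e with hp
  have hfix : ev ⟨A, []⟩ = p.fix.body := by
    rw [Proc.fix_eq]
    exact ev_eq_procF_inst hA (single_oneArg p)
  -- `A` satisfies its equation literally, so its value satisfies it for evaluated application. This
  -- puts the recursive value next to `q⃗` as an ordinary argument of `p`, which is the form in
  -- which `hplug` presents plugging.
  have happ : p.fix = p.apply p.fix := by
    rw [Proc.apply_eq]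
    refine hfix.symm.trans ?_
    rw [hA]
    refine SubRel.ev_eq (SubRel.toSub_lift (SSub.single_rel ?_) _) _
    rintro ⟨_, _ | ⟨⟨⟩⟩⟩
    exact hfix
  rw [happ]
  refine Eq.trans ?_ (Proc.apps_apply p (consArg p.fix q)).symm
  rw [eval_eq_ev, hplug]
  refine SubRel.ev_eq (SSub.single_rel ?_) _
  rintro ⟨_, _ | v⟩
  · exact hfix
  · exact ev_ofTerm _

end

end NSP

/-! ### The two inclusions -/

namespace NSP

noncomputable section

open Cfg

variable {Γ Δ : Ctx} {k : ℕ}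

/-! ### Further laws of substitution -/

theorem Proc.wk_nil {σ : Ty} (p : Proc Γ σ) : p.wk [] = p := by
  rw [Proc.wk_eq]
  exact p.inst_eta

theorem Exp.wk_nil (e : Exp Γ) : e.wk [] = e := by
  rw [Exp.wk_eq]
  exact e.inst_eta

theorem SSub.lift_nil (θ : SSub Γ Δ) : θ.lift [] = θ := by
  funext ρ v
  exact (SSub.lift_wk (σs := []) θ v).trans (Proc.wk_nil _)

theorem Proc.const_inst (θ : SSub Γ Δ) (e : Exp Γ) :
    (Proc.const e).inst θ = Proc.const (e.inst θ) := by
  change Exp.inst (θ.lift []) e = _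
  rw [SSub.lift_nil]
  rfl

@[simp] theorem SSub.lift_here (θ : SSub Γ Δ) {σ : Ty} :
    θ.lift [σ] σ .here = eta σ (σ :: Δ) .here :=
  SSub.lift_new (σs := [σ]) θ .here

@[simp] theorem SSub.lift_there (θ : SSub Γ Δ) {σ ρ : Ty} (v : Var Γ ρ) :
    θ.lift [σ] ρ (.there v) = (θ ρ v).wk [σ] :=
  SSub.lift_wk (σs := [σ]) θ v

@[simp] theorem SSub.single_here {σ : Ty} (q : ∀ ρ, Var [σ] ρ → Proc Γ ρ) :
    SSub.single [σ] q σ .here = q σ .here :=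
  SSub.single_new (Γ := Γ) (σs := [σ]) q .here

@[simp] theorem SSub.single_there {σ ρ : Ty} (q : ∀ ρ, Var [σ] ρ → Proc Γ ρ) (v : Var Γ ρ) :
    SSub.single [σ] q ρ (.there v) = eta ρ Γ v :=
  SSub.single_wk (σs := [σ]) q v

theorem Exp.ofOption_inst (θ : SSub Γ Δ) (o : Option ℕ) :
    (Exp.ofOption o : Exp Γ).inst θ = Exp.ofOption o := by
  cases o with
  | none => exact Exp.inst_bot θ
  | some n => exact Exp.inst_num θ n

theorem Exp.ofOption_wk (σs : List Ty) (o : Option ℕ) :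
    (Exp.ofOption o : Exp Γ).wk σs = Exp.ofOption o := by
  rw [Exp.wk_eq, Exp.ofOption_inst]

theorem Proc.apps_nat (p : Proc Γ .nat) (q : ∀ ρ, Var Ty.nat.args ρ → Proc Γ ρ) : p.apps q = p :=
  Exp.inst_eta _

theorem Exp.case_inst (θ : SSub Γ Δ) {σ : Ty} (x : Var Γ σ)
    (q : ∀ ρ, Var σ.args ρ → Proc Γ ρ) : (Proc.const (Exp.case x q Exp.num)).inst θ =
      (θ σ x).apps fun ρ v => (q ρ v).inst θ := by
  rw [Proc.const_inst, Exp.inst_case]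
  simp only [Exp.inst_num]
  exact congrArg Proc.const (Exp.replaceLeaves_num_self _)

theorem eta_apps {σ : Ty} (x : Var Γ σ) (q : ∀ ρ, Var σ.args ρ → Proc Γ ρ) :
    (eta σ Γ x).apps q = Proc.const (Exp.case x q Exp.num) := by
  rw [← (Proc.const (Exp.case x q Exp.num)).inst_eta, Exp.case_inst]
  simp only [Proc.inst_eta]

/-- Any procedure is recovered from its application to generic arguments. This reduces questions at
all types to ground type, where the recursion rule and the constants operate. -/
theorem Proc.wk_apps_eta {σ : Ty} (p : Proc Γ σ) :
    (p.wk σ.args).apps (fun ρ v => eta ρ _ (Var.new Γ v)) = Proc.const p.body := by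
  have h : (SSub.ofRen ((Ren.wk Γ σ.args).lift σ.args)).comp
      (SSub.single σ.args fun ρ v => eta ρ _ (Var.new Γ v)) = fun ρ v => eta ρ _ v := by
    refine SSub.ext' (fun ρ v => ?_) fun ρ v => ?_
    · rw [SSub.comp, SSub.ofRen, inst_of_eta, Ren.lift_wk, SSub.single_wk]
      rfl
    · rw [SSub.comp, SSub.ofRen, inst_of_eta, Ren.lift_new, SSub.single_new]
  change Exp.inst _ (Exp.rename ((Ren.wk Γ σ.args).lift σ.args) p.body) = _
  rw [← Exp.inst_ofRen, Exp.inst_inst, h, Exp.inst_eta]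
  rfl

theorem Proc.replaceLeaves_unlam {σ τ : Ty} (p : Proc Γ (.arrow σ τ)) (e : ℕ → Exp Γ) :
    (p.replaceLeaves e).unlam = p.unlam.replaceLeaves fun i => (e i).wk [σ] := by
  refine congrArg (Exp.replaceLeaves _) (funext fun i => ?_)
  refine Eq.trans ?_ (Exp.rename_rename _ _ _).symm
  rfl

theorem Exp.caseNat_replaceLeaves (x : Var Γ .nat) (e : ℕ → Exp Γ) :
    (Proc.const (Exp.caseNat x Exp.num)).replaceLeaves e = Proc.const (Exp.caseNat x e) := by
  refine (congrArg (Exp.replaceLeaves _) (funext fun i => Exp.wk_nil (e i))).trans ?_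
  refine (Exp.replaceLeaves_case _ _ _ _).trans ?_
  simp only [Exp.replaceLeaves_num]
  rfl

theorem eta_nat (x : Var Γ .nat) : eta .nat Γ x = Proc.const (Exp.caseNat x Exp.num) := by
  rw [eta]
  exact congrArg (fun q => Exp.case x q Exp.num) (funext fun _ => funext fun v => nomatch v)

theorem Exp.caseNat_inst (θ : SSub Γ Δ) (x : Var Γ .nat) (e : ℕ → Exp Γ) :
    (Exp.caseNat x e).inst θ = (θ .nat x).body.replaceLeaves fun i => (e i).inst θ := by
  rw [Exp.caseNat, Exp.inst_case]
  congr 1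
  exact Exp.inst_eta _

theorem Proc.lam_apply {σ τ : Ty} (p : Proc (σ :: Γ) τ) (q : Proc Γ σ) :
    p.lam.apply q = p.inst (SSub.single [σ] (oneArg q)) := Proc.apply_eq _ _

/-- The branches of a test for zero. -/
def zeroCase (d e : Exp Γ) : ℕ → Exp Γ
  | 0 => d
  | _ + 1 => e

theorem zeroCase_inst (θ : SSub Γ Δ) (d e : Exp Γ) :
    (fun i => (zeroCase d e i).inst θ) = zeroCase (d.inst θ) (e.inst θ) := by
  funext i
  cases i <;> rfl

theorem zeroCase_wk (σs : List Ty) (d e : Exp Γ) :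
    (fun i => (zeroCase d e i).wk σs) = zeroCase (d.wk σs) (e.wk σs) := by
  funext i
  cases i <;> rfl

/-- The test for zero of the numeral leaves of a variable. -/
def zeroTest (Γ : Ctx) (σ : Ty) : Proc (.nat :: .nat :: σ :: Γ) σ :=
  (eta σ _ (.there (.there .here))).replaceLeaves
    (zeroCase (eta .nat _ (.there .here)).body (eta .nat _ .here).body)

theorem Proc.body_inst (p : Proc Γ .nat) (θ : SSub Γ Δ) : p.body.inst θ = (p.inst θ).body :=
  (Proc.const_inst θ p.body).symm

theorem Proc.body_wk (p : Proc Γ .nat) (σs : List Ty) : (p.wk σs).body = p.body.wk σs := by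
  rw [Proc.wk_eq, ← Proc.body_inst, ← Exp.wk_eq]

theorem zeroTest_apply {σ : Ty} (p : Proc Γ σ) (d e : Proc Γ .nat) :
    (((zeroTest Γ σ).lam.lam.lam.apply p).apply d).apply e =
      p.replaceLeaves (zeroCase d.body e.body) := by
  rw [Proc.lam_apply, Proc.inst_lam, Proc.inst_lam, Proc.lam_apply, Proc.inst_lam, Proc.lam_apply,
    zeroTest]
  simp only [Proc.replaceLeaves_inst, zeroCase_inst, Proc.body_inst, inst_of_eta, SSub.lift_there,
    SSub.lift_here, SSub.single_here, eta_wk, Proc.wk_inst_lift,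
    Proc.wk_inst_single, oneArg, Var.wk]

theorem denote_ifzero : denote (.ifzero : Tm k Γ _) = (zeroTest Γ .nat).lam.lam.lam := by
  rw [denote, zeroTest, eta_nat, Exp.caseNat_replaceLeaves, eta_nat, eta_nat]
  congr 5

/-- A class of procedures closed under abstraction is closed under the formation of procedures
`λ x⃗. e`. -/
theorem Proc.mk_induction {C : ∀ Γ σ, Proc Γ σ → Prop}
    (hlam : ∀ {Γ σ τ} (p : Proc (σ :: Γ) τ), C _ _ p → C Γ (.arrow σ τ) p.lam) :
    ∀ (σ : Ty) {Γ : Ctx} (e : Exp (ext Γ σ.args)), C _ .nat (Proc.const e) → C Γ σ (Proc.mk σ e)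
  | .nat, _, _, h => h
  | .arrow _ τ, _, e, h => hlam _ (Proc.mk_induction hlam τ e h)

/-! ### The generated class is closed under the constructs of the language -/

namespace Generated

theorem mk {σ : Ty} {e : Exp (ext Γ σ.args)} (h : Generated k _ .nat (Proc.const e)) :
    Generated k Γ σ (Proc.mk σ e) :=
  Proc.mk_induction (C := Generated k) lam σ e h

theorem eta {Γ : Ctx} (σ : Ty) (x : Var Γ σ) : Generated k Γ σ (NSP.eta σ Γ x) := by
  rw [NSP.eta]
  refine mk (var _ _ fun ρ v => ?_)
  have := Var.sizeOf_lt v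
  exact eta ρ _
termination_by sizeOf σ

/-- Closure under a class of substitutions. -/
theorem inst_of {C : ∀ Γ Δ, SSub Γ Δ → Prop}
    (hlift : ∀ {Γ Δ θ} σ, C Γ Δ θ → C (σ :: Γ) (σ :: Δ) (θ.lift [σ]))
    (hvar : ∀ {Γ Δ θ}, C Γ Δ θ → ∀ {σ} (x : Var Γ σ) (q : ∀ ρ, Var σ.args ρ → Proc Δ ρ),
      (∀ ρ v, Generated k Δ ρ (q ρ v)) → Generated k Δ .nat ((θ σ x).apps q))
    {σ : Ty} {p : Proc Γ σ} (hp : Generated k Γ σ p) :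
    ∀ {Δ} {θ : SSub Γ Δ}, C Γ Δ θ → Generated k Δ σ (p.inst θ) := by
  induction hp with
  | var x q _ ih =>
    intro Δ θ hθ
    rw [Exp.case_inst]
    exact hvar hθ x _ fun ρ v => ih ρ v hθ
  | lam p _ ih =>
    intro Δ θ hθ
    rw [Proc.inst_lam]
    exact lam _ (ih (hlift _ hθ))
  | num n =>
    intro Δ θ _
    rw [Proc.const_inst, Exp.inst_num]
    exact num n
  | oracle p _ f ih =>
    intro Δ θ hθ
    rw [Proc.replaceLeaves_inst]
    simp only [Exp.ofOption_inst]
    exact oracle _ (ih hθ) f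
  | ifzero p d e _ _ _ ihp ihd ihe =>
    intro Δ θ hθ
    have hd := ihd hθ
    have he := ihe hθ
    rw [Proc.const_inst] at hd he
    rw [Proc.replaceLeaves_inst]
    convert ifzero _ _ _ (ihp hθ) hd he using 2
    funext i
    cases i <;> rfl
  | recursion hσ e _ q _ ihe ihq =>
    intro Δ θ hθ
    have h := Proc.apps_inst θ (Proc.fix (Proc.mk _ e)) q
    rw [eval_plug]
    -- In the form `(fix p) q⃗` given by `eval_plug`, recursion commutes with substitution; the
    -- instantiated form is then folded back into the rule.
    refine (congrArg (Generated k Δ .nat) ((Proc.const_inst θ _).trans h)).mpr ?_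
    rw [Proc.fix_inst]
    refine (congrArg (Generated k Δ .nat) (eval_plug _ _)).mp ?_
    exact recursion hσ _ (ihe hθ) _ fun ρ v => ihq ρ v hθ

theorem rename {σ : Ty} {p : Proc Γ σ} (hp : Generated k Γ σ p) (r : Ren Γ Δ) :
    Generated k Δ σ (p.rename r) := by
  rw [← Proc.inst_ofRen]
  refine inst_of (C := fun _ _ θ => ∃ r, θ = SSub.ofRen r) ?_ ?_ hp ⟨r, rfl⟩
  · rintro Γ Δ _ σ ⟨r, rfl⟩
    exact ⟨_, SSub.lift_ofRen r [σ]⟩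
  · rintro Γ Δ _ ⟨r, rfl⟩ σ x q hq
    rw [SSub.ofRen, eta_apps]
    exact var _ _ hq

/-- Inversion of abstraction. Only abstraction and the two leaf rules conclude at an arrow type; the
leaf rules pass below the binder once `d` and `e` are weakened. -/
theorem unlam {ρ : Ty} {p : Proc Γ ρ} (hp : Generated k Γ ρ p) {σ τ : Ty} (h : ρ = .arrow σ τ) :
    Generated k (σ :: Γ) τ (h ▸ p).unlam := by
  induction hp with
  | var => cases h
  | num => cases h
  | recursion => cases h
  | lam p hp => cases h; exact hp
  | oracle p _ f ih =>
    subst h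
    rw [Proc.replaceLeaves_unlam]
    simp only [Exp.ofOption_wk]
    exact oracle _ (ih rfl) f
  | ifzero p d e _ hd he ih =>
    subst h
    rw [Proc.replaceLeaves_unlam]
    have hd := hd.rename (Ren.wk _ [σ])
    have he := he.rename (Ren.wk _ [σ])
    convert ifzero _ (d.wk [σ]) (e.wk [σ]) (ih rfl) ?_ ?_ using 2
    · funext i
      cases i <;> rfl
    · rw [← Proc.inst_ofRen, Proc.const_inst, ← Exp.wk_eq] at hd
      exact hd
    · rw [← Proc.inst_ofRen, Proc.const_inst, ← Exp.wk_eq] at he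
      exact he

theorem body : ∀ {σ : Ty} {Γ : Ctx} {p : Proc Γ σ}, Generated k Γ σ p →
    Generated k (ext Γ σ.args) .nat (Proc.const p.body)
  | .nat, _, _, h => h
  | .arrow σ τ, Γ, _, h => body (σ := τ) (Γ := σ :: Γ) (h.unlam rfl)

/-- The substitutions whose values are variables or generated procedures of types of bounded size. -/
def Bounded (k n : ℕ) (Γ Δ : Ctx) (θ : SSub Γ Δ) : Prop := ∀ ρ v,
  (∃ y, θ ρ v = NSP.eta ρ Δ y) ∨ (sizeOf ρ < n ∧ Generated k Δ ρ (θ ρ v))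

/-- Termination of hereditary substitution: an outer induction on a bound for the size of the
substituted types, and inside it an induction on the derivation of `p`, supplied by `inst_of`. -/
theorem inst_of_bounded (n : ℕ) {σ : Ty} {p : Proc Γ σ} (hp : Generated k Γ σ p) {θ : SSub Γ Δ}
    (hθ : Bounded k n Γ Δ θ) : Generated k Δ σ (p.inst θ) := by
  induction n using Nat.strong_induction_on generalizing Γ Δ σ with
  | _ n ih =>
    refine inst_of (C := Bounded k n) ?_ ?_ hp hθ
    · intro Γ Δ θ σ hθ ρ v
      cases v with
      | here => exact .inl ⟨_, SSub.lift_here θ⟩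
      | there v =>
        rw [SSub.lift_there]
        refine (hθ ρ v).imp ?_ fun h => ⟨h.1, h.2.rename _⟩
        rintro ⟨y, hy⟩
        exact ⟨_, by rw [hy, eta_wk]⟩
    · intro Γ Δ θ hθ σ x q hq
      rcases hθ σ x with ⟨y, hy⟩ | ⟨hn, hx⟩
      · rw [hy, eta_apps]
        exact var _ _ hq
      -- A head variable is replaced by a generated procedure. What remains is a substitution in its
      -- body of arguments whose types are components of `σ`, so the outer hypothesis applies with
      -- bound `sizeOf σ`.
      · rw [Proc.apps, ← Proc.const_inst]
        refine ih _ hn hx.body fun ρ v => ?_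
        rcases Var.wk_or_new _ v with ⟨w, rfl⟩ | ⟨w, rfl⟩
        · exact .inl ⟨w, SSub.single_wk _ _⟩
        · rw [SSub.single_new]
          exact .inr ⟨Var.sizeOf_lt w, hq _ _⟩

theorem apply {σ τ : Ty} {p : Proc Γ (.arrow σ τ)} {q : Proc Γ σ}
    (hp : Generated k Γ (.arrow σ τ) p) (hq : Generated k Γ σ q) : Generated k Γ τ (p.apply q) := by
  rw [Proc.apply_eq]
  refine inst_of_bounded (sizeOf σ + 1) (hp.unlam rfl) fun ρ v => ?_
  cases v with
  | here => exact .inr ⟨Nat.lt_succ_self _, by rw [SSub.single_here]; exact hq⟩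
  | there v => exact .inl ⟨v, SSub.single_there _ v⟩

/-- The recursion rule gives only fully applied fixed points. Applying to generic arguments `x⃗^η`
and abstracting them recovers the fixed point itself. -/
theorem fix {σ : Ty} (hσ : σ.level ≤ k) {p : Proc Γ (.arrow σ σ)}
    (hp : Generated k Γ (.arrow σ σ) p) : Generated k Γ σ p.fix := by
  refine mk (e := p.fix.body) ?_
  rw [← Proc.wk_apps_eta, Proc.wk_eq, Proc.fix_inst, ← Proc.wk_eq]
  refine (congrArg (Generated k _ .nat) (eval_plug _ _)).mp ?_
  exact recursion hσ _ (hp.rename _) _ fun ρ v => eta ρ _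

theorem caseNat_oracle (x : Var Γ .nat) (f : ℕ → Option ℕ) :
    Generated k Γ .nat (Proc.const (Exp.caseNat x fun i => Exp.ofOption (f i))) := by
  rw [← Exp.caseNat_replaceLeaves, ← eta_nat]
  exact oracle _ (eta _ x) f

theorem denote : ∀ {Γ : Ctx} {σ : Ty} (M : Tm k Γ σ), Generated k Γ σ (NSP.denote M)
  | _, _, .var x => eta _ x
  | _, _, .lam M => lam _ (denote M)
  | _, _, .app M N => (denote M).apply (denote N)
  | _, _, .num n => num n
  | _, _, .suc => lam _ (caseNat_oracle .here fun i => some (i + 1))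
  | _, _, .pre => by
    refine lam _ ?_
    -- Truncated subtraction gives the predecessor its value `0` at `0`.
    convert caseNat_oracle .here fun i => some (i - 1) using 3
    funext i
    cases i <;> rfl
  | _, _, .ifzero => by
    refine lam _ (lam _ (lam _ ?_))
    rw [← Exp.caseNat_replaceLeaves, ← eta_nat]
    refine ifzero _ _ _ (eta _ _) ?_ ?_
    all_goals
      rw [← eta_nat]
      exact eta _ _
  | _, _, .Y σ hσ => by
    refine lam _ ?_
    rw [procF_eq_fix]
    exact (eta _ _).fix hσ
  | _, _, .oracle f => lam _ (caseNat_oracle .here f)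

end Generated

/-! ### The denotable class is closed under the generating rules -/

namespace Denotable

theorem var {σ : Ty} (x : Var Γ σ) : Denotable k Γ σ (eta σ Γ x) := ⟨.var x, rfl⟩

theorem lam {σ τ : Ty} {p : Proc (σ :: Γ) τ} : Denotable k (σ :: Γ) τ p →
    Denotable k Γ (.arrow σ τ) p.lam
  | ⟨M, h⟩ => ⟨.lam M, congrArg _ h⟩

theorem apply {σ τ : Ty} {p : Proc Γ (.arrow σ τ)} {q : Proc Γ σ} :
    Denotable k Γ (.arrow σ τ) p → Denotable k Γ σ q → Denotable k Γ τ (p.apply q)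
  | ⟨M, h⟩, ⟨N, h'⟩ => ⟨.app M N, congrArg₂ _ h h'⟩

theorem num (n : ℕ) : Denotable k Γ .nat (Proc.const (Exp.num n)) := ⟨.num n, rfl⟩

theorem mk {σ : Ty} {e : Exp (ext Γ σ.args)} (h : Denotable k _ .nat (Proc.const e)) :
    Denotable k Γ σ (Proc.mk σ e) :=
  Proc.mk_induction (C := Denotable k) (fun _ => lam) σ e h

theorem apps : ∀ {σ : Ty} {p : Proc Γ σ} {q : ∀ ρ, Var σ.args ρ → Proc Γ ρ},
    Denotable k Γ σ p → (∀ ρ v, Denotable k Γ ρ (q ρ v)) → Denotable k Γ .nat (p.apps q)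
  | .nat, p, q, hp, _ => by rwa [Proc.apps_nat]
  | .arrow σ τ, p, q, hp, hq => by
    rw [← Proc.apps_apply]
    exact apps (hp.apply (hq _ _)) fun ρ v => hq ρ _

/-- The body of an η-expansion is an ordinary application of variables. It is the ground type term
on which the constants can act below the binders. -/
theorem var_body {σ : Ty} (x : Var Γ σ) :
    Denotable k (ext Γ σ.args) .nat (Proc.const (eta σ Γ x).body) := by
  rw [← Proc.wk_apps_eta, eta_wk]
  exact (var _).apps fun _ _ => var _

theorem fix {σ : Ty} (hσ : σ.level ≤ k) {p : Proc Γ (.arrow σ σ)}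
    (hp : Denotable k Γ (.arrow σ σ) p) : Denotable k Γ σ p.fix :=
  apply ⟨.Y σ hσ, rfl⟩ hp

theorem const_oracle {p : Proc Γ .nat} (hp : Denotable k Γ .nat p) (f : ℕ → Option ℕ) :
    Denotable k Γ .nat (Proc.const (p.body.replaceLeaves fun i => Exp.ofOption (f i))) := by
  have h := apply (k := k) ⟨.oracle f, rfl⟩ hp
  rw [denote, Proc.apply_eq] at h
  convert h using 1
  refine ((Proc.const_inst _ _).trans ?_).symm
  refine (congrArg Proc.const (Exp.caseNat_inst _ _ _)).trans ?_
  rw [SSub.single_here]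
  simp only [Exp.ofOption_inst]
  rfl

theorem const_ifzero {p q r : Proc Γ .nat} (hp : Denotable k Γ .nat p) (hq : Denotable k Γ .nat q)
    (hr : Denotable k Γ .nat r) : 
    Denotable k Γ .nat (Proc.const (p.body.replaceLeaves (zeroCase q.body r.body))) := by
  have h := apply (apply (apply (k := k) ⟨.ifzero, denote_ifzero⟩ hp) hq) hr
  rw [zeroTest_apply] at h
  convert h using 1
  refine congrArg (Exp.replaceLeaves _) ?_
  simp only [Exp.wk_nil]

/-- Leaf replacement in a variable gives leaf replacement in all procedures. -/
theorem oracle {σ : Ty} {p : Proc Γ σ} (hp : Denotable k Γ σ p) (f : ℕ → Option ℕ) :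
    Denotable k Γ σ (p.replaceLeaves fun i => Exp.ofOption (f i)) := by
  have h : Denotable k (σ :: Γ) σ ((eta σ _ .here).replaceLeaves fun i => Exp.ofOption (f i)) := by
    refine mk ?_
    simp only [Exp.ofOption_wk]
    exact const_oracle (var_body _) f
  have h := h.lam.apply hp
  rw [Proc.apply_eq] at h
  change Denotable k Γ σ (Proc.inst _ (Proc.replaceLeaves _ _)) at h
  rw [Proc.replaceLeaves_inst, inst_of_eta, SSub.single_here] at h
  simp only [Exp.ofOption_inst] at h
  exact h

theorem ifzero {σ : Ty} {p : Proc Γ σ} {d e : Exp Γ} (hp : Denotable k Γ σ p)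
    (hd : Denotable k Γ .nat (Proc.const d)) (he : Denotable k Γ .nat (Proc.const e)) :
    Denotable k Γ σ (p.replaceLeaves fun
      | 0 => d
      | _ + 1 => e) := by
  -- The language tests for zero only at type `ℕ`. The test is therefore made on the body of an
  -- η-expanded variable of type `σ`, and is transferred to `p`, `d` and `e` by abstraction and
  -- application.
  have h : Denotable k _ σ (zeroTest Γ σ) := by
    have h := const_ifzero (var_body (k := k) (σ := σ) (Γ := .nat :: .nat :: σ :: Γ)
      (.there (.there .here))) (var (Var.wk _ (.there .here))) (var (Var.wk _ .here))
    rw [← eta_wk, ← eta_wk, Proc.body_wk, Proc.body_wk, ← zeroCase_wk] at h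
    exact h.mk
  have h := ((h.lam.lam.lam.apply hp).apply hd).apply he
  rw [zeroTest_apply] at h
  convert h using 2
  funext i
  cases i <;> rfl

end Denotable

theorem Generated.denotable {σ : Ty} {p : Proc Γ σ} (hp : Generated k Γ σ p) :
    Denotable k Γ σ p := by
  induction hp with
  | var x q _ ih =>
    rw [← eta_apps]
    exact (Denotable.var x).apps ih
  | lam p _ ih => exact ih.lam
  | num n => exact .num n
  | oracle p _ f ih => exact ih.oracle f
  | ifzero p d e _ _ _ ihp ihd ihe => exact ihp.ifzero ihd ihe
  | recursion hσ e _ q _ ihe ihq =>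
    rw [eval_plug]
    exact (ihe.fix hσ).apps ihq

end

end NSP

theorem theorem3p9 (k : ℕ) (Γ : NSP.Ctx) (σ : NSP.Ty) (p : NSP.Proc Γ σ) :
    NSP.Denotable k Γ σ p ↔ NSP.Generated k Γ σ p := by
  constructor
  · rintro ⟨M, rfl⟩
    exact NSP.Generated.denote M
  · exact NSP.Generated.denotable
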